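/- **Notation.** For $k\in\mathbb R$ let $X_k=L^1((0,\infty),x^k\,dx)$, let $X_{k,+}$ be its cone of a.e. non-negative elements, let $X_{k,w}$ be $X_k$ with its weak topology, and put $\mathfrak m_k(f)=\int_0^\infty x^k f(x)\,dx$ for $f\in X_k$. **Assumptions.** Let $k_0\in(0,1)$, $p_0\in(1,1+k_0)$ and $k_0\le\lambda_1\le\lambda_2\le 1$; put $\lambda=\lambda_1+\lambda_2$ and $$\Phi(x_1,x_2)=x_1^{\lambda_1}x_2^{\lambda_2}+x_2^{\lambda_1}x_1^{\lambda_2},\qquad x_1,x_2>0 .$$ Let $\beta_*\ge 0$ be a measurable function on $(0,\infty)^3$ and let $$\beta(x_3,x_1,x_2)=\beta_*(x_3,x_1,x_2)\mathbf 1_{(0,x_1)}(x_3)+\beta_*(x_3,x_2,x_1)\mathbf 1_{(0,x_2)}(x_3).$$ Assume that, for all $x_1,x_2>0$ and all $p\in[1,p_0]$, $$\int_0^{x_1}x_3\,\beta_*(x_3,x_1,x_2)\,dx_3=x_1,\qquad \int_0^{x_1}x_3^{k_0}\beta_*(x_3,x_1,x_2)^p\,dx_3\le E_{k_0,p}\,x_1^{k_0+1-p},$$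 with positive constants $E_{k_0,p}$ independent of $x_1,x_2$ (the number of fragments $\int_0^{x_1}\beta_*(x_3,x_1,x_2)\,dx_3$ may be infinite). Let $u^{in}\in X_{k_0,+}\cap X_1\cap X_{1+k_0}$ with $\rho:=\mathfrak m_1(u^{in})>0$. **Weak solutions.** Let $\mathscr T^{k_0}$ be the set of bounded functions $\varsigma\in C^{0,k_0}([0,\infty))$ with $\varsigma(0)=0$, and let $\Upsilon_\varsigma(x_1,x_2)=\int_0^{x_1+x_2}\varsigma(x_3)\beta(x_3,x_1,x_2)\,dx_3-\varsigma(x_1)-\varsigma(x_2)$. For $T\in(0,\infty]$, a weak solution on $[0,T)$ to the collision-induced fragmentation equation with kernel $\Phi$, daughter distribution $\beta$ and initial datum $u^{in}$ is a non-negative function $u\in C([0,T),X_{k_0,w})\cap L^\infty((0,T),X_1)$ with $u(0)=u^{in}$ a.e. such that, for all $t\in(0,T)$, the function $(\tau,x_1,x_2)\mapsto (x_1^{k_0}+x_2^{k_0})\Phi(x_1,x_2)u(\tau,x_1)u(\tau,x_2)$ is in $L^1((0,t)\times(0,\infty)^2)$ and, for all $\varsigma\in\mathscr T^{k_0}$,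 $$\int_0^\infty\varsigma\, u(t)\,dx_1=\int_0^\infty\varsigma\, u^{in}\,dx_1+\frac12\int_0^t\int_0^\infty\int_0^\infty\Upsilon_\varsigma(x_1,x_2)\Phi(x_1,x_2)u(\tau,x_1)u(\tau,x_2)\,dx_2\,dx_1\,d\tau .$$ It is mass-conserving on $[0,T)$ if $\mathfrak m_1(u(t))=\mathfrak m_1(u^{in})$ for all $t\in[0,T)$. **Theorem.** Under these assumptions there exists at least one mass-conserving weak solution on $[0,T_*)$, where $T_*=\infty$ if $\lambda\in[1,2]$ and $T_*=T_{k_0}$ if $\lambda\in(0,1)$. Here $$T_{k_0}=\frac{1-k_0}{2(1-\lambda)c_3}\,\mathfrak m_{k_0}(u^{in})^{-\frac{1-\lambda}{1-k_0}},\qquad c_3=E_{k_0,1}\max\Big\{c_1\rho^{\frac{\lambda_2-k_0}{1-k_0}},\,c_2\rho^{\frac{\lambda_1-k_0}{1-k_0}}\Big\},$$ $$c_i=\max\Big\{\rho^{\frac{\lambda_i}{1-k_0}},\,\rho^{\frac{1-\lambda_i}{k_0}}\,\mathfrak m_{1+k_0}(u^{in})^{\frac{k_0+\lambda_i-1}{k_0}}\Big\},\qquad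 i=1,2 .$$ -/

import Mathlib

open MeasureTheory Set

namespace CollFrag

noncomputable section

/-- The measure `x ^ k dx` on the size interval `(0, ∞)`. -/
def sizeMeasure (k : ℝ) : Measure ℝ :=
  (volume.restrict (Ioi (0 : ℝ))).withDensity fun x => ENNReal.ofReal (x ^ k)

/-- The Banach space `X_k = L¹((0, ∞), x ^ k dx)`. -/
abbrev X (k : ℝ) : Type := Lp ℝ 1 (sizeMeasure k)

/-- The function `f` represents an element of `X_k`. -/
def MemX (k : ℝ) (f : ℝ → ℝ) : Prop := Integrable f (sizeMeasure k)

/-- The function `f` represents an element of the positive cone of `X_k`. -/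
def MemXPos (k : ℝ) (f : ℝ → ℝ) : Prop :=
  MemX k f ∧ ∀ᵐ x ∂(sizeMeasure k), 0 ≤ f x

/-- The moment `𝗆_k(f) = ∫₀^∞ x ^ k f(x) dx` (meaningful for `f ∈ X_k`). -/
def moment (k : ℝ) (f : ℝ → ℝ) : ℝ := ∫ x in Ioi (0 : ℝ), x ^ k * f x

/-- The collision kernel `Φ(x₁, x₂) = x₁ ^ l₁ x₂ ^ l₂ + x₂ ^ l₁ x₁ ^ l₂`. -/
def collisionKernel (l₁ l₂ x₁ x₂ : ℝ) : ℝ := x₁ ^ l₁ * x₂ ^ l₂ + x₂ ^ l₁ * x₁ ^ l₂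

/-- The time interval `[0, T)` for `T ∈ (0, ∞]`. -/
def timeIco (T : EReal) : Set ℝ := {t | 0 ≤ t ∧ (t : EReal) < T}

/-- The time interval `(0, T)` for `T ∈ (0, ∞]`. -/
def timeIoo (T : EReal) : Set ℝ := {t | 0 < t ∧ (t : EReal) < T}

/-- `u ∈ C([0, T), X_{k,w})`: every `u t` is in `X_k`, and `t ↦ u t` is continuous for the
weak topology of the Banach space `X_k`. -/
def WeaklyContinuousIn (k : ℝ) (T : EReal) (u : ℝ → ℝ → ℝ) : Prop :=
  ∃ v : ℝ → X k,
    (∀ t ∈ timeIco T, ∀ᵐ x ∂(sizeMeasure k), v t x = u t x) ∧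
    ContinuousOn (fun t => toWeakSpace ℝ (X k) (v t)) (timeIco T)

/-- `u ∈ L^∞((0, T), X_k)` (Bochner space). -/
def EssBoundedIn (k : ℝ) (T : EReal) (u : ℝ → ℝ → ℝ) : Prop :=
  ∃ v : ℝ → X k,
    (∀ᵐ t ∂(volume.restrict (timeIoo T)), ∀ᵐ x ∂(sizeMeasure k), v t x = u t x) ∧
    MemLp v ⊤ (volume.restrict (timeIoo T))

/-- Test functions: `ς ∈ C^{0,k₀}([0, ∞)) ∩ L^∞(0, ∞)` with `ς(0) = 0`. -/
structure IsTestFunction (k₀ : ℝ) (ς : ℝ → ℝ) : Prop where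
  holder : ∃ C : ℝ, ∀ x y : ℝ, 0 ≤ x → 0 ≤ y → |ς x - ς y| ≤ C * |x - y| ^ k₀
  bounded : ∃ C : ℝ, ∀ x : ℝ, 0 ≤ x → |ς x| ≤ C
  zero : ς 0 = 0

/-- `Υ_ς(x₁, x₂) = ∫₀^{x₁+x₂} ς(x₃) β(x₃, x₁, x₂) dx₃ - ς(x₁) - ς(x₂)`. -/
def upsilon (β : ℝ → ℝ → ℝ → ℝ) (ς : ℝ → ℝ) (x₁ x₂ : ℝ) : ℝ :=
  (∫ x₃ in Ioo (0 : ℝ) (x₁ + x₂), ς x₃ * β x₃ x₁ x₂) - ς x₁ - ς x₂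

/-- Weak solutions on `[0, T)` to the collision-induced fragmentation equation with collision
kernel `Φ`, daughter distribution `β` and initial datum `uin`. -/
structure IsWeakSolution (k₀ : ℝ) (Φ : ℝ → ℝ → ℝ) (β : ℝ → ℝ → ℝ → ℝ) (uin : ℝ → ℝ)
    (T : EReal) (u : ℝ → ℝ → ℝ) : Prop where
  nonneg : ∀ t ∈ timeIco T, ∀ x : ℝ, 0 < x → 0 ≤ u t x
  weaklyContinuous : WeaklyContinuousIn k₀ T u
  essBounded : EssBoundedIn 1 T u
  initial : ∀ᵐ x ∂(volume.restrict (Ioi (0 : ℝ))), u 0 x = uin x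
  integrable : ∀ t ∈ timeIoo T,
    IntegrableOn
      (fun z : ℝ × ℝ × ℝ =>
        (z.2.1 ^ k₀ + z.2.2 ^ k₀) * Φ z.2.1 z.2.2 * u z.1 z.2.1 * u z.1 z.2.2)
      (Ioo (0 : ℝ) t ×ˢ Ioi (0 : ℝ) ×ˢ Ioi (0 : ℝ))
  weakForm : ∀ t ∈ timeIoo T, ∀ ς : ℝ → ℝ, IsTestFunction k₀ ς →
    ∫ x₁ in Ioi (0 : ℝ), ς x₁ * u t x₁ =
      (∫ x₁ in Ioi (0 : ℝ), ς x₁ * uin x₁) +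
        1 / 2 * ∫ τ in Ioo (0 : ℝ) t, ∫ x₁ in Ioi (0 : ℝ), ∫ x₂ in Ioi (0 : ℝ),
          upsilon β ς x₁ x₂ * Φ x₁ x₂ * u τ x₁ * u τ x₂

/-- Mass conservation on `[0, T)`: `𝗆₁(u(t)) = 𝗆₁(uin)` for all `t ∈ [0, T)`. -/
def IsMassConserving (uin : ℝ → ℝ) (T : EReal) (u : ℝ → ℝ → ℝ) : Prop :=
  ∀ t ∈ timeIco T, MemX 1 (u t) ∧ moment 1 (u t) = moment 1 uin

/-- The constant `c₁` (for `l = l₁`), respectively `c₂` (for `l = l₂`):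
`max {ρ ^ (l / (1 - k₀)), ρ ^ ((1 - l) / k₀) 𝗆_{1+k₀}(uin) ^ ((k₀ + l - 1) / k₀)}`,
where `ρ = 𝗆₁(uin)`. -/
def momentConst (k₀ l : ℝ) (uin : ℝ → ℝ) : ℝ :=
  max (moment 1 uin ^ (l / (1 - k₀)))
    (moment 1 uin ^ ((1 - l) / k₀) * moment (1 + k₀) uin ^ ((k₀ + l - 1) / k₀))

/-- The constant `c₃ = E max {c₁ ρ ^ ((l₂ - k₀) / (1 - k₀)), c₂ ρ ^ ((l₁ - k₀) / (1 - k₀))}`,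
where `E` is the constant of the weighted `L¹`-bound on the daughter distribution. -/
def growthConst (k₀ l₁ l₂ E : ℝ) (uin : ℝ → ℝ) : ℝ :=
  E * max (momentConst k₀ l₁ uin * moment 1 uin ^ ((l₂ - k₀) / (1 - k₀)))
    (momentConst k₀ l₂ uin * moment 1 uin ^ ((l₁ - k₀) / (1 - k₀)))

/-- The time `T_{k₀} = (1 - k₀) / (2 (1 - l) c₃) 𝗆_{k₀}(uin) ^ (-(1 - l) / (1 - k₀))`, where
`l = l₁ + l₂`. -/
def localTime (k₀ l₁ l₂ E : ℝ) (uin : ℝ → ℝ) : ℝ :=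
  (1 - k₀) / (2 * (1 - (l₁ + l₂)) * growthConst k₀ l₁ l₂ E uin) *
    moment k₀ uin ^ (-((1 - (l₁ + l₂)) / (1 - k₀)))

open Classical in
/-- The existence time: `T_{k₀}` if `l₁ + l₂ < 1`, and `∞` otherwise. -/
def existenceTime (k₀ l₁ l₂ E : ℝ) (uin : ℝ → ℝ) : EReal :=
  if l₁ + l₂ < 1 then ((localTime k₀ l₁ l₂ E uin : ℝ) : EReal) else ⊤

end

end CollFrag

/-! The solution is the limit of explicit Euler schemes for `u' = coll u u`, started from the
initial datum cut off at a size `R`. No compactness argument is used: the schemes form a Cauchy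
sequence. Two mechanisms make this work.

Damping. The `L^p` bound with `p = p₀ > 1` prevents the fragments from concentrating at the size of
the parent, so shattering a particle of size `y` turns `y ^ (1 + k)` into a total of at most `(1 -
δ) * y ^ (1 + k)` (`exists_damping`). Hence the moment of order `1 + k` decreases, and what it loses
controls the time integral of the product of the moments of orders `1 + k + l₂` and `l₁`. Mass is
conserved and the moment of order `1 + k` is bounded, so the moment of order `l₁` stays away from
zero (`exists_le_moment`); therefore the moment of order `1 + k + l₂` is integrable in time,
uniformly in `R` and the step (`FragKernel.sum_high_moment_le`). Only the moment of order `k` may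
grow. Moment interpolation bounds its production by a function `g` of itself, affine if `l₁ + l₂ ≥
1` and a superlinear power otherwise. The solution of `y' = g y` dominates all Euler schemes; it is
global in the first case and blows up exactly at `localTime` in the second
(`exists_growthBound_majorant`).

Stability. Use the norm with weight `x ^ k + x ^ (1 + k)`. The difference `w = v - u` of two
solutions satisfies `w' = coll w v + coll u w`. In the first term the loss compensates the large
fragments, because fragmentation never increases the superlinear part of the weight; this term costs
only the norms of `w` and `v` (`FragKernel.wnorm_add_coll_le`). The second term costs the moment of
order `1 + k + l₂` of `u`, which is integrable in time (`FragKernel.wnorm_coll_le`). Gronwall's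
inequality then gives a constant independent of `R` and the step
(`FragKernel.wnorm_euler_sub_euler_le`). Only the consistency error depends on `R`, and the step is
chosen after `R`.

With nested time grids and errors of size `2 ^ (-n)`, consecutive approximations are geometrically
close on each `[0, S]` with `S < T`. Mass and the weak form of the collision operator are continuous
in the norm, so the limit is a mass-conserving weak solution. -/

namespace CollFrag

noncomputable section

/-! ### Weighted integrability, moments and the weighted norm. -/

/-- Lebesgue measure on the half-line `(0, ∞)`. -/
abbrev μ₀ : Measure ℝ := volume.restrict (Ioi (0 : ℝ))

lemma ae_pos : ∀ᵐ x ∂μ₀, 0 < x := ae_restrict_mem measurableSet_Ioi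

lemma ae_pos_prod : ∀ᵐ z ∂(μ₀.prod μ₀), 0 < z.1 ∧ 0 < z.2 := by
  rw [μ₀, Measure.prod_restrict]
  exact ae_restrict_mem (measurableSet_Ioi.prod measurableSet_Ioi)

/-- The reason why two extreme moments control all moments in between; the cases `x ≤ 1` and `x ≥ 1`
each use one of the two terms. -/
lemma rpow_le_rpow_add_rpow {x a b c : ℝ} (hx : 0 < x) (hab : a ≤ b) (hbc : b ≤ c) :
    x ^ b ≤ x ^ a + x ^ c := by
  have ha := Real.rpow_pos_of_pos hx a
  have hc := Real.rpow_pos_of_pos hx c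
  rcases le_total x 1 with h | h
  · linarith [Real.rpow_le_rpow_of_exponent_ge hx h hab]
  · linarith [Real.rpow_le_rpow_of_exponent_le h hbc]

lemma measurable_rpow_mul {f : ℝ → ℝ} (hf : Measurable f) (a : ℝ) :
    Measurable fun x : ℝ => x ^ a * f x := (measurable_id.pow_const a).mul hf

lemma integrable_rpow_of_le_of_le {f : ℝ → ℝ} (hf : Measurable f) {a b c : ℝ} (hab : a ≤ b)
    (hbc : b ≤ c) (ha : Integrable (fun x => x ^ a * f x) μ₀)
    (hc : Integrable (fun x => x ^ c * f x) μ₀) : Integrable (fun x => x ^ b * f x) μ₀ := by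
  refine (ha.norm.add hc.norm).mono' (measurable_rpow_mul hf b).aestronglyMeasurable ?_
  filter_upwards [ae_pos] with x hx
  simp only [Pi.add_apply, norm_mul, Real.norm_eq_abs,
    abs_of_pos (Real.rpow_pos_of_pos hx _)]
  rw [← add_mul]
  exact mul_le_mul_of_nonneg_right (rpow_le_rpow_add_rpow hx hab hbc) (abs_nonneg _)

/-- Measurable functions with finite moments of orders `k` and `1 + k`. -/
structure Weighted (k : ℝ) (f : ℝ → ℝ) : Prop where
  meas : Measurable f
  low : Integrable (fun x => x ^ k * f x) μ₀
  high : Integrable (fun x => x ^ (1 + k) * f x) μ₀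

lemma integrable_mul_abs {g f : ℝ → ℝ} (hg : ∀ x, 0 < x → 0 ≤ g x)
    (h : Integrable (fun x => g x * f x) μ₀) : Integrable (fun x => g x * |f x|) μ₀ := by
  refine h.abs.congr ?_
  filter_upwards [ae_pos] with x hx
  rw [abs_mul, abs_of_nonneg (hg x hx)]

lemma integrable_rpow_mul_abs {f : ℝ → ℝ} {a : ℝ}
    (h : Integrable (fun x => x ^ a * f x) μ₀) : Integrable (fun x => x ^ a * |f x|) μ₀ :=
  integrable_mul_abs (fun _ hx => (Real.rpow_pos_of_pos hx a).le) h

namespace Weighted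

variable {k : ℝ} {f g : ℝ → ℝ}

lemma integrable_rpow (hf : Weighted k f) {a : ℝ} (h₁ : k ≤ a) (h₂ : a ≤ 1 + k) :
    Integrable (fun x => x ^ a * f x) μ₀ :=
  integrable_rpow_of_le_of_le hf.meas h₁ h₂ hf.low hf.high

lemma abs (hf : Weighted k f) : Weighted k fun x => |f x| :=
  ⟨by simpa only [Real.norm_eq_abs] using hf.meas.norm, integrable_rpow_mul_abs hf.low,
    integrable_rpow_mul_abs hf.high⟩

lemma add (hf : Weighted k f) (hg : Weighted k g) : Weighted k fun x => f x + g x :=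
  ⟨hf.meas.add hg.meas, by simp only [mul_add]; exact hf.low.add hg.low,
    by simp only [mul_add]; exact hf.high.add hg.high⟩

lemma sub (hf : Weighted k f) (hg : Weighted k g) : Weighted k fun x => f x - g x :=
  ⟨hf.meas.sub hg.meas, by simp only [mul_sub]; exact hf.low.sub hg.low,
    by simp only [mul_sub]; exact hf.high.sub hg.high⟩

lemma const_mul (hf : Weighted k f) (c : ℝ) : Weighted k fun x => c * f x :=
  ⟨hf.meas.const_mul c, by simpa only [mul_left_comm] using hf.low.const_mul c,
    by simpa only [mul_left_comm] using hf.high.const_mul c⟩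

end Weighted

/-- The norm of `L¹((0, ∞), (x ^ k + x ^ (1 + k)) dx)`. -/
def wnorm (k : ℝ) (f : ℝ → ℝ) : ℝ := ∫ x, (x ^ k + x ^ (1 + k)) * |f x| ∂μ₀

lemma moment_eq (a : ℝ) (f : ℝ → ℝ) : moment a f = ∫ x, x ^ a * f x ∂μ₀ := rfl

lemma moment_nonneg (a : ℝ) {f : ℝ → ℝ} (hf : ∀ x, 0 ≤ f x) : 0 ≤ moment a f := by
  refine integral_nonneg_of_ae ?_
  filter_upwards [ae_pos] with x hx
  exact mul_nonneg (Real.rpow_nonneg hx.le _) (hf x)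

lemma moment_abs_of_nonneg {a : ℝ} {f : ℝ → ℝ} (hf : ∀ x, 0 ≤ f x) :
    moment a (fun x => |f x|) = moment a f := by
  simp only [abs_of_nonneg (hf _)]

lemma abs_moment_le (a : ℝ) (f : ℝ → ℝ) : |moment a f| ≤ moment a fun x => |f x| := by
  refine (abs_integral_le_integral_abs).trans (le_of_eq (integral_congr_ae ?_))
  filter_upwards [ae_pos] with x hx
  simp only [abs_mul, abs_of_pos (Real.rpow_pos_of_pos hx a)]

lemma moment_congr_ae {f g : ℝ → ℝ} (a : ℝ) (h : f =ᵐ[μ₀] g) : moment a f = moment a g := by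
  refine integral_congr_ae ?_
  filter_upwards [h] with x hx
  rw [hx]

lemma moment_add {f g : ℝ → ℝ} {a : ℝ} (hf : Integrable (fun x => x ^ a * f x) μ₀)
    (hg : Integrable (fun x => x ^ a * g x) μ₀) :
    moment a (fun x => f x + g x) = moment a f + moment a g := by
  simp only [moment_eq, mul_add]
  exact integral_add hf hg

lemma moment_sub {f g : ℝ → ℝ} {a : ℝ} (hf : Integrable (fun x => x ^ a * f x) μ₀)
    (hg : Integrable (fun x => x ^ a * g x) μ₀) :
    moment a (fun x => f x - g x) = moment a f - moment a g := by
  simp only [moment_eq, mul_sub]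
  exact integral_sub hf hg

lemma moment_const_mul {f : ℝ → ℝ} (a c : ℝ) :
    moment a (fun x => c * f x) = c * moment a f := by
  simp only [moment_eq, mul_left_comm _ c]
  exact integral_const_mul c _

lemma wnorm_nonneg (k : ℝ) (f : ℝ → ℝ) : 0 ≤ wnorm k f := by
  refine integral_nonneg_of_ae ?_
  filter_upwards [ae_pos] with x hx
  exact mul_nonneg (add_nonneg (Real.rpow_nonneg hx.le _) (Real.rpow_nonneg hx.le _))
    (abs_nonneg _)

lemma wnorm_congr_ae {k : ℝ} {f g : ℝ → ℝ} (h : f =ᵐ[μ₀] g) : wnorm k f = wnorm k g := by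
  refine integral_congr_ae ?_
  filter_upwards [h] with x hx
  rw [hx]

lemma wnorm_const_mul (k c : ℝ) (f : ℝ → ℝ) :
    wnorm k (fun x => c * f x) = |c| * wnorm k f := by
  simp only [wnorm, abs_mul, mul_left_comm _ |c|]
  exact integral_const_mul _ _

namespace Weighted

variable {k : ℝ} {f g : ℝ → ℝ}

lemma integrable_weight (hf : Weighted k f) :
    Integrable (fun x => (x ^ k + x ^ (1 + k)) * |f x|) μ₀ := by
  simp only [add_mul]
  exact hf.abs.low.add hf.abs.high

lemma wnorm_eq (hf : Weighted k f) :
    wnorm k f = moment k (fun x => |f x|) + moment (1 + k) fun x => |f x| := by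
  simp only [wnorm, moment_eq, add_mul]
  exact integral_add hf.abs.low hf.abs.high

lemma moment_abs_le (hf : Weighted k f) {a : ℝ} (h₁ : k ≤ a) (h₂ : a ≤ 1 + k) :
    moment a (fun x => |f x|) ≤ wnorm k f := by
  refine integral_mono_ae (hf.abs.integrable_rpow h₁ h₂) hf.integrable_weight ?_
  filter_upwards [ae_pos] with x hx
  exact mul_le_mul_of_nonneg_right (rpow_le_rpow_add_rpow hx h₁ h₂) (abs_nonneg _)

lemma wnorm_add_le (hf : Weighted k f) (hg : Weighted k g) :
    wnorm k (fun x => f x + g x) ≤ wnorm k f + wnorm k g := by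
  rw [wnorm, wnorm, wnorm, ← integral_add hf.integrable_weight hg.integrable_weight]
  refine integral_mono_ae (hf.add hg).integrable_weight
    (hf.integrable_weight.add hg.integrable_weight) ?_
  filter_upwards [ae_pos] with x hx
  rw [← mul_add]
  exact mul_le_mul_of_nonneg_left (abs_add_le _ _)
    (add_nonneg (Real.rpow_nonneg hx.le _) (Real.rpow_nonneg hx.le _))

lemma wnorm_sub_le (hf : Weighted k f) (hg : Weighted k g) :
    wnorm k (fun x => f x - g x) ≤ wnorm k f + wnorm k g := by
  have := hf.wnorm_add_le (hg.const_mul (-1))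
  rw [wnorm_const_mul] at this
  simpa [sub_eq_add_neg] using this

lemma wnorm_mono (hg : Weighted k g) (h : ∀ᵐ x ∂μ₀, |f x| ≤ |g x|) :
    wnorm k f ≤ wnorm k g := by
  refine integral_mono_of_nonneg ?_ hg.integrable_weight ?_
  · filter_upwards [ae_pos] with x hx
    exact mul_nonneg (add_nonneg (Real.rpow_nonneg hx.le _) (Real.rpow_nonneg hx.le _))
      (abs_nonneg _)
  · filter_upwards [ae_pos, h] with x hx h
    exact mul_le_mul_of_nonneg_left h
      (add_nonneg (Real.rpow_nonneg hx.le _) (Real.rpow_nonneg hx.le _))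

end Weighted

/-! ### Collision kernel and integrals of collision rates. -/

/-- Parameter range of the exponents. -/
structure Exponents (k l₁ l₂ : ℝ) : Prop where
  pos : 0 < k
  lt_one : k < 1
  le_left : k ≤ l₁
  le : l₁ ≤ l₂
  right_le : l₂ ≤ 1

lemma measurable_collisionKernel (l₁ l₂ : ℝ) :
    Measurable fun z : ℝ × ℝ => collisionKernel l₁ l₂ z.1 z.2 := by
  unfold collisionKernel
  exact ((measurable_fst.pow_const _).mul (measurable_snd.pow_const _)).add
    ((measurable_snd.pow_const _).mul (measurable_fst.pow_const _))

lemma collisionKernel_nonneg {l₁ l₂ x y : ℝ} (hx : 0 ≤ x) (hy : 0 ≤ y) :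
    0 ≤ collisionKernel l₁ l₂ x y :=
  add_nonneg (mul_nonneg (Real.rpow_nonneg hx _) (Real.rpow_nonneg hy _))
    (mul_nonneg (Real.rpow_nonneg hy _) (Real.rpow_nonneg hx _))

lemma collisionKernel_comm (l₁ l₂ x y : ℝ) :
    collisionKernel l₁ l₂ x y = collisionKernel l₁ l₂ y x := by
  unfold collisionKernel; ring

/-- The kernel is a sum of two products, so every double integral against it splits into products of
moments. -/
lemma rpow_mul_collisionKernel {l₁ l₂ a x : ℝ} (hx : 0 < x) (y c d : ℝ) :
    x ^ a * collisionKernel l₁ l₂ x y * c * d =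
      x ^ (a + l₁) * c * (y ^ l₂ * d) + x ^ (a + l₂) * c * (y ^ l₁ * d) := by
  unfold collisionKernel
  rw [Real.rpow_add hx, Real.rpow_add hx]; ring

lemma integrable_rpow_mul_rate {l₁ l₂ a : ℝ} {u v : ℝ → ℝ}
    (hu₁ : Integrable (fun x => x ^ (a + l₁) * u x) μ₀)
    (hu₂ : Integrable (fun x => x ^ (a + l₂) * u x) μ₀)
    (hv₁ : Integrable (fun x => x ^ l₁ * v x) μ₀)
    (hv₂ : Integrable (fun x => x ^ l₂ * v x) μ₀) :
    Integrable (fun z : ℝ × ℝ => z.1 ^ a * collisionKernel l₁ l₂ z.1 z.2 * u z.1 * v z.2)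
      (μ₀.prod μ₀) := by
  refine ((hu₁.mul_prod hv₂).add (hu₂.mul_prod hv₁)).congr ?_
  filter_upwards [ae_pos_prod] with z hz
  exact (rpow_mul_collisionKernel hz.1 _ _ _).symm

lemma integral_rpow_mul_rate {l₁ l₂ a : ℝ} {u v : ℝ → ℝ}
    (hu₁ : Integrable (fun x => x ^ (a + l₁) * u x) μ₀)
    (hu₂ : Integrable (fun x => x ^ (a + l₂) * u x) μ₀)
    (hv₁ : Integrable (fun x => x ^ l₁ * v x) μ₀)
    (hv₂ : Integrable (fun x => x ^ l₂ * v x) μ₀) :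
    ∫ z, z.1 ^ a * collisionKernel l₁ l₂ z.1 z.2 * u z.1 * v z.2 ∂(μ₀.prod μ₀) =
      moment (a + l₁) u * moment l₂ v + moment (a + l₂) u * moment l₁ v := by
  rw [moment_eq, moment_eq, moment_eq, moment_eq, ← integral_prod_mul, ← integral_prod_mul,
    ← integral_add (hu₁.mul_prod hv₂) (hu₂.mul_prod hv₁)]
  refine integral_congr_ae ?_
  filter_upwards [ae_pos_prod] with z hz
  exact rpow_mul_collisionKernel hz.1 _ _ _

lemma measurable_rate {ψ : ℝ × ℝ → ℝ} (hψ : Measurable ψ) (l₁ l₂ : ℝ) {u v : ℝ → ℝ}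
    (hu : Measurable u) (hv : Measurable v) :
    Measurable fun z : ℝ × ℝ => ψ z * collisionKernel l₁ l₂ z.1 z.2 * u z.1 * v z.2 :=
  ((hψ.mul (measurable_collisionKernel l₁ l₂)).mul (hu.comp measurable_fst)).mul
    (hv.comp measurable_snd)

/-- The bound on `p` is only required where `c ≠ 0`: later it holds only on the support of a
truncated density. -/
lemma abs_rate_le {l₁ l₂ p C q x y c d : ℝ} (hx : 0 < x) (hy : 0 < y)
    (h : c ≠ 0 → |p| ≤ C * q) :
    |p * collisionKernel l₁ l₂ x y * c * d| ≤
      C * (q * collisionKernel l₁ l₂ x y * |c| * |d|) := by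
  rw [abs_mul, abs_mul, abs_mul, abs_of_nonneg (collisionKernel_nonneg hx.le hy.le)]
  by_cases hc : c = 0
  · simp [hc]
  · calc |p| * collisionKernel l₁ l₂ x y * |c| * |d|
        ≤ C * q * collisionKernel l₁ l₂ x y * |c| * |d| := by
          gcongr
          · exact collisionKernel_nonneg hx.le hy.le
          · exact h hc
      _ = _ := by ring

section Rate

variable {k l₁ l₂ C : ℝ} {u v : ℝ → ℝ} {ψ : ℝ × ℝ → ℝ}

/-- A factor `x ^ k` is the most that can be afforded: the orders `k + l₁`, `k + l₂` that it
produces still lie in `[k, 1 + k]`, because `l₂ ≤ 1`. -/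
lemma integrable_rate (hk : Exponents k l₁ l₂) (hu : Weighted k u) (hv : Weighted k v)
    (hψ : Measurable ψ)
    (hC : ∀ x y, 0 < x → 0 < y → u x ≠ 0 → |ψ (x, y)| ≤ C * x ^ k) :
    Integrable (fun z : ℝ × ℝ => ψ z * collisionKernel l₁ l₂ z.1 z.2 * u z.1 * v z.2)
      (μ₀.prod μ₀) := by
  have h := hk.pos; have h1 := hk.le_left; have h2 := hk.le; have h3 := hk.right_le
  refine ((integrable_rpow_mul_rate (a := k) (l₁ := l₁) (l₂ := l₂)
    (hu.abs.integrable_rpow (by linarith) (by linarith))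
    (hu.abs.integrable_rpow (by linarith) (by linarith))
    (hv.abs.integrable_rpow (by linarith) (by linarith))
    (hv.abs.integrable_rpow (by linarith) (by linarith))).const_mul C).mono'
    (measurable_rate hψ l₁ l₂ hu.meas hv.meas).aestronglyMeasurable ?_
  filter_upwards [ae_pos_prod] with z hz
  exact abs_rate_le hz.1 hz.2 (hC z.1 z.2 hz.1 hz.2)

lemma integral_abs_rate_le (hk : Exponents k l₁ l₂) (hu : Weighted k u) (hv : Weighted k v)
    (hψ : Measurable ψ) (hC0 : 0 ≤ C)
    (hC : ∀ x y, 0 < x → 0 < y → u x ≠ 0 → |ψ (x, y)| ≤ C * x ^ k) :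
    ∫ z, |ψ z * collisionKernel l₁ l₂ z.1 z.2 * u z.1 * v z.2| ∂(μ₀.prod μ₀) ≤
      2 * C * wnorm k u * wnorm k v := by
  have h := hk.pos; have h1 := hk.le_left; have h2 := hk.le; have h3 := hk.right_le
  have i1 := hu.abs.integrable_rpow (a := k + l₁) (by linarith) (by linarith)
  have i2 := hu.abs.integrable_rpow (a := k + l₂) (by linarith) (by linarith)
  have i3 := hv.abs.integrable_rpow (a := l₁) (by linarith) (by linarith)
  have i4 := hv.abs.integrable_rpow (a := l₂) (by linarith) (by linarith)
  have hle : ∫ z, |ψ z * collisionKernel l₁ l₂ z.1 z.2 * u z.1 * v z.2| ∂(μ₀.prod μ₀) ≤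
      ∫ z, C * (z.1 ^ k * collisionKernel l₁ l₂ z.1 z.2 * |u z.1| * |v z.2|)
        ∂(μ₀.prod μ₀) := by
    refine integral_mono_ae (integrable_rate hk hu hv hψ hC).abs
      ((integrable_rpow_mul_rate i1 i2 i3 i4).const_mul C) ?_
    filter_upwards [ae_pos_prod] with z hz
    exact abs_rate_le hz.1 hz.2 (hC z.1 z.2 hz.1 hz.2)
  refine hle.trans ?_
  rw [integral_const_mul, integral_rpow_mul_rate i1 i2 i3 i4]
  have j1 := hu.moment_abs_le (a := k + l₁) (by linarith) (by linarith)
  have j2 := hu.moment_abs_le (a := k + l₂) (by linarith) (by linarith)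
  have j3 := hv.moment_abs_le (a := l₁) (by linarith) (by linarith)
  have j4 := hv.moment_abs_le (a := l₂) (by linarith) (by linarith)
  have hN := wnorm_nonneg k u
  have hM3 : 0 ≤ moment l₁ fun x => |v x| := moment_nonneg _ fun _ => abs_nonneg _
  have hM4 : 0 ≤ moment l₂ fun x => |v x| := moment_nonneg _ fun _ => abs_nonneg _
  have := mul_le_mul j1 j4 hM4 hN
  have := mul_le_mul j2 j3 hM3 hN
  calc _ ≤ C * (wnorm k u * wnorm k v + wnorm k u * wnorm k v) := by gcongr
    _ = _ := by ring

lemma abs_integral_rate_le (hk : Exponents k l₁ l₂) (hu : Weighted k u) (hv : Weighted k v)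
    (hψ : Measurable ψ) (hC0 : 0 ≤ C)
    (hC : ∀ x y, 0 < x → 0 < y → u x ≠ 0 → |ψ (x, y)| ≤ C * x ^ k) :
    |∫ z, ψ z * collisionKernel l₁ l₂ z.1 z.2 * u z.1 * v z.2 ∂(μ₀.prod μ₀)| ≤
      2 * C * wnorm k u * wnorm k v :=
  abs_integral_le_integral_abs.trans (integral_abs_rate_le hk hu hv hψ hC0 hC)

end Rate

/-! ### Densities with bounded support. -/

/-- Weighted functions that vanish outside `(0, R)`. -/
structure Truncated (k R : ℝ) (f : ℝ → ℝ) : Prop where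
  meas : Measurable f
  supp : ∀ x, x ∉ Ioo 0 R → f x = 0
  low : Integrable (fun x => x ^ k * f x) μ₀

namespace Truncated

variable {k R : ℝ} {f g : ℝ → ℝ}

lemma mem_Ioo (hf : Truncated k R f) {x : ℝ} (hx : f x ≠ 0) : x ∈ Ioo 0 R :=
  by_contra fun h => hx (hf.supp x h)

lemma integrable_mul (hf : Truncated k R f) {ψ : ℝ → ℝ} (hψ : Measurable ψ) {C : ℝ}
    (hC : ∀ x ∈ Ioo 0 R, |ψ x| ≤ C * x ^ k) : Integrable (fun x => ψ x * f x) μ₀ := by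
  refine (hf.low.norm.const_mul C).mono' (hψ.mul hf.meas).aestronglyMeasurable ?_
  filter_upwards [ae_pos] with x hx
  by_cases h : f x = 0
  · simp [h]
  · rw [norm_mul, norm_mul, Real.norm_eq_abs, Real.norm_eq_abs, Real.norm_eq_abs,
      abs_of_pos (Real.rpow_pos_of_pos hx k), ← mul_assoc]
    exact mul_le_mul_of_nonneg_right (hC x (hf.mem_Ioo h)) (abs_nonneg _)

lemma rpow_bound {a : ℝ} (h : k ≤ a) {x : ℝ} (hx : x ∈ Ioo 0 R) :
    |x ^ a| ≤ R ^ (a - k) * x ^ k := by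
  rw [abs_of_pos (Real.rpow_pos_of_pos hx.1 a)]
  calc x ^ a = x ^ (a - k) * x ^ k := by rw [← Real.rpow_add hx.1]; simp
    _ ≤ _ := mul_le_mul_of_nonneg_right
      (Real.rpow_le_rpow hx.1.le hx.2.le (by linarith)) (Real.rpow_nonneg hx.1.le _)

lemma integrable_rpow (hf : Truncated k R f) {a : ℝ} (h : k ≤ a) :
    Integrable (fun x => x ^ a * f x) μ₀ :=
  hf.integrable_mul (measurable_id.pow_const a) fun _ hx => rpow_bound h hx

lemma weighted (hf : Truncated k R f) : Weighted k f :=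
  ⟨hf.meas, hf.low, hf.integrable_rpow (by linarith)⟩

lemma abs (hf : Truncated k R f) : Truncated k R fun x => |f x| :=
  ⟨hf.weighted.abs.meas, fun x hx => by simp [hf.supp x hx], hf.weighted.abs.low⟩

lemma add (hf : Truncated k R f) (hg : Truncated k R g) : Truncated k R fun x => f x + g x :=
  ⟨hf.meas.add hg.meas, fun x hx => by simp [hf.supp x hx, hg.supp x hx],
    (hf.weighted.add hg.weighted).low⟩

lemma sub (hf : Truncated k R f) (hg : Truncated k R g) : Truncated k R fun x => f x - g x :=
  ⟨hf.meas.sub hg.meas, fun x hx => by simp [hf.supp x hx, hg.supp x hx],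
    (hf.weighted.sub hg.weighted).low⟩

lemma const_mul (hf : Truncated k R f) (c : ℝ) : Truncated k R fun x => c * f x :=
  ⟨hf.meas.const_mul c, fun x hx => by simp [hf.supp x hx], (hf.weighted.const_mul c).low⟩

lemma mono (hf : Truncated k R f) {R' : ℝ} (h : R ≤ R') : Truncated k R' f :=
  ⟨hf.meas, fun x hx => hf.supp x fun hx' => hx ⟨hx'.1, hx'.2.trans_le h⟩, hf.low⟩

end Truncated

end

/-! ### Fragmentation kernels and the bilinear collision operator. -/

noncomputable section

/-- Kernels `κ x y z`: the density in `x` of the fragments of a particle of size `y` shattered by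
a particle of size `z`. -/
structure FragKernel (k E δ : ℝ) (κ : ℝ → ℝ → ℝ → ℝ) : Prop where
  meas : Measurable fun p : ℝ × ℝ × ℝ => κ p.1 p.2.1 p.2.2
  nonneg : ∀ x y z, 0 ≤ κ x y z
  supp : ∀ x y z, x ∉ Ioo 0 y → κ x y z = 0
  integrable : ∀ y z, 0 < y → 0 < z → Integrable (fun x => x ^ k * κ x y z) μ₀
  mass : ∀ y z, 0 < y → 0 < z → ∫ x, x * κ x y z ∂μ₀ = y
  bound : ∀ y z, 0 < y → 0 < z → ∫ x, x ^ k * κ x y z ∂μ₀ ≤ E * y ^ k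
  damping : ∀ y z, 0 < y → 0 < z →
    ∫ x, x ^ (1 + k) * κ x y z ∂μ₀ ≤ (1 - δ) * y ^ (1 + k)
  one_le : 1 ≤ E
  pos : 0 < δ

/-- The average of `ψ` over the fragments. -/
def avg (κ : ℝ → ℝ → ℝ → ℝ) (ψ : ℝ → ℝ) (y z : ℝ) : ℝ := ∫ x, ψ x * κ x y z ∂μ₀

/-- The gain part of the collision operator, `u` being shattered by `v`. -/
def gain (κ : ℝ → ℝ → ℝ → ℝ) (l₁ l₂ : ℝ) (u v : ℝ → ℝ) (x : ℝ) : ℝ :=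
  ∫ z, κ x z.1 z.2 * collisionKernel l₁ l₂ z.1 z.2 * u z.1 * v z.2 ∂(μ₀.prod μ₀)

/-- The rate at which a particle of size `x` is shattered by `v`. -/
def loss (l₁ l₂ : ℝ) (v : ℝ → ℝ) (x : ℝ) : ℝ := x ^ l₁ * moment l₂ v + x ^ l₂ * moment l₁ v

/-- The bilinear collision operator, `u` being shattered by `v`. -/
def coll (κ : ℝ → ℝ → ℝ → ℝ) (l₁ l₂ : ℝ) (u v : ℝ → ℝ) (x : ℝ) : ℝ :=
  gain κ l₁ l₂ u v x - u x * loss l₁ l₂ v x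

variable {k l₁ l₂ E δ R C : ℝ} {κ : ℝ → ℝ → ℝ → ℝ} {u v f g ψ : ℝ → ℝ}

namespace FragKernel

lemma meas_slice (hκ : FragKernel k E δ κ) (y z : ℝ) : Measurable fun x => κ x y z :=
  hκ.meas.comp (measurable_id.prodMk (measurable_const (a := (y, z))))

lemma abs_mul_le (hκ : FragKernel k E δ κ) {x y z : ℝ}
    (hC : ∀ x ∈ Ioo 0 y, |ψ x| ≤ C * x ^ k) :
    |ψ x * κ x y z| ≤ C * (x ^ k * κ x y z) := by
  by_cases h : x ∈ Ioo 0 y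
  · rw [abs_mul, abs_of_nonneg (hκ.nonneg x y z), ← mul_assoc]
    exact mul_le_mul_of_nonneg_right (hC x h) (hκ.nonneg x y z)
  · simp [hκ.supp x y z h]

lemma integrable_mul (hκ : FragKernel k E δ κ) {y z : ℝ} (hy : 0 < y) (hz : 0 < z)
    (hψ : Measurable ψ) (hC : ∀ x ∈ Ioo 0 y, |ψ x| ≤ C * x ^ k) :
    Integrable (fun x => ψ x * κ x y z) μ₀ :=
  ((hκ.integrable y z hy hz).const_mul C).mono'
    (hψ.mul (hκ.meas_slice y z)).aestronglyMeasurable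
    (Filter.Eventually.of_forall fun _ => hκ.abs_mul_le hC)

lemma integral_abs_le (hκ : FragKernel k E δ κ) {y z : ℝ} (hy : 0 < y) (hz : 0 < z)
    (hψ : Measurable ψ) (hC0 : 0 ≤ C) (hC : ∀ x ∈ Ioo 0 y, |ψ x| ≤ C * x ^ k) :
    ∫ x, |ψ x * κ x y z| ∂μ₀ ≤ C * E * y ^ k := by
  calc ∫ x, |ψ x * κ x y z| ∂μ₀ ≤ ∫ x, C * (x ^ k * κ x y z) ∂μ₀ :=
        integral_mono (hκ.integrable_mul hy hz hψ hC).abs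
          ((hκ.integrable y z hy hz).const_mul C) fun _ => hκ.abs_mul_le hC
    _ = C * ∫ x, x ^ k * κ x y z ∂μ₀ := integral_const_mul _ _
    _ ≤ C * (E * y ^ k) := mul_le_mul_of_nonneg_left (hκ.bound y z hy hz) hC0
    _ = _ := by ring

lemma abs_avg_le (hκ : FragKernel k E δ κ) {y z : ℝ} (hy : 0 < y) (hz : 0 < z)
    (hψ : Measurable ψ) (hC0 : 0 ≤ C) (hC : ∀ x ∈ Ioo 0 y, |ψ x| ≤ C * x ^ k) :
    |avg κ ψ y z| ≤ C * E * y ^ k :=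
  abs_integral_le_integral_abs.trans (hκ.integral_abs_le hy hz hψ hC0 hC)

lemma measurable_avg (hκ : FragKernel k E δ κ) (hψ : Measurable ψ) :
    Measurable fun z : ℝ × ℝ => avg κ ψ z.1 z.2 := by
  have h : Measurable fun p : (ℝ × ℝ) × ℝ => ψ p.2 * κ p.2 p.1.1 p.1.2 :=
    (hψ.comp measurable_snd).mul (hκ.meas.comp (measurable_snd.prodMk
      ((measurable_fst.comp measurable_fst).prodMk (measurable_snd.comp measurable_fst))))
  exact (h.stronglyMeasurable.integral_prod_right').measurable

lemma measurable_gain_integrand (hκ : FragKernel k E δ κ) (l₁ l₂ : ℝ) (hu : Measurable u)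
    (hv : Measurable v) :
    Measurable fun p : ℝ × ℝ × ℝ =>
      κ p.1 p.2.1 p.2.2 * collisionKernel l₁ l₂ p.2.1 p.2.2 * u p.2.1 * v p.2.2 :=
  ((hκ.meas.mul ((measurable_collisionKernel l₁ l₂).comp measurable_snd)).mul
    (hu.comp (measurable_fst.comp measurable_snd))).mul
    (hv.comp (measurable_snd.comp measurable_snd))

lemma measurable_gain (hκ : FragKernel k E δ κ) (l₁ l₂ : ℝ) (hu : Measurable u)
    (hv : Measurable v) : Measurable (gain κ l₁ l₂ u v) :=
  ((hκ.measurable_gain_integrand l₁ l₂ hu hv).stronglyMeasurable.integral_prod_right').measurable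

/-- Tonelli with the fragment size integrated first: that integral is at most a multiple of `y ^ k`,
and `integrable_rate` applies to the rest. -/
lemma integrable_gain_integrand (hk : Exponents k l₁ l₂) (hκ : FragKernel k E δ κ)
    (hu : Truncated k R u) (hv : Weighted k v) (hψ : Measurable ψ)
    (hC : ∀ x ∈ Ioo 0 R, |ψ x| ≤ C * x ^ k) :
    Integrable (fun p : ℝ × ℝ × ℝ =>
      ψ p.1 * (κ p.1 p.2.1 p.2.2 * collisionKernel l₁ l₂ p.2.1 p.2.2 * u p.2.1 * v p.2.2))
      (μ₀.prod (μ₀.prod μ₀)) := by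
  have hmeas : Measurable fun p : ℝ × ℝ × ℝ =>
      ψ p.1 * (κ p.1 p.2.1 p.2.2 * collisionKernel l₁ l₂ p.2.1 p.2.2 * u p.2.1 * v p.2.2) :=
    (hψ.comp measurable_fst).mul (hκ.measurable_gain_integrand l₁ l₂ hu.meas hv.meas)
  have hC' : ∀ x ∈ Ioo 0 R, |ψ x| ≤ |C| * x ^ k := fun x hx => (hC x hx).trans
    (mul_le_mul_of_nonneg_right (le_abs_self C) (Real.rpow_nonneg hx.1.le _))
  have hsub : ∀ y, u y ≠ 0 → ∀ x ∈ Ioo 0 y, |ψ x| ≤ |C| * x ^ k := fun y hy x hx =>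
    hC' x ⟨hx.1, hx.2.trans (hu.mem_Ioo hy).2⟩
  rw [integrable_prod_iff' hmeas.aestronglyMeasurable]
  constructor
  · filter_upwards [ae_pos_prod] with z hz
    by_cases h : u z.1 = 0
    · simp [h]
    · refine ((hκ.integrable_mul hz.1 hz.2 hψ (hsub z.1 h)).mul_const
        (collisionKernel l₁ l₂ z.1 z.2 * u z.1 * v z.2)).congr
        (Filter.Eventually.of_forall fun x => ?_)
      simp only; ring
  · have hdom := (integrable_rate (C := |C| * E) (ψ := fun z : ℝ × ℝ => |C| * E * z.1 ^ k)
      hk hu.weighted hv ((measurable_fst.pow_const k).const_mul _) (fun x y hx hy _ => by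
        rw [abs_of_nonneg]
        have := hκ.one_le
        have := Real.rpow_nonneg hx.le k
        positivity)).norm
    refine hdom.mono' (hmeas.norm.stronglyMeasurable.integral_prod_left').aestronglyMeasurable ?_
    filter_upwards [ae_pos_prod] with z hz
    rw [Real.norm_of_nonneg (integral_nonneg fun _ => norm_nonneg _)]
    by_cases h : u z.1 = 0
    · simp [h]
    · have h1 : ∫ x, ‖ψ x * (κ x z.1 z.2 * collisionKernel l₁ l₂ z.1 z.2 * u z.1 * v z.2)‖ ∂μ₀
          = (∫ x, |ψ x * κ x z.1 z.2| ∂μ₀) * |collisionKernel l₁ l₂ z.1 z.2 * u z.1 * v z.2| := by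
        rw [← integral_mul_const]
        refine integral_congr_ae (Filter.Eventually.of_forall fun x => ?_)
        simp only [Real.norm_eq_abs]
        rw [← abs_mul]
        congr 1; ring
      have h2 := hκ.integral_abs_le hz.1 hz.2 hψ (abs_nonneg C) (hsub z.1 h)
      calc _ = _ := h1
        _ ≤ |C| * E * z.1 ^ k * |collisionKernel l₁ l₂ z.1 z.2 * u z.1 * v z.2| :=
          mul_le_mul_of_nonneg_right h2 (abs_nonneg _)
        _ = |(|C| * E * z.1 ^ k)| * |collisionKernel l₁ l₂ z.1 z.2 * u z.1 * v z.2| := by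
          rw [abs_of_nonneg (a := |C| * E * z.1 ^ k)]
          have := hκ.one_le
          have := Real.rpow_nonneg hz.1.le k
          positivity
        _ = _ := by rw [← abs_mul, Real.norm_eq_abs]; congr 1; ring

lemma ae_integrable_gain (hk : Exponents k l₁ l₂) (hκ : FragKernel k E δ κ)
    (hu : Truncated k R u) (hv : Weighted k v) :
    ∀ᵐ x ∂μ₀, Integrable
      (fun z => κ x z.1 z.2 * collisionKernel l₁ l₂ z.1 z.2 * u z.1 * v z.2)
      (μ₀.prod μ₀) := by
  have h := (hκ.integrable_gain_integrand hk hu hv (ψ := fun x => x ^ k) (C := 1)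
    (measurable_id.pow_const k)
    (fun x hx => by rw [one_mul, abs_of_nonneg (Real.rpow_nonneg hx.1.le _)])).prod_right_ae
  filter_upwards [h, ae_pos] with x h hx
  exact (integrable_const_mul_iff (Real.rpow_pos_of_pos hx k).ne'.isUnit _).1 h

lemma integrable_mul_gain (hk : Exponents k l₁ l₂) (hκ : FragKernel k E δ κ)
    (hu : Truncated k R u) (hv : Weighted k v) (hψ : Measurable ψ)
    (hC : ∀ x ∈ Ioo 0 R, |ψ x| ≤ C * x ^ k) :
    Integrable (fun x => ψ x * gain κ l₁ l₂ u v x) μ₀ := by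
  refine (hκ.integrable_gain_integrand hk hu hv hψ hC).integral_prod_left.congr
    (Filter.Eventually.of_forall fun x => ?_)
  exact integral_const_mul (ψ x) _

lemma integral_mul_gain (hk : Exponents k l₁ l₂) (hκ : FragKernel k E δ κ)
    (hu : Truncated k R u) (hv : Weighted k v) (hψ : Measurable ψ)
    (hC : ∀ x ∈ Ioo 0 R, |ψ x| ≤ C * x ^ k) :
    ∫ x, ψ x * gain κ l₁ l₂ u v x ∂μ₀ =
      ∫ z, avg κ ψ z.1 z.2 * collisionKernel l₁ l₂ z.1 z.2 * u z.1 * v z.2 ∂(μ₀.prod μ₀) := by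
  have h := integral_integral_swap (f := fun (x : ℝ) (z : ℝ × ℝ) =>
    ψ x * (κ x z.1 z.2 * collisionKernel l₁ l₂ z.1 z.2 * u z.1 * v z.2))
    (hκ.integrable_gain_integrand hk hu hv hψ hC)
  simp only [integral_const_mul] at h
  refine h.trans (integral_congr_ae (Filter.Eventually.of_forall fun z => ?_))
  simp only [avg]
  rw [mul_assoc, mul_assoc, ← integral_mul_const]
  refine integral_congr_ae (Filter.Eventually.of_forall fun x => ?_)
  simp only; ring

/-- Fragments are smaller than their parent, so a cutoff of the shattered density is inherited by
the gain term. This is what keeps the Euler scheme inside the truncated class. -/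
lemma truncated_gain (hk : Exponents k l₁ l₂) (hκ : FragKernel k E δ κ)
    (hu : Truncated k R u) (hv : Weighted k v) : Truncated k R (gain κ l₁ l₂ u v) := by
  refine ⟨hκ.measurable_gain l₁ l₂ hu.meas hv.meas, fun x hx => ?_,
    hκ.integrable_mul_gain hk hu hv (measurable_id.pow_const k) (C := 1)
      (fun x hx => by rw [one_mul, abs_of_nonneg (Real.rpow_nonneg hx.1.le _)])⟩
  rw [gain, integral_eq_zero_of_ae]
  refine Filter.Eventually.of_forall fun z => ?_
  by_cases h : u z.1 = 0
  · simp [h]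
  · have : κ x z.1 z.2 = 0 := hκ.supp _ _ _ fun hx' =>
      hx ⟨hx'.1, hx'.2.trans (hu.mem_Ioo h).2⟩
    simp [this]

end FragKernel

lemma measurable_loss (l₁ l₂ : ℝ) (v : ℝ → ℝ) : Measurable (loss l₁ l₂ v) :=
  ((measurable_id.pow_const l₁).mul_const _).add ((measurable_id.pow_const l₂).mul_const _)

lemma integrable_mul_loss (hk : Exponents k l₁ l₂) (hu : Truncated k R u)
    (hψ : Measurable ψ) (hC : ∀ x ∈ Ioo 0 R, |ψ x| ≤ C * x ^ k) {l : ℝ} (hl : k ≤ l) :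
    Integrable (fun x => ψ x * x ^ l * u x) μ₀ := by
  refine hu.integrable_mul (C := C * R ^ l) (hψ.mul (measurable_id.pow_const l)) fun x hx => ?_
  have hl0 : 0 ≤ l := hk.pos.le.trans hl
  rw [abs_mul, abs_of_nonneg (Real.rpow_nonneg hx.1.le _)]
  calc |ψ x| * x ^ l ≤ C * x ^ k * R ^ l :=
        mul_le_mul (hC x hx) (Real.rpow_le_rpow hx.1.le hx.2.le hl0)
          (Real.rpow_nonneg hx.1.le _) ((abs_nonneg _).trans (hC x hx))
    _ = _ := by ring

lemma integrable_mul_mul_loss (hk : Exponents k l₁ l₂) (hu : Truncated k R u)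
    (hψ : Measurable ψ) (hC : ∀ x ∈ Ioo 0 R, |ψ x| ≤ C * x ^ k) :
    Integrable (fun x => ψ x * (u x * loss l₁ l₂ v x)) μ₀ := by
  refine (((integrable_mul_loss hk hu hψ hC hk.le_left).mul_const (moment l₂ v)).add
    ((integrable_mul_loss hk hu hψ hC (hk.le_left.trans hk.le)).mul_const
      (moment l₁ v))).congr (Filter.Eventually.of_forall fun x => ?_)
  simp only [Pi.add_apply, loss]; ring

lemma integral_mul_mul_loss (hk : Exponents k l₁ l₂) (hu : Truncated k R u)
    (hv : Weighted k v) (hψ : Measurable ψ) (hC : ∀ x ∈ Ioo 0 R, |ψ x| ≤ C * x ^ k) :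
    ∫ x, ψ x * (u x * loss l₁ l₂ v x) ∂μ₀ =
      ∫ z, ψ z.1 * collisionKernel l₁ l₂ z.1 z.2 * u z.1 * v z.2 ∂(μ₀.prod μ₀) := by
  have h := hk.pos; have h1 := hk.le_left; have h2 := hk.le; have h3 := hk.right_le
  have i1 := integrable_mul_loss hk hu hψ hC hk.le_left
  have i2 := integrable_mul_loss hk hu hψ hC (hk.le_left.trans hk.le)
  have i3 := hv.integrable_rpow (a := l₁) (by linarith) (by linarith)
  have i4 := hv.integrable_rpow (a := l₂) (by linarith) (by linarith)
  calc ∫ x, ψ x * (u x * loss l₁ l₂ v x) ∂μ₀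
      = ∫ x, (ψ x * x ^ l₁ * u x * moment l₂ v + ψ x * x ^ l₂ * u x * moment l₁ v) ∂μ₀ := by
        congr 1; ext x; simp only [loss]; ring
    _ = (∫ x, ψ x * x ^ l₁ * u x ∂μ₀) * moment l₂ v +
        (∫ x, ψ x * x ^ l₂ * u x ∂μ₀) * moment l₁ v := by
        rw [integral_add (i1.mul_const _) (i2.mul_const _), integral_mul_const,
          integral_mul_const]
    _ = _ := by
        rw [moment_eq, moment_eq, ← integral_prod_mul, ← integral_prod_mul,
          ← integral_add (i1.mul_prod i4) (i2.mul_prod i3)]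
        refine integral_congr_ae (Filter.Eventually.of_forall fun z => ?_)
        simp only [collisionKernel]; ring

lemma truncated_mul_loss (hk : Exponents k l₁ l₂) (hu : Truncated k R u) (v : ℝ → ℝ) :
    Truncated k R fun x => u x * loss l₁ l₂ v x :=
  ⟨hu.meas.mul (measurable_loss l₁ l₂ v), fun x hx => by simp [hu.supp x hx],
    integrable_mul_mul_loss hk hu (measurable_id.pow_const k) (C := 1)
      fun x hx => by rw [one_mul, abs_of_nonneg (Real.rpow_nonneg hx.1.le _)]⟩

namespace FragKernel

lemma truncated_coll (hk : Exponents k l₁ l₂) (hκ : FragKernel k E δ κ)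
    (hu : Truncated k R u) (hv : Weighted k v) : Truncated k R (coll κ l₁ l₂ u v) :=
  (hκ.truncated_gain hk hu hv).sub (truncated_mul_loss hk hu v)

lemma integrable_avg_rate (hk : Exponents k l₁ l₂) (hκ : FragKernel k E δ κ)
    (hu : Truncated k R u) (hv : Weighted k v) (hψ : Measurable ψ) (hC0 : 0 ≤ C)
    (hC : ∀ x ∈ Ioo 0 R, |ψ x| ≤ C * x ^ k) :
    Integrable (fun z : ℝ × ℝ =>
      avg κ ψ z.1 z.2 * collisionKernel l₁ l₂ z.1 z.2 * u z.1 * v z.2) (μ₀.prod μ₀) :=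
  integrable_rate (C := C * E) (ψ := fun z : ℝ × ℝ => avg κ ψ z.1 z.2) hk hu.weighted hv
    (hκ.measurable_avg hψ) fun _ _ hx hy h =>
    hκ.abs_avg_le hx hy hψ hC0 fun x' hx' => hC x' ⟨hx'.1, hx'.2.trans (hu.mem_Ioo h).2⟩

/-- The weak form, from Fubini. All moment estimates come from it by choosing `ψ` as a power or as
the weight. -/
lemma integral_mul_coll (hk : Exponents k l₁ l₂) (hκ : FragKernel k E δ κ)
    (hu : Truncated k R u) (hv : Weighted k v) (hψ : Measurable ψ) (hC0 : 0 ≤ C)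
    (hC : ∀ x ∈ Ioo 0 R, |ψ x| ≤ C * x ^ k) :
    ∫ x, ψ x * coll κ l₁ l₂ u v x ∂μ₀ =
      ∫ z, (avg κ ψ z.1 z.2 - ψ z.1) * collisionKernel l₁ l₂ z.1 z.2 * u z.1 * v z.2
        ∂(μ₀.prod μ₀) := by
  have h1 := hκ.integrable_avg_rate hk hu hv hψ hC0 hC
  have h2 := integrable_rate (C := C) (ψ := fun z : ℝ × ℝ => ψ z.1) hk hu.weighted hv
    (hψ.comp measurable_fst) fun x y hx hy h => hC x (hu.mem_Ioo h)
  simp only [sub_mul, coll, mul_sub]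
  rw [integral_sub (hκ.integrable_mul_gain hk hu hv hψ hC) (integrable_mul_mul_loss hk hu hψ hC),
    integral_sub h1 h2, hκ.integral_mul_gain hk hu hv hψ hC,
    integral_mul_mul_loss hk hu hv hψ hC]

lemma abs_gain_le (hκ : FragKernel k E δ κ) (u v : ℝ → ℝ) (x : ℝ) :
    |gain κ l₁ l₂ u v x| ≤ gain κ l₁ l₂ (fun y => |u y|) (fun y => |v y|) x := by
  refine abs_integral_le_integral_abs.trans (le_of_eq (integral_congr_ae ?_))
  filter_upwards [ae_pos_prod] with z hz
  simp only [abs_mul, abs_of_nonneg (hκ.nonneg _ _ _),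
    abs_of_nonneg (collisionKernel_nonneg hz.1.le hz.2.le)]

lemma gain_nonneg (hκ : FragKernel k E δ κ) (hu : ∀ x, 0 ≤ u x) (hv : ∀ x, 0 ≤ v x) (x : ℝ) :
    0 ≤ gain κ l₁ l₂ u v x := by
  refine integral_nonneg_of_ae ?_
  filter_upwards [ae_pos_prod] with z hz
  exact mul_nonneg (mul_nonneg (mul_nonneg (hκ.nonneg _ _ _)
    (collisionKernel_nonneg hz.1.le hz.2.le)) (hu _)) (hv _)

end FragKernel

lemma abs_loss_le (v : ℝ → ℝ) {x : ℝ} (hx : 0 < x) :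
    |loss l₁ l₂ v x| ≤ loss l₁ l₂ (fun y => |v y|) x := by
  refine (abs_add_le _ _).trans ?_
  rw [abs_mul, abs_mul, abs_of_pos (Real.rpow_pos_of_pos hx _),
    abs_of_pos (Real.rpow_pos_of_pos hx _)]
  have h1 := Real.rpow_pos_of_pos hx l₁
  have h2 := Real.rpow_pos_of_pos hx l₂
  exact add_le_add (mul_le_mul_of_nonneg_left (abs_moment_le _ _) h1.le)
    (mul_le_mul_of_nonneg_left (abs_moment_le _ _) h2.le)

/-- The loss rate is bounded on `(0, R)` only; this is the source of the restriction on the time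
step. -/
lemma loss_le (hk : Exponents k l₁ l₂) (hv : Weighted k v) {x : ℝ} (hx : x ∈ Ioo 0 R) :
    loss l₁ l₂ v x ≤ 2 * (1 + R) * wnorm k v := by
  have h := hk.pos; have h1 := hk.le_left; have h2 := hk.le; have h3 := hk.right_le
  have key : ∀ l : ℝ, 0 ≤ l → l ≤ 1 → x ^ l ≤ 1 + R := fun l h0 h1 => by
    have := rpow_le_rpow_add_rpow hx.1 h0 h1
    rw [Real.rpow_zero, Real.rpow_one] at this
    linarith [hx.2]
  have hm : ∀ l, k ≤ l → l ≤ 1 → moment l v ≤ wnorm k v := fun l h0 h1 =>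
    (le_abs_self _).trans ((abs_moment_le _ _).trans
      (hv.moment_abs_le h0 (by linarith)))
  have hN := wnorm_nonneg k v
  have a1 := mul_le_mul (key l₁ (by linarith) (by linarith)) (le_refl (wnorm k v)) hN
    (by linarith [hx.1, hx.2])
  have a2 := mul_le_mul (key l₂ (by linarith) (by linarith)) (le_refl (wnorm k v)) hN
    (by linarith [hx.1, hx.2])
  have b1 := mul_le_mul_of_nonneg_left (hm l₂ (by linarith) (by linarith))
    (Real.rpow_nonneg hx.1.le l₁)
  have b2 := mul_le_mul_of_nonneg_left (hm l₁ (by linarith) (by linarith))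
    (Real.rpow_nonneg hx.1.le l₂)
  unfold loss
  linarith

lemma measurable_weight (k : ℝ) : Measurable fun x : ℝ => x ^ k + x ^ (1 + k) :=
  (measurable_id.pow_const k).add (measurable_id.pow_const (1 + k))

lemma weight_nonneg (k : ℝ) {x : ℝ} (hx : 0 < x) : 0 ≤ x ^ k + x ^ (1 + k) :=
  add_nonneg (Real.rpow_nonneg hx.le _) (Real.rpow_nonneg hx.le _)

lemma rpow_one_add {x : ℝ} (hx : 0 < x) (k : ℝ) : x ^ (1 + k) = x * x ^ k := by
  rw [Real.rpow_add hx, Real.rpow_one]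

lemma abs_rpow_le {x : ℝ} (hx : x ∈ Ioo 0 R) : |x ^ k| ≤ 1 * x ^ k := by
  rw [one_mul, abs_of_nonneg (Real.rpow_nonneg hx.1.le _)]

lemma abs_rpow_one_add_le {x : ℝ} (hx : x ∈ Ioo 0 R) : |x ^ (1 + k)| ≤ R * x ^ k := by
  rw [abs_of_nonneg (Real.rpow_nonneg hx.1.le _), rpow_one_add hx.1]
  exact mul_le_mul_of_nonneg_right hx.2.le (Real.rpow_nonneg hx.1.le _)

lemma abs_weight_le {x : ℝ} (hx : x ∈ Ioo 0 R) :
    |x ^ k + x ^ (1 + k)| ≤ (1 + R) * x ^ k := by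
  refine (abs_add_le _ _).trans ?_
  linarith [abs_rpow_le (k := k) hx, abs_rpow_one_add_le (k := k) hx]

namespace FragKernel

/-- The part `y ^ (1 + k)` of the weight comes back with constant at most one. This is what allows
the loss to compensate it in `wnorm_add_coll_le`. -/
lemma avg_weight_le (hκ : FragKernel k E δ κ) {y z : ℝ} (hy : 0 < y) (hz : 0 < z) :
    avg κ (fun x => x ^ k + x ^ (1 + k)) y z ≤ E * y ^ k + y ^ (1 + k) := by
  have h := hκ.integrable_mul hy hz (ψ := fun x => x ^ (1 + k)) (measurable_id.pow_const _)
    (fun _ hx => abs_rpow_one_add_le hx)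
  simp only [avg, add_mul]
  rw [integral_add (hκ.integrable y z hy hz) h]
  have := hκ.bound y z hy hz
  have := hκ.damping y z hy hz
  nlinarith [hκ.pos, Real.rpow_nonneg hy.le (1 + k)]

/-- Gain and loss are estimated separately, which costs a moment of order `1 + k + l₂` of the
shattered density `u`, while `v` enters through its norm only. The constant does not depend on `R`;
this is the estimate for `coll u w` in the stability argument. -/
lemma wnorm_coll_le (hk : Exponents k l₁ l₂) (hκ : FragKernel k E δ κ) (hR : 0 ≤ R)
    (hu : Truncated k R u) (hv : Weighted k v) :
    wnorm k (coll κ l₁ l₂ u v) ≤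
      4 * (E + 1) * (wnorm k u + moment (1 + k + l₂) fun x => |u x|) * wnorm k v := by
  have h := hk.pos; have h1 := hk.le_left; have h2 := hk.le; have h3 := hk.right_le
  have hR1 : (0 : ℝ) ≤ 1 + R := by linarith
  have hφ := measurable_weight k
  have hφR : ∀ x ∈ Ioo 0 R, |x ^ k + x ^ (1 + k)| ≤ (1 + R) * x ^ k :=
    fun x hx => abs_weight_le hx
  have g1 := hκ.integrable_mul_gain hk hu.abs hv.abs hφ hφR
  have g2 := integrable_mul_mul_loss (v := fun x => |v x|) hk hu.abs hφ hφR
  have step1 : wnorm k (coll κ l₁ l₂ u v) ≤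
      (∫ x, (x ^ k + x ^ (1 + k)) *
        gain κ l₁ l₂ (fun y => |u y|) (fun y => |v y|) x ∂μ₀) +
      ∫ x, (x ^ k + x ^ (1 + k)) * (|u x| * loss l₁ l₂ (fun y => |v y|) x) ∂μ₀ := by
    rw [← integral_add g1 g2]
    refine integral_mono_ae (hκ.truncated_coll hk hu hv).weighted.integrable_weight
      (g1.add g2) ?_
    filter_upwards [ae_pos] with x hx
    rw [← mul_add]
    refine mul_le_mul_of_nonneg_left ?_ (weight_nonneg k hx)
    refine (abs_sub _ _).trans ?_
    refine add_le_add (hκ.abs_gain_le u v x) ?_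
    rw [abs_mul]
    exact mul_le_mul_of_nonneg_left (abs_loss_le v hx) (abs_nonneg _)
  rw [hκ.integral_mul_gain hk hu.abs hv.abs hφ hφR,
    integral_mul_mul_loss hk hu.abs hv.abs hφ hφR] at step1
  have i1 := hu.abs.integrable_rpow (a := k + l₁) (by linarith)
  have i2 := hu.abs.integrable_rpow (a := k + l₂) (by linarith)
  have i1' := hu.abs.integrable_rpow (a := 1 + k + l₁) (by linarith)
  have i2' := hu.abs.integrable_rpow (a := 1 + k + l₂) (by linarith)
  have i3 := hv.abs.integrable_rpow (a := l₁) (by linarith) (by linarith)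
  have i4 := hv.abs.integrable_rpow (a := l₂) (by linarith) (by linarith)
  have r1 := integrable_rpow_mul_rate i1 i2 i3 i4
  have r2 := integrable_rpow_mul_rate i1' i2' i3 i4
  have step2 : (∫ z, avg κ (fun x => x ^ k + x ^ (1 + k)) z.1 z.2 *
        collisionKernel l₁ l₂ z.1 z.2 * |u z.1| * |v z.2| ∂(μ₀.prod μ₀)) +
      (∫ z, (z.1 ^ k + z.1 ^ (1 + k)) * collisionKernel l₁ l₂ z.1 z.2 * |u z.1| * |v z.2|
        ∂(μ₀.prod μ₀)) ≤ ∫ z, (E + 1) *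
        (z.1 ^ k * collisionKernel l₁ l₂ z.1 z.2 * |u z.1| * |v z.2| +
        z.1 ^ (1 + k) * collisionKernel l₁ l₂ z.1 z.2 * |u z.1| * |v z.2|) ∂(μ₀.prod μ₀) := by
    have j1 := hκ.integrable_avg_rate hk hu.abs hv.abs hφ hR1 hφR
    have j2 := integrable_rate (C := 1 + R) (ψ := fun z : ℝ × ℝ => z.1 ^ k + z.1 ^ (1 + k))
      hk hu.abs.weighted hv.abs (hφ.comp measurable_fst)
      fun x y hx hy h => hφR x (hu.abs.mem_Ioo h)
    rw [← integral_add j1 j2]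
    refine integral_mono_ae (j1.add j2) ((r1.add r2).const_mul _) ?_
    filter_upwards [ae_pos_prod] with z hz
    have hw := hκ.avg_weight_le hz.1 hz.2
    have hP : 0 ≤ collisionKernel l₁ l₂ z.1 z.2 * |u z.1| * |v z.2| :=
      mul_nonneg (mul_nonneg (collisionKernel_nonneg hz.1.le hz.2.le) (abs_nonneg _))
        (abs_nonneg _)
    have hE : 0 ≤ E - 1 := by linarith [hκ.one_le]
    have hz1 := Real.rpow_nonneg hz.1.le (1 + k)
    have hw' : avg κ (fun x => x ^ k + x ^ (1 + k)) z.1 z.2 + (z.1 ^ k + z.1 ^ (1 + k)) ≤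
        (E + 1) * (z.1 ^ k + z.1 ^ (1 + k)) := by nlinarith
    have := mul_le_mul_of_nonneg_right hw' hP
    linarith
  refine step1.trans (step2.trans ?_)
  rw [integral_const_mul, integral_add r1 r2, integral_rpow_mul_rate i1 i2 i3 i4,
    integral_rpow_mul_rate i1' i2' i3 i4]
  have hw := hu.weighted
  have hN := wnorm_nonneg k u
  have hNv := wnorm_nonneg k v
  have hP : 0 ≤ moment (1 + k + l₂) fun x => |u x| := moment_nonneg _ fun _ => abs_nonneg _
  have j1 := hw.moment_abs_le (a := k + l₁) (by linarith) (by linarith)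
  have j2 := hw.moment_abs_le (a := k + l₂) (by linarith) (by linarith)
  have j3 := hv.moment_abs_le (a := l₁) (by linarith) (by linarith)
  have j4 := hv.moment_abs_le (a := l₂) (by linarith) (by linarith)
  -- The order `1 + k + l₁` lies between `1 + k` and `1 + k + l₂`, so only the highest moment has to
  -- be kept.
  have j5 : moment (1 + k + l₁) (fun x => |u x|) ≤
      wnorm k u + moment (1 + k + l₂) fun x => |u x| := by
    have i5 := hu.abs.integrable_rpow (a := 1 + k) (by linarith)
    calc _ ≤ moment (1 + k) (fun x => |u x|) + moment (1 + k + l₂) fun x => |u x| := by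
          rw [moment_eq, moment_eq, moment_eq, ← integral_add i5 i2']
          refine integral_mono_ae i1' (i5.add i2') ?_
          filter_upwards [ae_pos] with x hx
          rw [← add_mul]
          exact mul_le_mul_of_nonneg_right
            (rpow_le_rpow_add_rpow hx (by linarith) (by linarith)) (abs_nonneg _)
      _ ≤ _ := by linarith [hw.moment_abs_le (a := 1 + k) (by linarith) le_rfl]
  have hm1 : 0 ≤ moment l₁ fun x => |v x| := moment_nonneg _ fun _ => abs_nonneg _
  have hm2 : 0 ≤ moment l₂ fun x => |v x| := moment_nonneg _ fun _ => abs_nonneg _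
  have t1 := mul_le_mul j1 j4 hm2 hN
  have t2 := mul_le_mul j2 j3 hm1 hN
  have t3 := mul_le_mul j5 j4 hm2 (by linarith)
  have t4 := mul_le_mul_of_nonneg_left j3 hP
  have hE := hκ.one_le
  have hNN := mul_nonneg hN hNv
  have hPN := mul_nonneg hP hNv
  calc _ ≤ (E + 1) * (4 * (wnorm k u + moment (1 + k + l₂) fun x => |u x|) * wnorm k v) := by
        refine mul_le_mul_of_nonneg_left ?_ (by linarith)
        linarith
    _ = _ := by ring

/-- Here the loss is not discarded. Since `1 - s * loss ≥ 0` on the support, `|u + s coll u v| ≤ |u|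
+ s coll |u| v`; tested against the weight, the superlinear parts of gain and loss cancel and at
most `E * x ^ k` remains. No moment above `1 + k` is needed. This is the estimate for `coll w v` in
the stability argument. -/
lemma wnorm_add_coll_le (hk : Exponents k l₁ l₂) (hκ : FragKernel k E δ κ) (hR : 0 ≤ R)
    (hu : Truncated k R u) (hv : Weighted k v) (hv0 : ∀ x, 0 ≤ v x) {s : ℝ} (hs : 0 ≤ s)
    (hloss : ∀ x ∈ Ioo 0 R, s * loss l₁ l₂ v x ≤ 1) :
    wnorm k (fun x => u x + s * coll κ l₁ l₂ u v x) ≤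
      wnorm k u + s * (2 * E * wnorm k u * wnorm k v) := by
  have hR1 : (0 : ℝ) ≤ 1 + R := by linarith
  have hφ := measurable_weight k
  have hφR : ∀ x ∈ Ioo 0 R, |x ^ k + x ^ (1 + k)| ≤ (1 + R) * x ^ k :=
    fun x hx => abs_weight_le hx
  have g1 := (hκ.truncated_coll hk hu.abs hv).integrable_mul hφ hφR
  have step1 : wnorm k (fun x => u x + s * coll κ l₁ l₂ u v x) ≤ wnorm k u +
      s * ∫ x, (x ^ k + x ^ (1 + k)) * coll κ l₁ l₂ (fun y => |u y|) v x ∂μ₀ := by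
    rw [← integral_const_mul, wnorm, wnorm,
      ← integral_add hu.weighted.integrable_weight (g1.const_mul s)]
    refine integral_mono_ae
      (hu.add ((hκ.truncated_coll hk hu hv).const_mul s)).weighted.integrable_weight
      (hu.weighted.integrable_weight.add (g1.const_mul s)) ?_
    filter_upwards [ae_pos] with x hx
    have key : |u x + s * coll κ l₁ l₂ u v x| ≤ |u x| + s * coll κ l₁ l₂ (fun y => |u y|) v x := by
      have hg := hκ.abs_gain_le (l₁ := l₁) (l₂ := l₂) u v x
      simp only [abs_of_nonneg (hv0 _)] at hg
      -- Outside the support the sign of `1 - s * loss` is unknown, but `u x = 0` there.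
      have hfac : |u x * (1 - s * loss l₁ l₂ v x)| = |u x| * (1 - s * loss l₁ l₂ v x) := by
        by_cases hux : u x = 0
        · simp [hux]
        · rw [abs_mul, abs_of_nonneg (a := 1 - s * loss l₁ l₂ v x)]
          linarith [hloss x (hu.mem_Ioo hux)]
      calc |u x + s * coll κ l₁ l₂ u v x|
          = |u x * (1 - s * loss l₁ l₂ v x) + s * gain κ l₁ l₂ u v x| := by
            congr 1; simp only [coll]; ring
        _ ≤ |u x| * (1 - s * loss l₁ l₂ v x) + s * |gain κ l₁ l₂ u v x| := by
            refine (abs_add_le _ _).trans (le_of_eq ?_)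
            rw [hfac, abs_mul s, abs_of_nonneg hs]
        _ ≤ |u x| * (1 - s * loss l₁ l₂ v x) + s * gain κ l₁ l₂ (fun y => |u y|) v x := by
            gcongr
        _ = _ := by simp only [coll]; ring
    have := mul_le_mul_of_nonneg_left key (weight_nonneg k hx)
    linarith
  refine step1.trans (add_le_add le_rfl (mul_le_mul_of_nonneg_left ?_ hs))
  rw [hκ.integral_mul_coll hk hu.abs hv hφ hR1 hφR]
  have hE := hκ.one_le
  have hb : ∀ x y : ℝ, 0 < x → 0 < y → |u x| ≠ 0 → |E * x ^ k| ≤ E * x ^ k :=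
    fun x y hx _ _ => by
      rw [abs_of_nonneg (mul_nonneg (by linarith) (Real.rpow_nonneg hx.le _))]
  have r := abs_integral_rate_le (C := E) (ψ := fun z : ℝ × ℝ => E * z.1 ^ k) hk
    hu.abs.weighted hv ((measurable_fst.pow_const k).const_mul E) (by linarith) hb
  have ri := integrable_rate (C := E) (ψ := fun z : ℝ × ℝ => E * z.1 ^ k) hk
    hu.abs.weighted hv ((measurable_fst.pow_const k).const_mul E) hb
  have hww : wnorm k (fun x => |u x|) = wnorm k u := by simp only [wnorm, abs_abs]
  rw [hww] at r
  refine le_trans (integral_mono_ae ?_ ri ?_) ((le_abs_self _).trans r)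
  · have j2 := integrable_rate (C := 1 + R) (ψ := fun z : ℝ × ℝ => z.1 ^ k + z.1 ^ (1 + k))
      hk hu.abs.weighted hv (hφ.comp measurable_fst)
      fun x y hx hy h => hφR x (hu.abs.mem_Ioo h)
    refine ((hκ.integrable_avg_rate hk hu.abs hv hφ hR1 hφR).sub j2).congr
      (Filter.Eventually.of_forall fun z => ?_)
    simp only [Pi.sub_apply]; ring
  · filter_upwards [ae_pos_prod] with z hz
    have hw := hκ.avg_weight_le hz.1 hz.2
    have hz1 := Real.rpow_nonneg hz.1.le k
    have hP : 0 ≤ collisionKernel l₁ l₂ z.1 z.2 * |u z.1| * v z.2 :=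
      mul_nonneg (mul_nonneg (collisionKernel_nonneg hz.1.le hz.2.le) (abs_nonneg _)) (hv0 _)
    have hle : avg κ (fun x => x ^ k + x ^ (1 + k)) z.1 z.2 -
        (z.1 ^ k + z.1 ^ (1 + k)) ≤ E * z.1 ^ k := by linarith
    have := mul_le_mul_of_nonneg_right hle hP
    linarith

end FragKernel

section Bilinear

variable {u' v' : ℝ → ℝ}

lemma loss_sub (hk : Exponents k l₁ l₂) (hv : Weighted k v) (hv' : Weighted k v') (x : ℝ) :
    loss l₁ l₂ (fun y => v y - v' y) x = loss l₁ l₂ v x - loss l₁ l₂ v' x := by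
  have h := hk.pos; have h1 := hk.le_left; have h2 := hk.le; have h3 := hk.right_le
  unfold loss
  rw [moment_sub (hv.integrable_rpow (by linarith) (by linarith))
      (hv'.integrable_rpow (by linarith) (by linarith)),
    moment_sub (hv.integrable_rpow (by linarith) (by linarith))
      (hv'.integrable_rpow (by linarith) (by linarith))]
  ring

/-- The difference of two collision terms. -/
lemma FragKernel.coll_sub_coll (hk : Exponents k l₁ l₂) (hκ : FragKernel k E δ κ)
    (hu : Truncated k R u) (hu' : Truncated k R u') :
    (fun x => coll κ l₁ l₂ u u x - coll κ l₁ l₂ u' u' x) =ᵐ[μ₀]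
      fun x => coll κ l₁ l₂ (fun y => u y - u' y) u x +
        coll κ l₁ l₂ u' (fun y => u y - u' y) x := by
  filter_upwards [hκ.ae_integrable_gain hk hu hu.weighted,
    hκ.ae_integrable_gain hk hu' hu'.weighted, hκ.ae_integrable_gain hk hu' hu.weighted]
    with x h1 h2 h3
  have e1 : gain κ l₁ l₂ (fun y => u y - u' y) u x =
      gain κ l₁ l₂ u u x - gain κ l₁ l₂ u' u x := by
    unfold gain
    rw [← integral_sub h1 h3]
    congr 1; ext z; ring
  have e2 : gain κ l₁ l₂ u' (fun y => u y - u' y) x =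
      gain κ l₁ l₂ u' u x - gain κ l₁ l₂ u' u' x := by
    unfold gain
    rw [← integral_sub h3 h2]
    congr 1; ext z; ring
  simp only [coll]
  rw [e1, e2, loss_sub hk hu.weighted hu'.weighted]
  ring

end Bilinear

end

/-! ### The Euler scheme and its a priori bounds. -/

noncomputable section

/-- The explicit Euler scheme with step `h` for the collision equation. -/
def euler (κ : ℝ → ℝ → ℝ → ℝ) (l₁ l₂ h : ℝ) (f₀ : ℝ → ℝ) : ℕ → ℝ → ℝ
  | 0 => f₀
  | j + 1 => fun x => euler κ l₁ l₂ h f₀ j x +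
      h * coll κ l₁ l₂ (euler κ l₁ l₂ h f₀ j) (euler κ l₁ l₂ h f₀ j) x

variable {k l₁ l₂ E δ R C h : ℝ} {κ : ℝ → ℝ → ℝ → ℝ} {f f₀ : ℝ → ℝ}

namespace FragKernel

lemma truncated_step (hk : Exponents k l₁ l₂) (hκ : FragKernel k E δ κ)
    (hf : Truncated k R f) (h : ℝ) :
    Truncated k R fun x => f x + h * coll κ l₁ l₂ f f x :=
  hf.add ((hκ.truncated_coll hk hf hf.weighted).const_mul h)

lemma truncated_euler (hk : Exponents k l₁ l₂) (hκ : FragKernel k E δ κ)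
    (hf : Truncated k R f₀) (h : ℝ) (j : ℕ) : Truncated k R (euler κ l₁ l₂ h f₀ j) := by
  induction j with
  | zero => exact hf
  | succ j ih => exact hκ.truncated_step hk ih h

lemma moment_step (hk : Exponents k l₁ l₂) (hκ : FragKernel k E δ κ) (hR : 0 ≤ R)
    (hf : Truncated k R f) {a : ℝ} (ha : k ≤ a) :
    moment a (fun x => f x + h * coll κ l₁ l₂ f f x) = moment a f +
      h * ∫ z, (avg κ (fun x => x ^ a) z.1 z.2 - z.1 ^ a) * collisionKernel l₁ l₂ z.1 z.2 *
        f z.1 * f z.2 ∂(μ₀.prod μ₀) := by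
  have hc := hκ.truncated_coll hk hf hf.weighted
  rw [moment_add (hf.integrable_rpow ha) ((hc.const_mul h).integrable_rpow ha),
    moment_const_mul, moment_eq a (coll κ l₁ l₂ f f),
    hκ.integral_mul_coll (ψ := fun x => x ^ a) hk hf hf.weighted (measurable_id.pow_const a)
      (Real.rpow_nonneg hR (a - k)) fun _ hx => Truncated.rpow_bound ha hx]

lemma moment_one_step (hk : Exponents k l₁ l₂) (hκ : FragKernel k E δ κ) (hR : 0 ≤ R)
    (hf : Truncated k R f) :
    moment 1 (fun x => f x + h * coll κ l₁ l₂ f f x) = moment 1 f := by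
  rw [hκ.moment_step hk hR hf hk.lt_one.le, integral_eq_zero_of_ae]
  · simp
  · filter_upwards [ae_pos_prod] with z hz
    simp [avg, hκ.mass z.1 z.2 hz.1 hz.2]

lemma moment_step_le (hk : Exponents k l₁ l₂) (hκ : FragKernel k E δ κ) (hR : 0 ≤ R)
    (hf : Truncated k R f) (hf0 : ∀ x, 0 ≤ f x) (hh : 0 ≤ h) {a c : ℝ} (ha : k ≤ a)
    (hc : ∀ y z, 0 < y → 0 < z → avg κ (fun x => x ^ a) y z - y ^ a ≤ c * y ^ a) :
    moment a (fun x => f x + h * coll κ l₁ l₂ f f x) ≤ moment a f +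
      h * (c * (moment (a + l₁) f * moment l₂ f + moment (a + l₂) f * moment l₁ f)) := by
  have h0 := hk.pos; have h1 := hk.le_left; have h2 := hk.le; have h3 := hk.right_le
  rw [hκ.moment_step hk hR hf ha]
  have i1 := hf.integrable_rpow (a := a + l₁) (by linarith)
  have i2 := hf.integrable_rpow (a := a + l₂) (by linarith)
  have i3 := hf.integrable_rpow (a := l₁) (by linarith)
  have i4 := hf.integrable_rpow (a := l₂) (by linarith)
  refine add_le_add le_rfl (mul_le_mul_of_nonneg_left ?_ hh)
  have hψ : Measurable fun x : ℝ => x ^ a := measurable_id.pow_const a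
  have hC : ∀ x ∈ Ioo 0 R, |x ^ a| ≤ R ^ (a - k) * x ^ k :=
    fun x hx => Truncated.rpow_bound ha hx
  rw [← integral_rpow_mul_rate i1 i2 i3 i4, ← integral_const_mul]
  have r := integrable_rpow_mul_rate i1 i2 i3 i4
  refine integral_mono_ae ?_ (r.const_mul c) ?_
  · refine ((hκ.integrable_avg_rate hk hf hf.weighted hψ
      (Real.rpow_nonneg hR (a - k)) hC).sub r).congr (Filter.Eventually.of_forall fun z => ?_)
    simp only [Pi.sub_apply]; ring
  · filter_upwards [ae_pos_prod] with z hz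
    have hP : 0 ≤ collisionKernel l₁ l₂ z.1 z.2 * f z.1 * f z.2 :=
      mul_nonneg (mul_nonneg (collisionKernel_nonneg hz.1.le hz.2.le) (hf0 _)) (hf0 _)
    have := mul_le_mul_of_nonneg_right (hc z.1 z.2 hz.1 hz.2) hP
    linarith

/-- The new value is `f * (1 - h * loss) + h * gain`; the condition on `h` makes the first factor
non-negative on the support. -/
lemma step_nonneg (hk : Exponents k l₁ l₂) (hκ : FragKernel k E δ κ)
    (hf : Truncated k R f) (hf0 : ∀ x, 0 ≤ f x) (hh : 0 ≤ h)
    (hhR : h * (2 * (1 + R) * wnorm k f) ≤ 1) (x : ℝ) :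
    0 ≤ f x + h * coll κ l₁ l₂ f f x := by
  by_cases hx : x ∈ Ioo 0 R
  · have h1 := hκ.gain_nonneg (l₁ := l₁) (l₂ := l₂) hf0 hf0 x
    have h2 := mul_le_mul_of_nonneg_left (loss_le hk hf.weighted hx) hh
    have h3 : 0 ≤ f x * (1 - h * loss l₁ l₂ f x) := mul_nonneg (hf0 x) (by linarith)
    have h4 := mul_nonneg hh h1
    unfold coll
    linarith
  · exact ((hκ.truncated_step hk hf h).supp x hx).ge

end FragKernel

/-- Split at size `A`: below it `x ≤ A ^ (1 - l₁) * x ^ l₁`, above it `x ≤ A ^ (-k) * x ^ (1 + k)`.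
-/
lemma moment_one_le_add (hk : Exponents k l₁ l₂) (hf : Weighted k f) (hf0 : ∀ x, 0 ≤ f x)
    {A : ℝ} (hA : 0 < A) :
    moment 1 f ≤ A ^ (1 - l₁) * moment l₁ f + A ^ (-k) * moment (1 + k) f := by
  have h0 := hk.pos; have h1 := hk.le_left; have h2 := hk.le; have h3 := hk.right_le
  have i1 := hf.integrable_rpow (a := l₁) (by linarith) (by linarith)
  rw [moment_eq, moment_eq, moment_eq, ← integral_const_mul, ← integral_const_mul,
    ← integral_add (i1.const_mul _) (hf.high.const_mul _)]
  refine integral_mono_ae (hf.integrable_rpow (by linarith) (by linarith))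
    ((i1.const_mul _).add (hf.high.const_mul _)) ?_
  filter_upwards [ae_pos] with x hx
  rw [← mul_assoc, ← mul_assoc, ← add_mul]
  refine mul_le_mul_of_nonneg_right ?_ (hf0 x)
  have p1 : 0 ≤ A ^ (1 - l₁) * x ^ l₁ := by positivity
  have p2 : 0 ≤ A ^ (-k) * x ^ (1 + k) := by positivity
  rcases le_total x A with hxA | hxA
  · have : x ^ (1 : ℝ) ≤ A ^ (1 - l₁) * x ^ l₁ := by
      calc x ^ (1 : ℝ) = x ^ (1 - l₁) * x ^ l₁ := by rw [← Real.rpow_add hx]; simp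
        _ ≤ _ := mul_le_mul_of_nonneg_right
          (Real.rpow_le_rpow hx.le hxA (by linarith)) (Real.rpow_nonneg hx.le _)
    linarith
  · have : x ^ (1 : ℝ) ≤ A ^ (-k) * x ^ (1 + k) := by
      calc x ^ (1 : ℝ) = x ^ (-k) * x ^ (1 + k) := by rw [← Real.rpow_add hx]; simp
        _ ≤ _ := mul_le_mul_of_nonneg_right
          (Real.rpow_le_rpow_of_nonpos hA hxA (by linarith)) (Real.rpow_nonneg hx.le _)
    linarith

/-- The mass can escape neither to size zero without feeding the moment of order `l₁`, nor to
infinity because of the moment of order `1 + k`. The bound turns the dissipated product of moments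
into control of the moment of order `1 + k + l₂` alone. -/
lemma exists_le_moment (hk : Exponents k l₁ l₂) {ρ : ℝ} (hρ : 0 < ρ) (M : ℝ) :
    ∃ c > 0, ∀ f : ℝ → ℝ, Weighted k f → (∀ x, 0 ≤ f x) → ρ ≤ moment 1 f →
      moment (1 + k) f ≤ M → c ≤ moment l₁ f := by
  have hB : 0 < (2 * |M| + 1) / ρ := by positivity
  -- Chosen so that sizes above `A` carry at most half of the mass: `A ^ (-k) * M ≤ ρ / 2`.
  set A := ((2 * |M| + 1) / ρ) ^ (1 / k) with hA
  have hA0 : 0 < A := Real.rpow_pos_of_pos hB _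
  have hAk : A ^ (-k) = ρ / (2 * |M| + 1) := by
    rw [hA, ← Real.rpow_mul hB.le, show 1 / k * -k = -1 by field_simp [hk.pos.ne'],
      Real.rpow_neg_one, inv_div]
  have hA1 : 0 < A ^ (1 - l₁) := Real.rpow_pos_of_pos hA0 _
  refine ⟨ρ / 2 / A ^ (1 - l₁), by positivity, fun f hf hf0 h1 h2 => ?_⟩
  have h3 := moment_one_le_add hk hf hf0 hA0
  have h4 : A ^ (-k) * moment (1 + k) f ≤ ρ / 2 := by
    rw [hAk]
    have : ρ / (2 * |M| + 1) * moment (1 + k) f ≤ ρ / (2 * |M| + 1) * |M| :=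
      mul_le_mul_of_nonneg_left (h2.trans (le_abs_self M)) (by positivity)
    refine this.trans ?_
    rw [div_mul_eq_mul_div, div_le_iff₀ (by positivity)]
    nlinarith [abs_nonneg M]
  rw [div_le_iff₀ hA1]
  linarith

/-- A bound of the production of the moment of order `k` by a function of that moment, for
densities with mass at most `ρ` and moment of order `1 + k` at most `M`. -/
structure GrowthBound (k l₁ l₂ E ρ M : ℝ) (g : ℝ → ℝ) : Prop where
  mono : MonotoneOn g (Ici 0)
  nonneg : ∀ y, 0 ≤ y → 0 ≤ g y
  bound : ∀ f : ℝ → ℝ, Weighted k f → (∀ x, 0 ≤ f x) → moment 1 f ≤ ρ →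
    moment (1 + k) f ≤ M →
    E * (moment (k + l₁) f * moment l₂ f + moment (k + l₂) f * moment l₁ f) ≤ g (moment k f)

/-- Supersolutions on `[0, T]` of all explicit Euler schemes for `y' = g y`. -/
structure Majorant (g : ℝ → ℝ) (T : ℝ) (Y : ℝ → ℝ) : Prop where
  init : 0 ≤ Y 0
  step : ∀ t s, 0 ≤ t → 0 ≤ s → t + s ≤ T → Y t + s * g (Y t) ≤ Y (t + s)

variable {ρ M T : ℝ} {g Y : ℝ → ℝ}

lemma Majorant.nonneg (hY : Majorant g T Y) (hg : GrowthBound k l₁ l₂ E ρ M g) {t : ℝ}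
    (ht : 0 ≤ t) (htT : t ≤ T) : 0 ≤ Y t := by
  have := hY.step 0 t le_rfl ht (by linarith)
  rw [zero_add] at this
  have h1 := hg.nonneg _ hY.init
  nlinarith [hY.init]

lemma Majorant.le (hY : Majorant g T Y) (hg : GrowthBound k l₁ l₂ E ρ M g) {s t : ℝ}
    (hs : 0 ≤ s) (hst : s ≤ t) (htT : t ≤ T) : Y s ≤ Y t := by
  have := hY.step s (t - s) hs (by linarith) (by linarith)
  rw [add_sub_cancel] at this
  have h1 := hg.nonneg _ (hY.nonneg hg hs (hst.trans htT))
  nlinarith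

/-- Initial data and step sizes for which the Euler scheme is controlled on `[0, T]`. -/
structure Admissible (k ρ M T : ℝ) (Y : ℝ → ℝ) (R h : ℝ) (f₀ : ℝ → ℝ) : Prop where
  radius : 0 ≤ R
  trunc : Truncated k R f₀
  nonneg : ∀ x, 0 ≤ f₀ x
  mass_le : moment 1 f₀ ≤ ρ
  le_mass : ρ / 2 ≤ moment 1 f₀
  high : moment (1 + k) f₀ ≤ M
  low : moment k f₀ ≤ Y 0
  step_pos : 0 < h
  step_le : h * (2 * (1 + R) * (Y T + M)) ≤ 1

/-- The a priori bounds on the `j`-th iterate of the Euler scheme. -/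
structure EulerBounds (k l₁ l₂ δ h : ℝ) (Y : ℝ → ℝ) (κ : ℝ → ℝ → ℝ → ℝ) (f₀ : ℝ → ℝ) (j : ℕ) :
    Prop where
  nonneg_of_le : ∀ i ≤ j, ∀ x, 0 ≤ euler κ l₁ l₂ h f₀ i x
  mass : moment 1 (euler κ l₁ l₂ h f₀ j) = moment 1 f₀
  low : moment k (euler κ l₁ l₂ h f₀ j) ≤ Y (j * h)
  high : moment (1 + k) (euler κ l₁ l₂ h f₀ j) + δ * ∑ i ∈ Finset.range j,
    h * (moment (1 + k + l₂) (euler κ l₁ l₂ h f₀ i) * moment l₁ (euler κ l₁ l₂ h f₀ i)) ≤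
      moment (1 + k) f₀

lemma EulerBounds.nonneg {j : ℕ} (hb : EulerBounds k l₁ l₂ δ h Y κ f₀ j) (x : ℝ) :
    0 ≤ euler κ l₁ l₂ h f₀ j x := hb.nonneg_of_le j le_rfl x

lemma EulerBounds.sum_nonneg {j : ℕ} (hb : EulerBounds k l₁ l₂ δ h Y κ f₀ j) (hh : 0 ≤ h) :
    0 ≤ ∑ i ∈ Finset.range j, h *
      (moment (1 + k + l₂) (euler κ l₁ l₂ h f₀ i) * moment l₁ (euler κ l₁ l₂ h f₀ i)) :=
  Finset.sum_nonneg fun i hi =>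
    have hi' := hb.nonneg_of_le i (Finset.mem_range.1 hi).le
    mul_nonneg hh (mul_nonneg (moment_nonneg _ hi') (moment_nonneg _ hi'))

lemma wnorm_of_nonneg (hf : Weighted k f) (hf0 : ∀ x, 0 ≤ f x) :
    wnorm k f = moment k f + moment (1 + k) f := by
  rw [hf.wnorm_eq, moment_abs_of_nonneg hf0, moment_abs_of_nonneg hf0]

namespace FragKernel

/-- All bounds are propagated together: those at step `j` control the weighted norm, hence the loss
rate, hence the sign at step `j + 1`; and the sign is what makes the moment inequalities available.
-/
lemma eulerBounds (hk : Exponents k l₁ l₂) (hκ : FragKernel k E δ κ)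
    (hg : GrowthBound k l₁ l₂ E ρ M g) (hY : Majorant g T Y)
    (ha : Admissible k ρ M T Y R h f₀) (j : ℕ) (hj : j * h ≤ T) :
    EulerBounds k l₁ l₂ δ h Y κ f₀ j := by
  induction j with
  | zero => exact ⟨fun i hi => by
      rw [Nat.le_zero.1 hi]; exact ha.nonneg, rfl, by simpa [euler] using ha.low, by simp [euler]⟩
  | succ j ih =>
    push_cast at hj
    have hh := ha.step_pos
    have hjh : (0 : ℝ) ≤ j * h := by positivity
    have hjT : j * h ≤ T := by linarith
    have hn := (ih hjT).nonneg
    have hsum := mul_nonneg hκ.pos.le ((ih hjT).sum_nonneg hh.le)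
    obtain ⟨hn', hm, hl, hhi⟩ := ih hjT
    have htr := hκ.truncated_euler hk ha.trunc h j
    set f := euler κ l₁ l₂ h f₀ j with hf
    have hM : moment (1 + k) f ≤ M := by linarith [ha.high]
    have hN : wnorm k f ≤ Y T + M := by
      rw [wnorm_of_nonneg htr.weighted hn]
      linarith [hY.le hg hjh hjT le_rfl]
    have hR1 : 0 ≤ 2 * (1 + R) := by linarith [ha.radius]
    have hstep : h * (2 * (1 + R) * wnorm k f) ≤ 1 :=
      le_trans (by gcongr) ha.step_le
    refine ⟨fun i hi => ?_, ?_, ?_, ?_⟩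
    · rcases Nat.le_succ_iff.1 hi with hi | rfl
      · exact hn' i hi
      · exact hκ.step_nonneg hk htr hn hh.le hstep
    · exact (hκ.moment_one_step hk ha.radius htr).trans hm
    · have h1 := hκ.moment_step_le hk ha.radius htr hn hh.le le_rfl (c := E - 1)
        fun y z hy hz => by have := hκ.bound y z hy hz; simp only [avg]; linarith
      have h2 := hg.bound f htr.weighted hn (hm.trans_le ha.mass_le) hM
      have h3 := hY.step (j * h) h hjh hh.le (by linarith)
      -- Monotonicity of `g` transfers the production bound from the actual moment to the majorant
      -- `Y`, whose own step inequality then closes the induction.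
      have h4 := hg.mono (moment_nonneg k hn) (hY.nonneg hg hjh hjT) hl
      have h5 : 0 ≤ moment (k + l₁) f * moment l₂ f + moment (k + l₂) f * moment l₁ f :=
        add_nonneg (mul_nonneg (moment_nonneg _ hn) (moment_nonneg _ hn))
          (mul_nonneg (moment_nonneg _ hn) (moment_nonneg _ hn))
      have h6 : (E - 1) * (moment (k + l₁) f * moment l₂ f + moment (k + l₂) f * moment l₁ f) ≤
          g (Y (j * h)) := by linarith
      have h7 := mul_le_mul_of_nonneg_left h6 hh.le
      have h8 : ((j + 1 : ℕ) : ℝ) * h = j * h + h := by push_cast; ring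
      rw [h8]
      change moment k (fun x => f x + h * coll κ l₁ l₂ f f x) ≤ _
      linarith
    · have h1 := hκ.moment_step_le hk ha.radius htr hn hh.le (a := 1 + k) (by linarith)
        (c := -δ) fun y z hy hz => by
          have := hκ.damping y z hy hz; simp only [avg]; linarith
      -- Of the two dissipated products, only the one containing the order `1 + k + l₂` is kept in
      -- the sum.
      have h2 : 0 ≤ h * (δ * (moment (1 + k + l₁) f * moment l₂ f)) :=
        mul_nonneg hh.le (mul_nonneg hκ.pos.le
          (mul_nonneg (moment_nonneg _ hn) (moment_nonneg _ hn)))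
      rw [Finset.sum_range_succ]
      change moment (1 + k) (fun x => f x + h * coll κ l₁ l₂ f f x) + _ ≤ _
      simp only [← hf]
      linarith

lemma wnorm_euler_le (hk : Exponents k l₁ l₂) (hκ : FragKernel k E δ κ)
    (hg : GrowthBound k l₁ l₂ E ρ M g) (hY : Majorant g T Y)
    (ha : Admissible k ρ M T Y R h f₀) {S : ℝ} (hST : S ≤ T) {j : ℕ} (hj : j * h ≤ S) :
    wnorm k (euler κ l₁ l₂ h f₀ j) ≤ Y S + M := by
  have hb := hκ.eulerBounds hk hg hY ha j (hj.trans hST)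
  have hh := ha.step_pos
  rw [wnorm_of_nonneg (hκ.truncated_euler hk ha.trunc h j).weighted hb.nonneg]
  have h1 := hY.le hg (by positivity) hj hST
  have h2 := mul_nonneg hκ.pos.le (hb.sum_nonneg hh.le)
  linarith [hb.low, hb.high, ha.high]

/-- The moment of order `1 + k + l₂` is summable in time, uniformly in the discretization. -/
lemma sum_high_moment_le (hk : Exponents k l₁ l₂) (hκ : FragKernel k E δ κ)
    (hg : GrowthBound k l₁ l₂ E ρ M g) (hY : Majorant g T Y)
    (ha : Admissible k ρ M T Y R h f₀) {c : ℝ} (hc : 0 < c)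
    (hcf : ∀ f : ℝ → ℝ, Weighted k f → (∀ x, 0 ≤ f x) → ρ / 2 ≤ moment 1 f →
      moment (1 + k) f ≤ M → c ≤ moment l₁ f) (j : ℕ) (hj : j * h ≤ T) :
    ∑ i ∈ Finset.range j, h * moment (1 + k + l₂) (euler κ l₁ l₂ h f₀ i) ≤ M / (δ * c) := by
  have hh := ha.step_pos
  have hb := hκ.eulerBounds hk hg hY ha j hj
  rw [le_div_iff₀ (mul_pos hκ.pos hc)]
  -- Each iterate keeps the initial mass and a moment of order `1 + k` below `M`, so the factor of
  -- order `l₁` is at least `c` at every step.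
  have hle : c * ∑ i ∈ Finset.range j, h * moment (1 + k + l₂) (euler κ l₁ l₂ h f₀ i) ≤
      ∑ i ∈ Finset.range j, h * (moment (1 + k + l₂) (euler κ l₁ l₂ h f₀ i) *
        moment l₁ (euler κ l₁ l₂ h f₀ i)) := by
    rw [Finset.mul_sum]
    refine Finset.sum_le_sum fun i hi => ?_
    have hij : (i : ℝ) * h ≤ j * h := by
      have : (i : ℝ) ≤ j := by exact_mod_cast (Finset.mem_range.1 hi).le
      gcongr
    have hbi := hκ.eulerBounds hk hg hY ha i (hij.trans hj)
    have h1 := hcf _ (hκ.truncated_euler hk ha.trunc h i).weighted hbi.nonneg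
      (by rw [hbi.mass]; exact ha.le_mass)
      (by linarith [hbi.high, ha.high, mul_nonneg hκ.pos.le (hbi.sum_nonneg hh.le)])
    have h2 := mul_le_mul_of_nonneg_left h1
      (mul_nonneg hh.le (moment_nonneg (1 + k + l₂) hbi.nonneg))
    linarith
  have h3 := mul_le_mul_of_nonneg_left hle hκ.pos.le
  have h4 := moment_nonneg (1 + k) hb.nonneg
  linarith [hb.high, ha.high]

end FragKernel

end

/-! ### Consistency and stability of the Euler scheme. -/

noncomputable section

variable {k l₁ l₂ E δ R C h : ℝ} {κ : ℝ → ℝ → ℝ → ℝ} {u v f f₀ : ℝ → ℝ}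

/-- The only way to bound moments above `1 + k` at a fixed time is through `R`; this enters the
consistency error, never the Gronwall exponent. -/
lemma Truncated.moment_add_le (hu : Truncated k R u) {l : ℝ} (hl0 : 0 ≤ l) (hl1 : l ≤ 1) :
    moment (1 + k + l) (fun x => |u x|) ≤ (1 + R) * wnorm k u := by
  rw [wnorm, ← integral_const_mul]
  refine integral_mono_ae (hu.abs.integrable_rpow (by linarith))
    (hu.weighted.integrable_weight.const_mul _) ?_
  filter_upwards [ae_pos] with x hx
  by_cases h : u x = 0
  · simp [h]
  · have hm := hu.mem_Ioo h
    have h1 : x ^ l ≤ 1 + R := by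
      have := rpow_le_rpow_add_rpow hx hl0 hl1
      rw [Real.rpow_zero, Real.rpow_one] at this
      linarith [hm.2]
    rw [← mul_assoc]
    refine mul_le_mul_of_nonneg_right ?_ (abs_nonneg _)
    rw [Real.rpow_add hx, mul_comm]
    have h2 := Real.rpow_nonneg hx.le k
    have h3 := Real.rpow_nonneg hx.le (1 + k)
    exact mul_le_mul h1 (by linarith) h3 (by linarith [hm.1, hm.2])

/-- The Lipschitz constant of the collision operator on functions supported in `(0, R)`. -/
def lipConst (E R : ℝ) : ℝ := 4 * (E + 1) * (2 + R)

namespace FragKernel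

lemma wnorm_coll_le_lipConst (hk : Exponents k l₁ l₂) (hκ : FragKernel k E δ κ) (hR : 0 ≤ R)
    (hu : Truncated k R u) (hv : Weighted k v) :
    wnorm k (coll κ l₁ l₂ u v) ≤ lipConst E R * wnorm k u * wnorm k v := by
  have h0 := hk.pos; have h1 := hk.le_left; have h2 := hk.le; have h3 := hk.right_le
  refine (hκ.wnorm_coll_le hk hR hu hv).trans ?_
  refine mul_le_mul_of_nonneg_right ?_ (wnorm_nonneg _ _)
  rw [lipConst, mul_assoc (4 * (E + 1))]
  refine mul_le_mul_of_nonneg_left ?_ (by linarith [hκ.one_le])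
  linarith [hu.moment_add_le (l := l₂) (by linarith) h3]

/-- Bilinear splitting, with each of the two terms bounded by `lipConst E R`. -/
lemma wnorm_coll_sub_le (hk : Exponents k l₁ l₂) (hκ : FragKernel k E δ κ) (hR : 0 ≤ R)
    (hu : Truncated k R u) (hv : Truncated k R v) {B : ℝ} (huB : wnorm k u ≤ B)
    (hvB : wnorm k v ≤ B) :
    wnorm k (fun x => coll κ l₁ l₂ u u x - coll κ l₁ l₂ v v x) ≤
      2 * lipConst E R * B * wnorm k fun x => u x - v x := by
  have hw := hu.sub hv
  have hL : 0 ≤ lipConst E R := by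
    have := hκ.one_le
    unfold lipConst; positivity
  have hN := wnorm_nonneg k fun x => u x - v x
  rw [wnorm_congr_ae (hκ.coll_sub_coll hk hu hv)]
  refine ((hκ.truncated_coll hk hw hu.weighted).weighted.wnorm_add_le
    (hκ.truncated_coll hk hv hw.weighted).weighted).trans ?_
  have h1 := hκ.wnorm_coll_le_lipConst hk hR hw hu.weighted
  have h2 := hκ.wnorm_coll_le_lipConst hk hR hv hw.weighted
  have h3 := mul_le_mul_of_nonneg_left huB (mul_nonneg hL hN)
  have h4 := mul_le_mul_of_nonneg_left hvB (mul_nonneg hL hN)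
  linarith

section Drift

variable {B : ℝ} {i : ℕ}

lemma wnorm_euler_add_sub_le (hk : Exponents k l₁ l₂) (hκ : FragKernel k E δ κ) (hR : 0 ≤ R)
    (hh : 0 ≤ h) (hf : Truncated k R f₀) (hB : 0 ≤ B) (r : ℕ)
    (hb : ∀ s < r, wnorm k (euler κ l₁ l₂ h f₀ (i + s)) ≤ B) :
    wnorm k (fun x => euler κ l₁ l₂ h f₀ (i + r) x - euler κ l₁ l₂ h f₀ i x) ≤
      r * h * (lipConst E R * B ^ 2) := by
  have hL : 0 ≤ lipConst E R := by
    have := hκ.one_le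
    unfold lipConst; positivity
  induction r with
  | zero => simp [wnorm]
  | succ r ih =>
    have ht := hκ.truncated_euler hk hf h
    have hc := hκ.truncated_coll hk (ht (i + r)) (ht (i + r)).weighted
    have e : (fun x => euler κ l₁ l₂ h f₀ (i + (r + 1)) x - euler κ l₁ l₂ h f₀ i x) =
        fun x => (euler κ l₁ l₂ h f₀ (i + r) x - euler κ l₁ l₂ h f₀ i x) +
          h * coll κ l₁ l₂ (euler κ l₁ l₂ h f₀ (i + r)) (euler κ l₁ l₂ h f₀ (i + r)) x := by
      ext x; rw [← add_assoc, euler]; ring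
    rw [e]
    refine (((ht _).sub (ht _)).weighted.wnorm_add_le (hc.const_mul h).weighted).trans ?_
    rw [wnorm_const_mul, abs_of_nonneg hh]
    have h1 := ih fun s hs => hb s (hs.trans (Nat.lt_succ_self r))
    have h2 := hκ.wnorm_coll_le_lipConst hk hR (ht (i + r)) (ht (i + r)).weighted
    have h3 := hb r (Nat.lt_succ_self r)
    have h4 := mul_le_mul h3 h3 (wnorm_nonneg _ _) hB
    have h5 := mul_le_mul_of_nonneg_left h4 hL
    have h6 := mul_le_mul_of_nonneg_left (h2.trans ((mul_assoc _ _ _).trans_le h5)) hh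
    push_cast
    linarith

/-- Compares `r` small steps with one large step along the initial slope. Each small step errs by
`h` times the Lipschitz constant `2 * lipConst E R * B` times the drift, which is at most `m * h *
lipConst E R * B ^ 2`. -/
lemma wnorm_euler_add_sub_step_le (hk : Exponents k l₁ l₂) (hκ : FragKernel k E δ κ)
    (hR : 0 ≤ R) (hh : 0 ≤ h) (hf : Truncated k R f₀) (hB : 0 ≤ B) (m r : ℕ) (hrm : r ≤ m)
    (hb : ∀ s ≤ m, wnorm k (euler κ l₁ l₂ h f₀ (i + s)) ≤ B) :
    wnorm k (fun x => euler κ l₁ l₂ h f₀ (i + r) x - (euler κ l₁ l₂ h f₀ i x +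
      r * h * coll κ l₁ l₂ (euler κ l₁ l₂ h f₀ i) (euler κ l₁ l₂ h f₀ i) x)) ≤
      r * h * (m * h * (2 * lipConst E R ^ 2 * B ^ 3)) := by
  have hL : 0 ≤ lipConst E R := by
    have := hκ.one_le
    unfold lipConst; positivity
  have ht := hκ.truncated_euler hk hf h
  have hc := fun j => hκ.truncated_coll hk (ht j) (ht j).weighted
  induction r with
  | zero => simp [wnorm]
  | succ r ih =>
    have hrm' : r ≤ m := (Nat.le_succ r).trans hrm
    have e : (fun x => euler κ l₁ l₂ h f₀ (i + (r + 1)) x - (euler κ l₁ l₂ h f₀ i x +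
        ((r + 1 : ℕ) : ℝ) * h * coll κ l₁ l₂ (euler κ l₁ l₂ h f₀ i) (euler κ l₁ l₂ h f₀ i) x)) =
        fun x => (euler κ l₁ l₂ h f₀ (i + r) x - (euler κ l₁ l₂ h f₀ i x +
          r * h * coll κ l₁ l₂ (euler κ l₁ l₂ h f₀ i) (euler κ l₁ l₂ h f₀ i) x)) +
          h * (coll κ l₁ l₂ (euler κ l₁ l₂ h f₀ (i + r)) (euler κ l₁ l₂ h f₀ (i + r)) x -
            coll κ l₁ l₂ (euler κ l₁ l₂ h f₀ i) (euler κ l₁ l₂ h f₀ i) x) := by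
      ext x; rw [← add_assoc, euler]; push_cast; ring
    rw [e]
    refine (((ht _).sub ((ht _).add ((hc i).const_mul _))).weighted.wnorm_add_le
      (((hc _).sub (hc i)).const_mul h).weighted).trans ?_
    rw [wnorm_const_mul, abs_of_nonneg hh]
    have h1 := ih hrm'
    have h2 := hκ.wnorm_coll_sub_le hk hR (ht (i + r)) (ht i) (hb r hrm')
      (by simpa using hb 0 (Nat.zero_le m))
    have h3 := hκ.wnorm_euler_add_sub_le (l₁ := l₁) (l₂ := l₂) (i := i) hk hR hh hf hB r
      fun s hs => hb s (hs.le.trans hrm')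
    have h4 : (r : ℝ) * h * (lipConst E R * B ^ 2) ≤ m * h * (lipConst E R * B ^ 2) := by
      have : (r : ℝ) ≤ m := by exact_mod_cast hrm'
      gcongr
    have h5 := mul_le_mul_of_nonneg_left (h3.trans h4)
      (mul_nonneg (mul_nonneg zero_le_two hL) hB)
    have h6 := mul_le_mul_of_nonneg_left (h2.trans h5) hh
    push_cast
    linarith

end Drift

end FragKernel

/-- Discrete Gronwall inequality. -/
lemma le_exp_sum_mul {D a : ℕ → ℝ} {e : ℝ} (he : 0 ≤ e) (hD : 0 ≤ D 0) (n : ℕ)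
    (ha : ∀ j < n, 0 ≤ a j)
    (hstep : ∀ j < n, D (j + 1) ≤ (1 + a j) * D j + e) :
    D n ≤ Real.exp (∑ j ∈ Finset.range n, a j) * (D 0 + n * e) := by
  induction n with
  | zero => simp
  | succ n ih =>
    have h1 := ih (fun j hj => ha j (hj.trans (Nat.lt_succ_self n)))
      fun j hj => hstep j (hj.trans (Nat.lt_succ_self n))
    have h2 := hstep n (Nat.lt_succ_self n)
    have h3 := ha n (Nat.lt_succ_self n)
    rw [Finset.sum_range_succ, Real.exp_add]
    have h4 : 1 + a n ≤ Real.exp (a n) := by linarith [Real.add_one_le_exp (a n)]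
    have hs : 0 ≤ ∑ j ∈ Finset.range n, a j :=
      Finset.sum_nonneg fun j hj => ha j ((Finset.mem_range.1 hj).trans (Nat.lt_succ_self n))
    have h5 : 1 ≤ Real.exp (∑ j ∈ Finset.range n, a j) := Real.one_le_exp hs
    have h6 : 1 ≤ Real.exp (a n) := Real.one_le_exp h3
    set X := Real.exp (∑ j ∈ Finset.range n, a j)
    set Z := Real.exp (a n)
    have hDn : 0 ≤ D 0 + n * e := by positivity
    have h7 : (1 + a n) * D n ≤ Z * (X * (D 0 + n * e)) :=
      calc (1 + a n) * D n ≤ (1 + a n) * (X * (D 0 + n * e)) :=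
            mul_le_mul_of_nonneg_left h1 (by linarith)
        _ ≤ _ := mul_le_mul_of_nonneg_right h4 (by positivity)
    have h8 : e ≤ X * Z * e := by
      have : 1 ≤ X * Z := one_le_mul_of_one_le_of_one_le h5 h6
      nlinarith
    push_cast
    linarith

/-- The exponent in the stability estimate on a time interval of length `S`. -/
def stabConst (E B S D : ℝ) : ℝ := (6 * E + 4) * B * S + 4 * (E + 1) * D

namespace FragKernel

variable {ρ M T T' S B R' h' η c : ℝ} {g Y f₀' : ℝ → ℝ} {m : ℕ}

/-- Comparison of two Euler schemes at the points of the coarser grid. -/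
lemma wnorm_euler_sub_euler_le (hk : Exponents k l₁ l₂) (hκ : FragKernel k E δ κ)
    (hg : GrowthBound k l₁ l₂ E ρ M g) (hY : Majorant g T Y) (hY' : Majorant g T' Y)
    (ha : Admissible k ρ M T Y R h f₀) (ha' : Admissible k ρ M T' Y R' h' f₀')
    (hST : S ≤ T) (hST' : S ≤ T') (hRR : R ≤ R') (hm : h = m * h') (hB : Y S + M = B)
    (hB0 : 0 ≤ B)
    (hc : 0 < c) (hcf : ∀ f : ℝ → ℝ, Weighted k f → (∀ x, 0 ≤ f x) → ρ / 2 ≤ moment 1 f →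
      moment (1 + k) f ≤ M → c ≤ moment l₁ f)
    (hloss : h * (2 * (1 + R') * B) ≤ 1)
    (hη : h * (2 * lipConst E R' ^ 2 * B ^ 3) ≤ η)
    (j : ℕ) (hj : j * h ≤ S) :
    wnorm k (fun x => euler κ l₁ l₂ h' f₀' (j * m) x - euler κ l₁ l₂ h f₀ j x) ≤
      Real.exp (stabConst E B S (M / (δ * c))) * (wnorm k (fun x => f₀' x - f₀ x) + S * η) := by
  have hh := ha.step_pos
  have hh' := ha'.step_pos
  have hE := hκ.one_le
  have hR' := ha'.radius
  have hL : 0 ≤ lipConst E R' := by unfold lipConst; positivity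
  have hη0 : 0 ≤ η := le_trans (by positivity) hη
  have tU := hκ.truncated_euler hk ha.trunc h
  have tU' := fun i => (tU i).mono hRR
  have tV := hκ.truncated_euler hk ha'.trunc h'
  set U := euler κ l₁ l₂ h f₀ with hU
  set V := euler κ l₁ l₂ h' f₀' with hV
  have hP0 : ∀ i < j, 0 ≤ moment (1 + k + l₂) (U i) := fun i hi => by
    have hij : (i : ℝ) * h ≤ j * h := by
      have : (i : ℝ) ≤ j := by exact_mod_cast hi.le
      gcongr
    exact moment_nonneg _ (hκ.eulerBounds hk hg hY ha i (hij.trans (hj.trans hST))).nonneg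
  -- Growth per coarse step: `2 * E * B` from `wnorm_add_coll_le`, and `4 * (E + 1) * (B + moment (1
  -- + k + l₂) (U i))` from `wnorm_coll_le`. The first two contributions add up to `(6 * E + 4) *
  -- B`; the last one is summable.
  have key := le_exp_sum_mul (D := fun i => wnorm k fun x => V (i * m) x - U i x)
    (a := fun i => h * ((6 * E + 4) * B) + 4 * (E + 1) * (h * moment (1 + k + l₂) (U i)))
    (e := h * η) (by positivity) (wnorm_nonneg _ _) j
    (fun i hi => by have := hP0 i hi; positivity) (fun i hi => ?_)
  · refine key.trans ?_
    have hD0 : (fun x => V (0 * m) x - U 0 x) = fun x => f₀' x - f₀ x := by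
      simp [hU, hV, euler]
    rw [hD0]
    have hN := wnorm_nonneg k fun x => f₀' x - f₀ x
    have hS0 : 0 ≤ S := le_trans (by positivity) hj
    refine mul_le_mul (Real.exp_le_exp.2 ?_) ?_ (by positivity) (Real.exp_pos _).le
    · have hsum : ∑ i ∈ Finset.range j, (h * ((6 * E + 4) * B) +
          4 * (E + 1) * (h * moment (1 + k + l₂) (U i))) = j * (h * ((6 * E + 4) * B)) +
          4 * (E + 1) * ∑ i ∈ Finset.range j, h * moment (1 + k + l₂) (U i) := by
        rw [Finset.sum_add_distrib, Finset.mul_sum, Finset.sum_const, Finset.card_range,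
          nsmul_eq_mul]
      rw [hsum, stabConst]
      have h1 := hκ.sum_high_moment_le hk hg hY ha hc hcf j (hj.trans hST)
      have h2 : (j : ℝ) * (h * ((6 * E + 4) * B)) ≤ (6 * E + 4) * B * S := by
        have := mul_le_mul_of_nonneg_left hj (show 0 ≤ (6 * E + 4) * B by positivity)
        linarith
      have h3 := mul_le_mul_of_nonneg_left h1 (show 0 ≤ 4 * (E + 1) by positivity)
      linarith
    · have := mul_le_mul_of_nonneg_right hj hη0
      linarith
  · have hi1 : ((i + 1 : ℕ) : ℝ) ≤ j := by exact_mod_cast hi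
    have hiS : ((i + 1 : ℕ) : ℝ) * h ≤ S := le_trans (by gcongr) hj
    push_cast at hiS
    have hVB : ∀ s ≤ m, wnorm k (V (i * m + s)) ≤ B := fun s hs => by
      rw [← hB]
      refine hκ.wnorm_euler_le hk hg hY' ha' hST' (le_trans ?_ hiS)
      have : (s : ℝ) ≤ m := by exact_mod_cast hs
      rw [hm]
      push_cast
      have := mul_le_mul_of_nonneg_right this hh'.le
      linarith
    have hUB : wnorm k (U i) ≤ B := by
      rw [← hB]
      exact hκ.wnorm_euler_le hk hg hY ha hST (by linarith)
    have hV0 := (hκ.eulerBounds hk hg hY' ha' (i * m) (by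
      push_cast
      have : (i : ℝ) * m * h' = i * h := by rw [hm]; ring
      linarith)).nonneg
    have hU0 := (hκ.eulerBounds hk hg hY ha i (by linarith)).nonneg
    have hVi := hVB 0 (Nat.zero_le m)
    rw [add_zero] at hVi
    have z := hκ.wnorm_euler_add_sub_step_le (i := i * m) hk hR' hh'.le ha'.trunc hB0 m m le_rfl
      hVB
    rw [← hm, ← hV] at z
    have w := (tV (i * m)).sub (tU' i)
    have a1 := hκ.wnorm_add_coll_le hk hR' w (tV (i * m)).weighted hV0 hh.le fun x hx => by
      refine le_trans (mul_le_mul_of_nonneg_left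
        ((loss_le hk (tV (i * m)).weighted hx).trans ?_) hh.le) hloss
      gcongr
    have a2 := hκ.wnorm_coll_le hk ha.radius (tU i) w.weighted
    rw [moment_abs_of_nonneg hU0] at a2
    -- With `W` the difference at step `i`, the new difference is `(W + h coll W V) + h coll U W`
    -- plus the consistency error of the `m` fine steps. Only the first bracket uses the
    -- compensation by the loss.
    have e : (fun x => V ((i + 1) * m) x - U (i + 1) x) =ᵐ[μ₀] fun x =>
        ((V (i * m) x - U i x) +
          h * coll κ l₁ l₂ (fun y => V (i * m) y - U i y) (V (i * m)) x) +
        (h * coll κ l₁ l₂ (U i) (fun y => V (i * m) y - U i y) x +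
        (V (i * m + m) x - (V (i * m) x + h * coll κ l₁ l₂ (V (i * m)) (V (i * m)) x))) := by
      filter_upwards [hκ.coll_sub_coll (l₁ := l₁) (l₂ := l₂) hk (tV (i * m)) (tU' i)] with x hx
      have h1 : U (i + 1) x = U i x + h * coll κ l₁ l₂ (U i) (U i) x := rfl
      rw [h1, add_mul, one_mul]
      have h2 := congrArg (fun y => h * y) hx
      linarith
    have t1 := w.add ((hκ.truncated_coll hk w (tV (i * m)).weighted).const_mul h)
    have t2 := (hκ.truncated_coll hk (tU' i) w.weighted).const_mul h
    have t3 := (tV (i * m + m)).sub ((tV (i * m)).add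
      ((hκ.truncated_coll hk (tV (i * m)) (tV (i * m)).weighted).const_mul h))
    rw [wnorm_congr_ae e]
    refine (t1.weighted.wnorm_add_le (t2.add t3).weighted).trans ?_
    have t23 := t2.weighted.wnorm_add_le t3.weighted
    rw [wnorm_const_mul, abs_of_pos hh] at t23
    have z' := mul_le_mul_of_nonneg_left hη hh.le
    have hW := wnorm_nonneg k fun x => V (i * m) x - U i x
    set W := wnorm k fun x => V (i * m) x - U i x
    have b1 := mul_le_mul_of_nonneg_left hVi (show 0 ≤ h * (2 * E * W) by positivity)
    have b2 := mul_le_mul_of_nonneg_left hUB (show 0 ≤ h * (4 * (E + 1) * W) by positivity)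
    have b3 := mul_le_mul_of_nonneg_left a2 hh.le
    linarith

/-- Comparison of the piecewise constant interpolations of two Euler schemes. -/
lemma wnorm_euler_floor_sub_le (hk : Exponents k l₁ l₂) (hκ : FragKernel k E δ κ)
    (hg : GrowthBound k l₁ l₂ E ρ M g) (hY : Majorant g T Y) (hY' : Majorant g T' Y)
    (ha : Admissible k ρ M T Y R h f₀) (ha' : Admissible k ρ M T' Y R' h' f₀')
    (hST : S ≤ T) (hST' : S ≤ T') (hRR : R ≤ R') (hm : h = m * h') (hB : Y S + M = B)
    (hB0 : 0 ≤ B)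
    (hc : 0 < c) (hcf : ∀ f : ℝ → ℝ, Weighted k f → (∀ x, 0 ≤ f x) → ρ / 2 ≤ moment 1 f →
      moment (1 + k) f ≤ M → c ≤ moment l₁ f)
    (hloss : h * (2 * (1 + R') * B) ≤ 1)
    (hη : h * (2 * lipConst E R' ^ 2 * B ^ 3) ≤ η) (hη' : h * (lipConst E R' * B ^ 2) ≤ η)
    {t : ℝ} (ht : 0 ≤ t) (htS : t ≤ S) :
    wnorm k (fun x => euler κ l₁ l₂ h' f₀' ⌊t / h'⌋₊ x - euler κ l₁ l₂ h f₀ ⌊t / h⌋₊ x) ≤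
      Real.exp (stabConst E B S (M / (δ * c))) * (wnorm k (fun x => f₀' x - f₀ x) + S * η) +
        η := by
  have hh := ha.step_pos
  have hh' := ha'.step_pos
  have hE := hκ.one_le
  have hR' := ha'.radius
  have hL : 0 ≤ lipConst E R' := by unfold lipConst; positivity
  have hm0 : 0 < m := by
    rcases Nat.eq_zero_or_pos m with rfl | h0
    · simp at hm; linarith
    · exact h0
  -- The grids are nested: the coarse index is an integer quotient, and the remaining fewer than `m`
  -- fine steps are estimated by the drift bound.
  have hfl : ⌊t / h⌋₊ = ⌊t / h'⌋₊ / m := by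
    rw [← Nat.floor_div_natCast, hm, mul_comm, div_div]
  set j := ⌊t / h⌋₊ with hj
  set i := ⌊t / h'⌋₊ with hi
  have hih : (i : ℝ) * h' ≤ t := (le_div_iff₀ hh').1 (Nat.floor_le (by positivity))
  have hjh : (j : ℝ) * h ≤ t := (le_div_iff₀ hh).1 (Nat.floor_le (by positivity))
  have h1 := hκ.wnorm_euler_sub_euler_le hk hg hY hY' ha ha' hST hST' hRR hm hB hB0 hc hcf hloss
    hη j (hjh.trans htS)
  have hdecomp : j * m + i % m = i := by rw [hfl, mul_comm]; exact Nat.div_add_mod i m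
  have hmod : i % m ≤ m := (Nat.mod_lt i hm0).le
  have h2 := hκ.wnorm_euler_add_sub_le (l₁ := l₁) (l₂ := l₂) (i := j * m) hk hR' hh'.le ha'.trunc
    hB0 (i % m) fun s hs => by
      rw [← hB]
      refine hκ.wnorm_euler_le hk hg hY' ha' hST' (le_trans ?_ (hih.trans htS))
      have : ((j * m + s : ℕ) : ℝ) ≤ i := by exact_mod_cast (by omega)
      gcongr
  rw [hdecomp] at h2
  have h3 : ((i % m : ℕ) : ℝ) * h' * (lipConst E R' * B ^ 2) ≤ η := by
    refine le_trans ?_ hη'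
    rw [hm]
    have : ((i % m : ℕ) : ℝ) ≤ m := by exact_mod_cast hmod
    gcongr
  have tU := hκ.truncated_euler (l₁ := l₁) (l₂ := l₂) hk ha.trunc h
  have tV := hκ.truncated_euler (l₁ := l₁) (l₂ := l₂) hk ha'.trunc h'
  have h4 := ((tV i).weighted.sub (tV (j * m)).weighted).wnorm_add_le
    ((tV (j * m)).weighted.sub (tU j).weighted)
  have e : (fun x => euler κ l₁ l₂ h' f₀' i x - euler κ l₁ l₂ h f₀ j x) = fun x =>
      (euler κ l₁ l₂ h' f₀' i x - euler κ l₁ l₂ h' f₀' (j * m) x) +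
      (euler κ l₁ l₂ h' f₀' (j * m) x - euler κ l₁ l₂ h f₀ j x) := by ext x; ring
  rw [e]
  linarith

end FragKernel

end

/-! ### Moment interpolation, growth of the moment of order `k`, and the existence time. -/

noncomputable section

variable {k l₁ l₂ E ρ M : ℝ} {f : ℝ → ℝ}

/-- Interpolation of moments. -/
lemma moment_le_rpow_mul_rpow {a b c : ℝ} (hf : Measurable f) (hf0 : ∀ x, 0 ≤ f x) (hab : a ≤ b)
    (hbc : b ≤ c) (hac : a < c) (ha : Integrable (fun x => x ^ a * f x) μ₀)
    (hc : Integrable (fun x => x ^ c * f x) μ₀) :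
    moment b f ≤ moment a f ^ ((c - b) / (c - a)) * moment c f ^ ((b - a) / (c - a)) := by
  have hca : 0 < c - a := by linarith
  have hA := moment_nonneg a hf0
  have hC := moment_nonneg c hf0
  -- If one moment vanishes then `f = 0` almost everywhere, so all do; afterwards division by the
  -- extreme moments is allowed.
  have hzero : ∀ d, moment d f = 0 → Integrable (fun x => x ^ d * f x) μ₀ →
      moment b f = 0 := fun d hd hi => by
    have h0 : 0 ≤ᵐ[μ₀] fun x => x ^ d * f x := by
      filter_upwards [ae_pos] with x hx
      exact mul_nonneg (Real.rpow_nonneg hx.le _) (hf0 x)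
    have h1 := (integral_eq_zero_iff_of_nonneg_ae h0 hi).1 hd
    refine integral_eq_zero_of_ae ?_
    filter_upwards [h1, ae_pos] with x h1 hx
    rcases mul_eq_zero.1 h1 with h | h
    · exact absurd h (Real.rpow_pos_of_pos hx d).ne'
    · simp [h]
  rcases hA.eq_or_lt with hA0 | hA0
  · rw [hzero a hA0.symm ha]; positivity
  rcases hC.eq_or_lt with hC0 | hC0
  · rw [hzero c hC0.symm hc]; positivity
  set θ := (c - b) / (c - a) with hθ
  set η := (b - a) / (c - a) with hη
  have hθ0 : 0 ≤ θ := div_nonneg (by linarith) hca.le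
  have hη0 : 0 ≤ η := div_nonneg (by linarith) hca.le
  have hsum : θ + η = 1 := by rw [hθ, hη]; field_simp; ring
  have hb : b = a * θ + c * η := by rw [hθ, hη]; field_simp; ring
  set A := moment a f
  set D := moment c f
  have hi := integrable_rpow_of_le_of_le hf hab hbc ha hc
  have hAD : 0 ≤ A ^ θ * D ^ η := by positivity
  calc moment b f ≤ ∫ x, A ^ θ * D ^ η * (θ / A * (x ^ a * f x) + η / D * (x ^ c * f x)) ∂μ₀ := by
        refine integral_mono_ae hi (((ha.const_mul _).add (hc.const_mul _)).const_mul _) ?_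
        filter_upwards [ae_pos] with x hx
        -- Hölder in the form of weighted arithmetic-geometric means for the normalized powers `x ^
        -- a / A` and `x ^ c / D`; after integration the right side is `θ + η = 1`.
        have hy := Real.geom_mean_le_arith_mean2_weighted hθ0 hη0
          (div_nonneg (Real.rpow_nonneg hx.le a) hA) (div_nonneg (Real.rpow_nonneg hx.le c) hC) hsum
        rw [Real.div_rpow (Real.rpow_nonneg hx.le a) hA, Real.div_rpow (Real.rpow_nonneg hx.le c) hC,
          ← Real.rpow_mul hx.le, ← Real.rpow_mul hx.le] at hy
        have e : x ^ b = A ^ θ * D ^ η * (x ^ (a * θ) / A ^ θ * (x ^ (c * η) / D ^ η)) := by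
          rw [hb, Real.rpow_add hx]
          have h1 := (Real.rpow_pos_of_pos hA0 θ).ne'
          have h2 := (Real.rpow_pos_of_pos hC0 η).ne'
          field_simp
        have h3 := mul_le_mul_of_nonneg_right (mul_le_mul_of_nonneg_left hy hAD) (hf0 x)
        rw [← e] at h3
        refine h3.trans (le_of_eq ?_)
        ring
    _ = A ^ θ * D ^ η * (θ / A * A + η / D * D) := by
        rw [integral_const_mul, integral_add (ha.const_mul _) (hc.const_mul _),
          integral_const_mul, integral_const_mul]
        rfl
    _ = A ^ θ * D ^ η := by
        rw [div_mul_cancel₀ _ hA0.ne', div_mul_cancel₀ _ hC0.ne', hsum, mul_one]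

lemma moment_le_of_mass_le (hk0 : 0 < k) (hk1 : k < 1) {b : ℝ} (hf : Weighted k f)
    (hf0 : ∀ x, 0 ≤ f x) (hm : moment 1 f ≤ ρ) (h1 : k ≤ b) (h2 : b ≤ 1) :
    moment b f ≤ moment k f ^ ((1 - b) / (1 - k)) * ρ ^ ((b - k) / (1 - k)) := by
  refine (moment_le_rpow_mul_rpow hf.meas hf0 h1 h2 hk1 hf.low
    (hf.integrable_rpow hk1.le (by linarith))).trans ?_
  refine mul_le_mul_of_nonneg_left (Real.rpow_le_rpow (moment_nonneg _ hf0) hm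
    (div_nonneg (by linarith) (by linarith))) (Real.rpow_nonneg (moment_nonneg _ hf0) _)

lemma rpow_le_one_add {y p : ℝ} (hy : 0 ≤ y) (hp0 : 0 ≤ p) (hp1 : p ≤ 1) : y ^ p ≤ 1 + y := by
  rcases le_total y 1 with h | h
  · linarith [Real.rpow_le_one hy h hp0]
  · have := Real.rpow_le_rpow_of_exponent_le h hp1
    rw [Real.rpow_one] at this
    linarith

/-- For exponents with sum at least one, the production term grows at most linearly. -/
lemma exists_product_le (hk0 : 0 < k) (hk1 : k < 1) (hρ : 0 ≤ ρ) (hM : 0 ≤ M) {a b : ℝ}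
    (ha : k ≤ a) (ha1 : a ≤ 1) (hb : k ≤ b) (hb1 : b ≤ 1) (hab : 1 ≤ a + b) :
    ∃ C, 0 ≤ C ∧ ∀ f : ℝ → ℝ, Weighted k f → (∀ x, 0 ≤ f x) → moment 1 f ≤ ρ →
      moment (1 + k) f ≤ M → moment (k + a) f * moment b f ≤ C * (1 + moment k f) := by
  have hk' : 0 < 1 - k := by linarith
  -- If `k + a ≤ 1`, both moments are interpolated between `k` and `1`; the resulting exponents of
  -- `moment k f` add up to `(2 - k - a - b) / (1 - k)`, at most one because `a + b ≥ 1`. If `k + a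
  -- > 1`, the first moment is bounded by `ρ + M`, and the second contributes an exponent at most
  -- one because `b ≥ k`.
  rcases le_or_gt (k + a) 1 with h | h
  · refine ⟨ρ ^ ((k + a - k) / (1 - k)) * ρ ^ ((b - k) / (1 - k)), by positivity,
      fun f hf hf0 hm _ => ?_⟩
    have h1 := moment_le_of_mass_le hk0 hk1 hf hf0 hm (b := k + a) (by linarith) h
    have h2 := moment_le_of_mass_le hk0 hk1 hf hf0 hm hb hb1
    have hy := moment_nonneg k hf0
    set y := moment k f
    have p1 : 0 ≤ (1 - (k + a)) / (1 - k) := div_nonneg (by linarith) hk'.le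
    have p2 : 0 ≤ (1 - b) / (1 - k) := div_nonneg (by linarith) hk'.le
    have h3 := mul_le_mul h1 h2 (moment_nonneg _ hf0) (by positivity)
    have h4 : y ^ ((1 - (k + a)) / (1 - k)) * y ^ ((1 - b) / (1 - k)) ≤ 1 + y := by
      rw [← Real.rpow_add_of_nonneg hy p1 p2]
      refine rpow_le_one_add hy (add_nonneg p1 p2) ?_
      rw [← add_div, div_le_one hk']
      linarith
    have h5 := mul_le_mul_of_nonneg_left h4
      (show 0 ≤ ρ ^ ((k + a - k) / (1 - k)) * ρ ^ ((b - k) / (1 - k)) by positivity)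
    linarith
  · refine ⟨(ρ + M) * ρ ^ ((b - k) / (1 - k)), by positivity, fun f hf hf0 hm hM' => ?_⟩
    have h2 := moment_le_of_mass_le hk0 hk1 hf hf0 hm hb hb1
    have hy := moment_nonneg k hf0
    set y := moment k f
    have i1 := hf.integrable_rpow (a := 1) hk1.le (by linarith)
    have h1 : moment (k + a) f ≤ ρ + M := by
      refine le_trans ?_ (add_le_add hm hM')
      rw [moment_eq, moment_eq, moment_eq, ← integral_add i1 hf.high]
      refine integral_mono_ae (hf.integrable_rpow (by linarith) (by linarith))
        (i1.add hf.high) ?_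
      filter_upwards [ae_pos] with x hx
      rw [← add_mul]
      exact mul_le_mul_of_nonneg_right (rpow_le_rpow_add_rpow hx h.le (by linarith)) (hf0 x)
    have h4 := rpow_le_one_add hy (p := (1 - b) / (1 - k)) (div_nonneg (by linarith) hk'.le)
      (by rw [div_le_one hk']; linarith)
    have h5 : moment b f ≤ (1 + y) * ρ ^ ((b - k) / (1 - k)) :=
      h2.trans (mul_le_mul_of_nonneg_right h4 (by positivity))
    have h6 := mul_le_mul h1 h5 (moment_nonneg _ hf0) (by positivity)
    linarith

lemma exists_linear_growthBound (hk : Exponents k l₁ l₂) (hE : 0 ≤ E) (hρ : 0 ≤ ρ) (hM : 0 ≤ M)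
    (hl : 1 ≤ l₁ + l₂) : ∃ G, 0 ≤ G ∧ GrowthBound k l₁ l₂ E ρ M fun y => G * (1 + y) := by
  have h0 := hk.pos; have h1 := hk.le_left; have h2 := hk.le; have h3 := hk.right_le
  obtain ⟨C₁, hC₁, h₁⟩ := exists_product_le hk.pos hk.lt_one hρ hM (a := l₁) (b := l₂)
    (by linarith) (by linarith) (by linarith) (by linarith) hl
  obtain ⟨C₂, hC₂, h₂⟩ := exists_product_le hk.pos hk.lt_one hρ hM (a := l₂) (b := l₁)
    (by linarith) (by linarith) (by linarith) (by linarith) (by linarith)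
  refine ⟨E * (C₁ + C₂), by positivity, fun x _ y _ hxy => ?_, fun y hy => by positivity,
    fun f hf hf0 hm hM' => ?_⟩
  · have : 0 ≤ E * (C₁ + C₂) := by positivity
    gcongr
  · have := mul_le_mul_of_nonneg_left (add_le_add (h₁ f hf hf0 hm hM') (h₂ f hf hf0 hm hM')) hE
    linarith

/-- The exact solution of `y' = G * (1 + y)`; convexity of the exponential puts it above its Euler
steps. -/
lemma majorant_exp {G y₀ : ℝ} (hy : 0 ≤ y₀) (T : ℝ) :
    Majorant (fun y => G * (1 + y)) T fun t => (1 + y₀) * Real.exp (G * t) - 1 := by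
  refine ⟨by simpa using hy, fun t s ht hs _ => ?_⟩
  have h1 : Real.exp (G * (t + s)) = Real.exp (G * t) * Real.exp (G * s) := by
    rw [mul_add, Real.exp_add]
  have h2 := Real.add_one_le_exp (G * s)
  have h3 := mul_le_mul_of_nonneg_left h2
    (show 0 ≤ (1 + y₀) * Real.exp (G * t) by positivity)
  rw [h1]
  linarith

lemma growthConst_pos (hE : 0 < E) {uin : ℝ → ℝ} (hm : 0 < moment 1 uin) :
    0 < growthConst k l₁ l₂ E uin := by
  refine mul_pos hE (lt_max_of_lt_left (mul_pos (lt_max_of_lt_left ?_) ?_)) <;>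
  exact Real.rpow_pos_of_pos hm _

/-- From `k + a ≤ a + b < 1`, both moments are interpolated between `k` and `1`, and the exponents
of `moment k f` add up to `1 + (1 - (l₁ + l₂)) / (1 - k)`. The powers of the mass are those of the
first entry of the maximum in `momentConst`. -/
lemma growthBound_power (hk : Exponents k l₁ l₂) (hE : 0 < E) {uin : ℝ → ℝ}
    (hm : 0 < moment 1 uin) (hl : l₁ + l₂ < 1) (M : ℝ) :
    GrowthBound k l₁ l₂ E (moment 1 uin) M fun y =>
      2 * growthConst k l₁ l₂ E uin * y ^ (1 + (1 - (l₁ + l₂)) / (1 - k)) := by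
  have h0 := hk.pos; have h1 := hk.le_left; have h2 := hk.le; have h3 := hk.right_le
  have hk' : 0 < 1 - k := by linarith [hk.lt_one]
  have hc3 := growthConst_pos (k := k) (l₁ := l₁) (l₂ := l₂) hE hm
  have hp : 0 ≤ 1 + (1 - (l₁ + l₂)) / (1 - k) := by
    have : 0 ≤ (1 - (l₁ + l₂)) / (1 - k) := div_nonneg (by linarith) hk'.le
    linarith
  refine ⟨fun x hx y hy hxy => ?_, fun y hy => by positivity, fun f hf hf0 hm' _ => ?_⟩
  · exact mul_le_mul_of_nonneg_left (Real.rpow_le_rpow hx hxy hp) (by positivity)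
  · have hy := moment_nonneg k hf0
    have key : ∀ a b, k ≤ a → k ≤ b → b ≤ 1 → a + b = l₁ + l₂ →
        moment (k + a) f * moment b f ≤ moment k f ^ (1 + (1 - (l₁ + l₂)) / (1 - k)) *
          (momentConst k a uin * moment 1 uin ^ ((b - k) / (1 - k))) :=
      fun a b ha hb hb1 hab => by
      have e1 := moment_le_of_mass_le hk.pos hk.lt_one hf hf0 hm' (b := k + a) (by linarith)
        (by linarith)
      have e2 := moment_le_of_mass_le hk.pos hk.lt_one hf hf0 hm' hb hb1
      have p1 : 0 ≤ (1 - (k + a)) / (1 - k) := div_nonneg (by linarith) hk'.le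
      have p2 : 0 ≤ (1 - b) / (1 - k) := div_nonneg (by linarith) hk'.le
      have e3 := mul_le_mul e1 e2 (moment_nonneg _ hf0) (by positivity)
      have e4 : moment k f ^ (1 + (1 - (l₁ + l₂)) / (1 - k)) =
          moment k f ^ ((1 - (k + a)) / (1 - k)) * moment k f ^ ((1 - b) / (1 - k)) := by
        rw [← Real.rpow_add_of_nonneg hy p1 p2]
        congr 1
        rw [← hab]
        field_simp
        ring
      have e5 : moment 1 uin ^ ((k + a - k) / (1 - k)) ≤ momentConst k a uin := by
        rw [add_sub_cancel_left]
        exact le_max_left _ _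
      rw [e4]
      have e6 := mul_le_mul_of_nonneg_left e5 (show 0 ≤ moment k f ^ ((1 - (k + a)) / (1 - k)) *
        moment k f ^ ((1 - b) / (1 - k)) * moment 1 uin ^ ((b - k) / (1 - k)) by positivity)
      linarith
    have k1 := key l₁ l₂ (by linarith) (by linarith) (by linarith) rfl
    have k2 := key l₂ l₁ (by linarith) (by linarith) (by linarith) (by ring)
    have hyp : 0 ≤ moment k f ^ (1 + (1 - (l₁ + l₂)) / (1 - k)) := by positivity
    have m1 := mul_le_mul_of_nonneg_left (le_max_left
      (momentConst k l₁ uin * moment 1 uin ^ ((l₂ - k) / (1 - k)))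
      (momentConst k l₂ uin * moment 1 uin ^ ((l₁ - k) / (1 - k)))) hyp
    have m2 := mul_le_mul_of_nonneg_left (le_max_right
      (momentConst k l₁ uin * moment 1 uin ^ ((l₂ - k) / (1 - k)))
      (momentConst k l₂ uin * moment 1 uin ^ ((l₁ - k) / (1 - k)))) hyp
    unfold growthConst
    have := mul_le_mul_of_nonneg_left (add_le_add (k1.trans m1) (k2.trans m2)) hE.le
    linarith

/-- The exact solution of `y' = c * y ^ (1 + γ)`, which blows up when `c * γ * t` reaches `y₀ ^
(-γ)`. -/
lemma majorant_power {c γ y₀ T : ℝ} (hc : 0 < c) (hγ : 0 < γ) (hy : 0 < y₀)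
    (hT : c * γ * T < y₀ ^ (-γ)) :
    Majorant (fun y => c * y ^ (1 + γ)) T fun t => (y₀ ^ (-γ) - c * γ * t) ^ (-(1 / γ)) := by
  have hy' := Real.rpow_pos_of_pos hy (-γ)
  refine ⟨by simp only [mul_zero, sub_zero]; positivity, fun t s ht hs hts => ?_⟩
  have hlt : c * γ * (t + s) < y₀ ^ (-γ) :=
    lt_of_le_of_lt (mul_le_mul_of_nonneg_left hts (by positivity)) hT
  have hs' : 0 ≤ c * γ * s := by positivity
  set σ := y₀ ^ (-γ) - c * γ * t with hσ
  have hσ0 : 0 < σ := by rw [hσ]; linarith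
  have e : y₀ ^ (-γ) - c * γ * (t + s) = σ * (1 - c * γ * s / σ) := by
    rw [mul_sub, mul_one, mul_div_cancel₀ _ hσ0.ne']; rw [hσ]; ring
  set b := c * γ * s / σ with hb
  have hb1 : b < 1 := by rw [hb, div_lt_one hσ0]; rw [hσ]; linarith
  rw [e, Real.mul_rpow hσ0.le (by linarith), ← Real.rpow_mul hσ0.le,
    show -(1 / γ) * (1 + γ) = -(1 / γ) + -1 by field_simp; ring, Real.rpow_add hσ0,
    Real.rpow_neg_one]
  -- After factoring out `σ`, the supersolution property is this Bernoulli-type inequality; both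
  -- sides are compared with `Real.exp (b / γ)`.
  have h1 : 1 + b / γ ≤ (1 - b) ^ (-(1 / γ)) := by
    rw [Real.rpow_neg (by linarith), ← Real.inv_rpow (by linarith)]
    have h2 : Real.exp b ≤ (1 - b)⁻¹ := by
      rw [le_inv_comm₀ (Real.exp_pos b) (by linarith), ← Real.exp_neg]
      linarith [Real.add_one_le_exp (-b)]
    calc 1 + b / γ ≤ Real.exp (b / γ) := by linarith [Real.add_one_le_exp (b / γ)]
      _ = Real.exp b ^ (1 / γ) := by rw [← Real.exp_mul]; congr 1; ring
      _ ≤ _ := Real.rpow_le_rpow (Real.exp_pos b).le h2 (by positivity)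
  have h3 := mul_le_mul_of_nonneg_left h1 (Real.rpow_nonneg hσ0.le (-(1 / γ)))
  refine le_trans (le_of_eq ?_) h3
  rw [hb]
  field_simp

/-- A vanishing moment of a non-negative function forces it to vanish almost everywhere, hence all
its moments vanish. -/
lemma moment_pos_of_pos {a b : ℝ} (hf0 : ∀ x, 0 ≤ f x) (hi : Integrable (fun x => x ^ a * f x) μ₀)
    (hb : 0 < moment b f) : 0 < moment a f := by
  refine (moment_nonneg a hf0).lt_of_ne fun h => hb.ne' ?_
  have h0 : 0 ≤ᵐ[μ₀] fun x => x ^ a * f x := by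
    filter_upwards [ae_pos] with x hx
    exact mul_nonneg (Real.rpow_nonneg hx.le _) (hf0 x)
  have h1 := (integral_eq_zero_iff_of_nonneg_ae h0 hi).1 h.symm
  refine integral_eq_zero_of_ae ?_
  filter_upwards [h1, ae_pos] with x h1 hx
  rcases mul_eq_zero.1 h1 with h | h
  · exact absurd h (Real.rpow_pos_of_pos hx a).ne'
  · simp [h]

/-- The moment of order `k` of the Euler schemes is controlled up to the existence time. -/
lemma exists_growthBound_majorant (hk : Exponents k l₁ l₂) (hE : 0 < E) {uin : ℝ → ℝ}
    (hu : Weighted k uin) (hu0 : ∀ x, 0 ≤ uin x) (hm : 0 < moment 1 uin) :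
    (0 : EReal) < existenceTime k l₁ l₂ E uin ∧
    ∃ g Y : ℝ → ℝ, GrowthBound k l₁ l₂ E (moment 1 uin) (moment (1 + k) uin) g ∧
      Y 0 = moment k uin ∧
      ∀ T : ℝ, (T : EReal) < existenceTime k l₁ l₂ E uin → Majorant g T Y := by
  have hy := moment_pos_of_pos hu0 hu.low hm
  unfold existenceTime
  split_ifs with hl
  · have hk' : 0 < 1 - k := by linarith [hk.lt_one]
    have hc3 := growthConst_pos (k := k) (l₁ := l₁) (l₂ := l₂) hE hm
    have hγ : 0 < (1 - (l₁ + l₂)) / (1 - k) := div_pos (by linarith) hk'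
    set γ := (1 - (l₁ + l₂)) / (1 - k) with hγd
    -- `localTime` is the blow-up time of the majorant started at `moment k uin`.
    have e : localTime k l₁ l₂ E uin =
        moment k uin ^ (-γ) / (2 * growthConst k l₁ l₂ E uin * γ) := by
      unfold localTime
      rw [← hγd]
      have h1 : (1 - (l₁ + l₂)) = γ * (1 - k) := by rw [hγd]; field_simp
      rw [h1]
      field_simp
    rw [e]
    refine ⟨EReal.coe_pos.2 (by positivity), _, _, growthBound_power hk hE hm hl _, ?_,
      fun T hT => majorant_power (by positivity) hγ hy ?_⟩
    · simp only [mul_zero, sub_zero]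
      rw [← Real.rpow_mul hy.le, show -γ * -(1 / γ) = 1 by field_simp, Real.rpow_one]
    · have := EReal.coe_lt_coe_iff.1 hT
      rw [lt_div_iff₀ (by positivity)] at this
      linarith
  · obtain ⟨G, -, hg⟩ := exists_linear_growthBound hk hE.le hm.le
      (moment_nonneg (1 + k) hu0) (not_lt.1 hl)
    exact ⟨EReal.zero_lt_top, _, _, hg, by simp, fun T _ => majorant_exp hy.le T⟩

end

/-! ### From the daughter distribution to a damped fragmentation kernel. -/

noncomputable section

/-- A bound on the lower Lebesgue integral carries integrability with it, which a bound on the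
Bochner integral would not. -/
lemma integrableOn_and_integral_le {f : ℝ → ℝ} {s : Set ℝ} {C : ℝ} (hs : MeasurableSet s)
    (hf : Measurable f) (hf0 : ∀ x ∈ s, 0 ≤ f x) (hC : 0 ≤ C)
    (h : ∫⁻ x in s, ENNReal.ofReal (f x) ≤ ENNReal.ofReal C) :
    IntegrableOn f s ∧ ∫ x in s, f x ≤ C := by
  have h0 : 0 ≤ᵐ[volume.restrict s] f := by
    filter_upwards [ae_restrict_mem hs] with x hx using hf0 x hx
  have hi : IntegrableOn f s :=
    (lintegral_ofReal_ne_top_iff_integrable hf.aestronglyMeasurable h0).1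
      (h.trans_lt ENNReal.ofReal_lt_top).ne
  refine ⟨hi, ?_⟩
  rw [integral_eq_lintegral_of_nonneg_ae h0 hf.aestronglyMeasurable]
  exact ENNReal.toReal_le_of_le_ofReal hC h

/-- The density of the fragments, as a kernel that vanishes outside its range. -/
def fragmentKernel (βs : ℝ → ℝ → ℝ → ℝ) (x y z : ℝ) : ℝ :=
  {p : ℝ × ℝ × ℝ | 0 < p.1 ∧ p.1 < p.2.1 ∧ 0 < p.2.2}.indicator
    (fun p => βs p.1 p.2.1 p.2.2) (x, y, z)

lemma mul_fragmentKernel (βs : ℝ → ℝ → ℝ → ℝ) (ψ : ℝ → ℝ) (y : ℝ) {z : ℝ} (hz : 0 < z) :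
    (fun x => ψ x * fragmentKernel βs x y z) =
      (Ioo 0 y).indicator fun x => ψ x * βs x y z := by
  ext x
  by_cases hx : x ∈ Ioo 0 y
  · have : (x, y, z) ∈ {p : ℝ × ℝ × ℝ | 0 < p.1 ∧ p.1 < p.2.1 ∧ 0 < p.2.2} := ⟨hx.1, hx.2, hz⟩
    rw [indicator_of_mem hx, fragmentKernel, indicator_of_mem this]
  · have : (x, y, z) ∉ {p : ℝ × ℝ × ℝ | 0 < p.1 ∧ p.1 < p.2.1 ∧ 0 < p.2.2} :=
      fun h => hx ⟨h.1, h.2.1⟩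
    rw [indicator_of_notMem hx, fragmentKernel, indicator_of_notMem this, mul_zero]

lemma restrict_Ioo_eq (y : ℝ) : μ₀.restrict (Ioo 0 y) = volume.restrict (Ioo 0 y) := by
  rw [μ₀, Measure.restrict_restrict measurableSet_Ioo,
    inter_eq_self_of_subset_left Ioo_subset_Ioi_self]

lemma integral_mul_fragmentKernel (βs : ℝ → ℝ → ℝ → ℝ) (ψ : ℝ → ℝ) (y : ℝ) {z : ℝ}
    (hz : 0 < z) :
    ∫ x, ψ x * fragmentKernel βs x y z ∂μ₀ = ∫ x in Ioo 0 y, ψ x * βs x y z := by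
  rw [mul_fragmentKernel βs ψ y hz, integral_indicator measurableSet_Ioo, restrict_Ioo_eq]

/-- Quantitative equi-integrability: where `b` exceeds the threshold `w`, it is dominated by `w ^ (1
- p) * b ^ p`. -/
lemma le_div_add_rpow {b p w : ℝ} (hw : 0 < w) (hp : 1 < p) (hb : 0 ≤ b) :
    b ≤ w + w ^ (1 - p) * b ^ p := by
  rcases le_or_gt b w with h | h
  · have := Real.rpow_nonneg hw.le (1 - p)
    have := Real.rpow_nonneg hb p
    nlinarith
  · have hb' : 0 < b := hw.trans h
    have h1 : b ^ (1 - p) ≤ w ^ (1 - p) := Real.rpow_le_rpow_of_nonpos hw h.le (by linarith)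
    have h2 : b = b ^ (1 - p) * b ^ p := by rw [← Real.rpow_add hb']; simp
    have h3 := mul_le_mul_of_nonneg_right h1 (Real.rpow_nonneg hb p)
    linarith

/-- Fragments of the same size as the parent cannot be too numerous. -/
lemma exists_damping {k p E : ℝ} (hk0 : 0 < k) (hk1 : k < 1) (hp : 1 < p) (hE : 0 < E) :
    ∃ δ > 0, ∀ (b : ℝ → ℝ) (y : ℝ), 0 < y → Measurable b → (∀ x ∈ Ioo 0 y, 0 ≤ b x) →
      IntegrableOn (fun x => x * b x) (Ioo 0 y) → ∫ x in Ioo 0 y, x * b x = y →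
      ∫⁻ x in Ioo 0 y, ENNReal.ofReal (x ^ k * b x ^ p) ≤ ENNReal.ofReal (E * y ^ (k + 1 - p)) →
      ∫ x in Ioo 0 y, x ^ (1 + k) * b x ≤ (1 - δ) * y ^ (1 + k) := by
  have hp1 : 0 < p - 1 := by linarith
  -- With threshold `m / y` for `b`, this makes the contribution of `b ^ p` to the mass near the
  -- parent size at most `y / 4`.
  set m := (4 * E) ^ (1 / (p - 1)) with hm
  have hm0 : 0 < m := by positivity
  have hmp : m ^ (1 - p) = 1 / (4 * E) := by
    rw [hm, ← Real.rpow_mul (by positivity), show 1 / (p - 1) * (1 - p) = -1 by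
      field_simp; ring, Real.rpow_neg_one, one_div]
  -- The layer `((1 - η) * y, y)` is thin enough that densities below the threshold contribute at
  -- most `m * η * y ≤ y / 4` to its mass.
  set η := min (1 / 2) (1 / (4 * m)) with hη
  have hη0 : 0 < η := by positivity
  have hη1 : η ≤ 1 / 2 := min_le_left _ _
  have hη2 : m * η ≤ 1 / 4 := by
    have := mul_le_mul_of_nonneg_left (min_le_right (1 / 2) (1 / (4 * m))) hm0.le
    refine this.trans (le_of_eq ?_)
    field_simp
  set q := (1 - η) ^ k with hq
  have hq1 : q < 1 := Real.rpow_lt_one (by linarith) (by linarith) hk0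
  -- The layer carries at most half of the mass; the remaining sizes satisfy `x ^ k ≤ q * y ^ k`.
  -- Altogether the factor is `q + (1 - q) / 2 = 1 - (1 - q) / 2`.
  refine ⟨(1 - q) / 2, by linarith, fun b y hy hb hb0 hi hmass hbd => ?_⟩
  have hyk := Real.rpow_nonneg hy.le k
  obtain ⟨ip, hle⟩ := integrableOn_and_integral_le (f := fun x => x ^ k * b x ^ p)
    measurableSet_Ioo
    ((measurable_id.pow_const k).mul (hb.pow_const p))
    (fun x hx => mul_nonneg (Real.rpow_nonneg hx.1.le _) (Real.rpow_nonneg (hb0 x hx) _))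
    (by positivity) hbd
  have hw : 0 < m / y := by positivity
  have ii : IntegrableOn ((Ioo ((1 - η) * y) y).indicator fun _ => m) (Ioo 0 y) :=
    (integrableOn_const (by simp)).indicator measurableSet_Ioo
  have ij : IntegrableOn (fun x => (Ioo ((1 - η) * y) y).indicator (fun _ => m) x +
      y ^ (1 - k) * (m / y) ^ (1 - p) * (x ^ k * b x ^ p)) (Ioo 0 y) := ii.add (ip.const_mul _)
  have hdom : ∫ x in Ioo 0 y, x ^ (1 + k) * b x ≤ ∫ x in Ioo 0 y, (q * y ^ k * (x * b x) +
      (1 - q) * y ^ k * ((Ioo ((1 - η) * y) y).indicator (fun _ => m) x +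
        y ^ (1 - k) * (m / y) ^ (1 - p) * (x ^ k * b x ^ p))) := by
    refine integral_mono_of_nonneg ?_ ((hi.const_mul _).add
      (ij.const_mul _)) ?_
    · filter_upwards [ae_restrict_mem measurableSet_Ioo] with x hx
      exact mul_nonneg (Real.rpow_nonneg hx.1.le _) (hb0 x hx)
    · filter_upwards [ae_restrict_mem measurableSet_Ioo] with x hx
      have hx0 := hx.1
      have hbx := hb0 x hx
      have hxb : 0 ≤ x * b x := mul_nonneg hx0.le hbx
      have hlast : 0 ≤ y ^ (1 - k) * (m / y) ^ (1 - p) * (x ^ k * b x ^ p) := by positivity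
      have hpow : x ^ (1 + k) * b x = x ^ k * (x * b x) := by rw [rpow_one_add hx0]; ring
      rw [hpow]
      by_cases hxη : x ∈ Ioo ((1 - η) * y) y
      · rw [indicator_of_mem hxη]
        have h1 : x ^ k ≤ y ^ k := Real.rpow_le_rpow hx0.le hx.2.le hk0.le
        have h2 := le_div_add_rpow hw hp hbx
        have h3 : x * (m / y) ≤ m := by
          rw [mul_div_assoc', div_le_iff₀ hy]; nlinarith [hx.2]
        have h4 : x ≤ y ^ (1 - k) * x ^ k := by
          calc x = x ^ (1 - k) * x ^ k := by rw [← Real.rpow_add hx0]; simp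
            _ ≤ _ := mul_le_mul_of_nonneg_right
              (Real.rpow_le_rpow hx0.le hx.2.le (by linarith)) (by positivity)
        have h5 : x * b x ≤ m + y ^ (1 - k) * (m / y) ^ (1 - p) * (x ^ k * b x ^ p) := by
          have h6 := mul_le_mul_of_nonneg_left h2 hx0.le
          have h7 := mul_le_mul_of_nonneg_right h4
            (show 0 ≤ (m / y) ^ (1 - p) * b x ^ p by positivity)
          linarith
        have h8 := mul_le_mul_of_nonneg_right h1 hxb
        have h9 := mul_le_mul_of_nonneg_left h5 (show 0 ≤ (1 - q) * y ^ k from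
          mul_nonneg (by linarith) hyk)
        linarith
      · rw [indicator_of_notMem hxη, zero_add]
        have hxle : x ≤ (1 - η) * y := by
          by_contra h
          exact hxη ⟨not_le.1 h, hx.2⟩
        have h1 : x ^ k ≤ q * y ^ k := by
          rw [hq, ← Real.mul_rpow (by linarith) hy.le]
          exact Real.rpow_le_rpow hx0.le hxle hk0.le
        have h2 := mul_le_mul_of_nonneg_right h1 hxb
        have h3 := mul_nonneg (mul_nonneg (show 0 ≤ 1 - q by linarith) hyk) hlast
        linarith
  refine hdom.trans ?_
  have e1 : ∫ x in Ioo 0 y, (q * y ^ k * (x * b x) +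
      (1 - q) * y ^ k * ((Ioo ((1 - η) * y) y).indicator (fun _ => m) x +
        y ^ (1 - k) * (m / y) ^ (1 - p) * (x ^ k * b x ^ p))) =
      q * y ^ k * y + (1 - q) * y ^ k * (m * (η * y) +
        y ^ (1 - k) * (m / y) ^ (1 - p) * ∫ x in Ioo 0 y, x ^ k * b x ^ p) := by
    have hind : ∫ x in Ioo 0 y, (Ioo ((1 - η) * y) y).indicator (fun _ => m) x = m * (η * y) := by
      rw [integral_indicator measurableSet_Ioo, Measure.restrict_restrict measurableSet_Ioo,
        inter_eq_self_of_subset_left (Ioo_subset_Ioo_left (by nlinarith)), setIntegral_const]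
      have : (volume.real (Ioo ((1 - η) * y) y)) = η * y := by
        rw [Real.volume_real_Ioo_of_le (by nlinarith)]; ring
      rw [this, smul_eq_mul, mul_comm]
    rw [integral_add (hi.const_mul _) (ij.const_mul _),
      integral_const_mul, hmass, integral_const_mul]
    congr 2
    rw [← hind, ← integral_const_mul]
    exact integral_add ii (ip.const_mul _)
  rw [e1]
  have h1 : y ^ (1 - k) * (m / y) ^ (1 - p) * ∫ x in Ioo 0 y, x ^ k * b x ^ p ≤ y / 4 := by
    refine (mul_le_mul_of_nonneg_left hle (by positivity)).trans (le_of_eq ?_)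
    rw [Real.div_rpow hm0.le hy.le, hmp]
    have e2 : y ^ (1 - k) * y ^ (k + 1 - p) = y * y ^ (1 - p) := by
      rw [← Real.rpow_add hy]
      nth_rewrite 2 [← Real.rpow_one y]
      rw [← Real.rpow_add hy]
      congr 1; ring
    have h3 := (Real.rpow_pos_of_pos hy (1 - p)).ne'
    field_simp
    linarith
  have h2 : y ^ (1 + k) = y ^ k * y := by rw [rpow_one_add hy]; ring
  rw [h2]
  have h3 : m * (η * y) ≤ y / 4 := by nlinarith
  have h4 := mul_le_mul_of_nonneg_left (add_le_add h3 h1)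
    (mul_nonneg (show 0 ≤ 1 - q by linarith) hyk)
  linarith

lemma exists_fragKernel {k p₀ : ℝ} (hk0 : 0 < k) (hk1 : k < 1) (hp₀ : 1 < p₀)
    {βs : ℝ → ℝ → ℝ → ℝ} {E : ℝ → ℝ}
    (hmeas : Measurable fun z : ℝ × ℝ × ℝ => βs z.1 z.2.1 z.2.2)
    (hnonneg : ∀ x₃ x₁ x₂ : ℝ, 0 < x₃ → 0 < x₁ → 0 < x₂ → 0 ≤ βs x₃ x₁ x₂)
    (hmass : ∀ x₁ x₂ : ℝ, 0 < x₁ → 0 < x₂ → ∫ x₃ in Ioo 0 x₁, x₃ * βs x₃ x₁ x₂ = x₁)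
    (hE_pos : ∀ p ∈ Icc 1 p₀, 0 < E p)
    (hbound : ∀ p ∈ Icc 1 p₀, ∀ x₁ x₂ : ℝ, 0 < x₁ → 0 < x₂ →
      ∫⁻ x₃ in Ioo 0 x₁, ENNReal.ofReal (x₃ ^ k * βs x₃ x₁ x₂ ^ p) ≤
        ENNReal.ofReal (E p * x₁ ^ (k + 1 - p))) :
    ∃ δ, FragKernel k (E 1) δ (fragmentKernel βs) := by
  have hm1 : (1 : ℝ) ∈ Icc 1 p₀ := ⟨le_rfl, hp₀.le⟩
  have hslice : ∀ y z, Measurable fun x => βs x y z := fun y z =>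
    hmeas.comp (measurable_id.prodMk (measurable_const (a := (y, z))))
  have hn : ∀ y z, 0 < z → ∀ x ∈ Ioo 0 y, 0 ≤ βs x y z := fun y z hz x hx =>
    hnonneg x y z hx.1 (hx.1.trans hx.2) hz
  have low : ∀ y z, 0 < y → 0 < z → IntegrableOn (fun x => x ^ k * βs x y z) (Ioo 0 y) ∧
      ∫ x in Ioo 0 y, x ^ k * βs x y z ≤ E 1 * y ^ k := fun y z hy hz => by
    have h := hbound 1 hm1 y z hy hz
    simp only [Real.rpow_one, add_sub_cancel_right] at h
    exact integrableOn_and_integral_le measurableSet_Ioo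
      ((measurable_id.pow_const k).mul (hslice y z))
      (fun x hx => mul_nonneg (Real.rpow_nonneg hx.1.le _) (hn y z hz x hx))
      (mul_nonneg (hE_pos 1 hm1).le (Real.rpow_nonneg hy.le _)) h
  -- Integrability follows from the mass identity: the Bochner integral of a non-integrable function
  -- is zero, whereas this one equals `y > 0`.
  have hmi : ∀ y z, 0 < y → 0 < z → IntegrableOn (fun x => x * βs x y z) (Ioo 0 y) :=
    fun y z hy hz => by
      by_contra h
      have := hmass y z hy hz
      rw [integral_undef h] at this
      exact hy.ne this
  obtain ⟨δ, hδ, hd⟩ := exists_damping hk0 hk1 hp₀ (hE_pos p₀ ⟨hp₀.le, le_rfl⟩)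
  refine ⟨δ, ?_, ?_, ?_, ?_, ?_, ?_, ?_, ?_, hδ⟩
  · refine hmeas.indicator ?_
    exact (measurableSet_lt measurable_const measurable_fst).inter
      ((measurableSet_lt measurable_fst (measurable_fst.comp measurable_snd)).inter
        (measurableSet_lt measurable_const (measurable_snd.comp measurable_snd)))
  · intro x y z
    refine indicator_nonneg (fun p hp => ?_) _
    exact hnonneg _ _ _ hp.1 (hp.1.trans hp.2.1) hp.2.2
  · intro x y z hx
    exact indicator_of_notMem (fun h => hx ⟨h.1, h.2.1⟩) _
  · intro y z hy hz
    rw [mul_fragmentKernel βs (fun x => x ^ k) y hz, integrable_indicator_iff measurableSet_Ioo,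
      IntegrableOn, restrict_Ioo_eq]
    exact (low y z hy hz).1
  · intro y z hy hz
    rw [integral_mul_fragmentKernel βs (fun x => x) y hz, hmass y z hy hz]
  · intro y z hy hz
    rw [integral_mul_fragmentKernel βs (fun x => x ^ k) y hz]
    exact (low y z hy hz).2
  · intro y z hy hz
    rw [integral_mul_fragmentKernel βs (fun x => x ^ (1 + k)) y hz]
    exact hd (fun x => βs x y z) y hy (hslice y z) (hn y z hz) (hmi y z hy hz) (hmass y z hy hz)
      (hbound p₀ ⟨hp₀.le, le_rfl⟩ y z hy hz)
  -- For a parent of size one, `x ≤ x ^ k` gives `1 = ∫ x β ≤ ∫ x ^ k β ≤ E 1`.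
  · have h1 := hmass 1 1 one_pos one_pos
    have h2 := (low 1 1 one_pos one_pos).2
    rw [Real.one_rpow, mul_one] at h2
    refine h1.symm.le.trans (le_trans ?_ h2)
    refine setIntegral_mono_on (hmi 1 1 one_pos one_pos) (low 1 1 one_pos one_pos).1
      measurableSet_Ioo fun x hx => mul_le_mul_of_nonneg_right ?_ (hn 1 1 one_pos x hx)
    have := Real.rpow_le_rpow_of_exponent_ge hx.1 hx.2.le hk1.le
    rwa [Real.rpow_one] at this

end

/-! ### Completeness in the weighted norm; choice of cutoffs, time steps and time horizons. -/

noncomputable section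

open Filter Topology

variable {k : ℝ} {u : ℝ → ℝ}

lemma Weighted.wnorm_sub_le_add {f g w : ℝ → ℝ} (hf : Weighted k f) (hg : Weighted k g)
    (hw : Weighted k w) : wnorm k (fun x => f x - w x) ≤
      wnorm k (fun x => f x - g x) + wnorm k fun x => g x - w x := by
  have := (hf.sub hg).wnorm_add_le (hg.sub hw)
  simpa using this

lemma wnorm_sub_comm (k : ℝ) (f g : ℝ → ℝ) :
    wnorm k (fun x => f x - g x) = wnorm k fun x => g x - f x := by
  simp only [wnorm, abs_sub_comm]

lemma Weighted.integrable_weight_mul {f : ℝ → ℝ} (hf : Weighted k f) :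
    Integrable (fun x => (x ^ k + x ^ (1 + k)) * f x) μ₀ := by
  simp only [add_mul]
  exact hf.low.add hf.high

lemma Weighted.of_integrable_weight_mul {f : ℝ → ℝ} (hf : Measurable f)
    (h : Integrable (fun x => (x ^ k + x ^ (1 + k)) * f x) μ₀) : Weighted k f := by
  refine ⟨hf, h.norm.mono' (measurable_rpow_mul hf _).aestronglyMeasurable ?_,
    h.norm.mono' (measurable_rpow_mul hf _).aestronglyMeasurable ?_⟩ <;>
  · filter_upwards [ae_pos] with x hx
    have h1 := Real.rpow_nonneg hx.le k
    have h2 := Real.rpow_nonneg hx.le (1 + k)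
    rw [norm_mul, norm_mul, Real.norm_of_nonneg (weight_nonneg k hx), Real.norm_of_nonneg (by assumption)]
    exact mul_le_mul_of_nonneg_right (by linarith) (norm_nonneg _)

lemma eLpNorm_weight_mul {f : ℝ → ℝ} (hf : Weighted k f) :
    eLpNorm (fun x => (x ^ k + x ^ (1 + k)) * f x) 1 μ₀ = ENNReal.ofReal (wnorm k f) := by
  rw [eLpNorm_one_eq_lintegral_enorm, ← ofReal_integral_norm_eq_lintegral_enorm
    hf.integrable_weight_mul, wnorm]
  congr 1
  refine integral_congr_ae ?_
  filter_upwards [ae_pos] with x hx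
  rw [norm_mul, Real.norm_of_nonneg (weight_nonneg k hx), Real.norm_eq_abs]

/-- Geometrically convergent sequences of weighted functions converge in norm to their pointwise
limit. -/
lemma weighted_limit {v : ℕ → ℝ → ℝ} {w : ℝ → ℝ} {K : ℝ} {N : ℕ}
    (hv : ∀ n, N ≤ n → Weighted k (v n))
    (hK : ∀ n, N ≤ n → wnorm k (fun x => v (n + 1) x - v n x) ≤ K * (1 / 2) ^ n)
    (hw : Measurable w)
    (hlim : ∀ x l, Tendsto (fun n => v n x) atTop (𝓝 l) → w x = l) :
    Weighted k w ∧ Tendsto (fun n => wnorm k fun x => v n x - w x) atTop (𝓝 0) := by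
  have hK0 : 0 ≤ K := by
    have := (wnorm_nonneg k _).trans (hK N le_rfl)
    exact nonneg_of_mul_nonneg_left this (by positivity)
  -- The subtracted `(1 / 2) ^ j` lets the induction close without summing a series.
  have tele : ∀ N' j : ℕ, wnorm k (fun x => v (N + N' + j) x - v (N + N') x) ≤
      2 * K * (1 / 2) ^ N' * (1 - (1 / 2) ^ j) := by
    intro N' j
    induction j with
    | zero => simp [wnorm]
    | succ j ih =>
      have h1 := hK (N + N' + j) (by omega)
      have h2 := (hv (N + N' + j + 1) (by omega)).wnorm_sub_le_add (hv (N + N' + j) (by omega))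
        (hv (N + N') (by omega))
      have h3 : ((1 : ℝ) / 2) ^ (N + N' + j) ≤ (1 / 2) ^ (N' + j) :=
        pow_le_pow_of_le_one (by norm_num) (by norm_num) (by omega)
      have h4 := mul_le_mul_of_nonneg_left h3 hK0
      rw [pow_add (1 / 2 : ℝ) N' j] at h4
      rw [← add_assoc, pow_succ]
      linarith
  -- Two tails give `4 * K`; the extra `1` makes the Cauchy inequality strict.
  set B : ℕ → ENNReal := fun N' => ENNReal.ofReal ((4 * K + 1) * (1 / 2) ^ N') with hB
  have hBs : ∑' i, B i ≠ ⊤ := by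
    refine Summable.tsum_ofReal_ne_top ?_
    exact (summable_geometric_of_lt_one (by norm_num) (by norm_num)).mul_left _
  set F : ℕ → ℝ → ℝ := fun n x => (x ^ k + x ^ (1 + k)) * v (N + n) x with hF
  have hvN : ∀ n, Weighted k (v (N + n)) := fun n => hv _ (by omega)
  have hFi : ∀ n, Integrable (F n) μ₀ := fun n => (hvN n).integrable_weight_mul
  have hcau : ∀ N' n m, N' ≤ n → N' ≤ m → eLpNorm (F n - F m) 1 μ₀ < B N' := by
    intro N' n m hn hm
    have e : F n - F m = fun x => (x ^ k + x ^ (1 + k)) * (v (N + n) x - v (N + m) x) := by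
      ext x; simp only [hF, Pi.sub_apply]; ring
    rw [e, eLpNorm_weight_mul ((hvN n).sub (hvN m)), hB]
    refine (ENNReal.ofReal_lt_ofReal_iff (by positivity)).2 ?_
    have h1 := tele N' (n - N')
    have h2 := tele N' (m - N')
    rw [show N + N' + (n - N') = N + n by omega] at h1
    rw [show N + N' + (m - N') = N + m by omega] at h2
    have h3 := (hvN n).wnorm_sub_le_add (hvN N') (hvN m)
    rw [wnorm_sub_comm k (v (N + N'))] at h3
    have hp : (0 : ℝ) < (1 / 2) ^ N' := by positivity
    have hp1 : (0 : ℝ) ≤ 2 * K * (1 / 2) ^ N' * (1 / 2) ^ (n - N') := by positivity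
    have hp2 : (0 : ℝ) ≤ 2 * K * (1 / 2) ^ N' * (1 / 2) ^ (m - N') := by positivity
    linarith
  have hae := Lp.ae_tendsto_of_cauchy_eLpNorm (fun n => (hFi n).1) le_rfl hBs hcau
  have hae' : ∀ᵐ x ∂μ₀, Tendsto (fun n => F n x) atTop
      (𝓝 ((x ^ k + x ^ (1 + k)) * w x)) := by
    filter_upwards [hae, ae_pos] with x ⟨l, hl⟩ hx
    have hφ : x ^ k + x ^ (1 + k) ≠ 0 :=
      (add_pos (Real.rpow_pos_of_pos hx _) (Real.rpow_pos_of_pos hx _)).ne'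
    have h1 : Tendsto (fun n => v (n + N) x) atTop (𝓝 (l / (x ^ k + x ^ (1 + k)))) := by
      refine (hl.div_const (x ^ k + x ^ (1 + k))).congr fun n => ?_
      simp only [hF]
      rw [mul_div_cancel_left₀ _ hφ, add_comm]
    rw [hlim x _ ((tendsto_add_atTop_iff_nat N).1 h1), mul_div_cancel₀ _ hφ]
    exact hl
  have ht := Lp.cauchy_tendsto_of_tendsto (fun n => (hFi n).1)
    (fun x => (x ^ k + x ^ (1 + k)) * w x) hBs hcau hae'
  have hm := Lp.memLp_of_cauchy_tendsto le_rfl (fun n => memLp_one_iff_integrable.2 (hFi n))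
    (fun x => (x ^ k + x ^ (1 + k)) * w x)
    ((measurable_weight k).mul hw).aestronglyMeasurable ht
  have hW := Weighted.of_integrable_weight_mul hw (memLp_one_iff_integrable.1 hm)
  refine ⟨hW, ?_⟩
  rw [← tendsto_add_atTop_iff_nat N]
  have ht' := (ENNReal.tendsto_toReal ENNReal.zero_ne_top).comp ht
  rw [ENNReal.toReal_zero] at ht'
  refine ht'.congr fun n => ?_
  have e : (F n - fun x => (x ^ k + x ^ (1 + k)) * w x) =
      fun x => (x ^ k + x ^ (1 + k)) * (v (n + N) x - w x) := by
    ext x; simp only [hF, Pi.sub_apply]; rw [add_comm N n]; ring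
  simp only [Function.comp_apply]
  rw [e, eLpNorm_weight_mul ((hv (n + N) (by omega)).sub hW),
    ENNReal.toReal_ofReal (wnorm_nonneg _ _)]

/-- The restriction of a density to sizes below `R`. -/
def cutoff (R : ℝ) (u : ℝ → ℝ) : ℝ → ℝ := (Ioo 0 R).indicator u

lemma Weighted.cutoff (hu : Weighted k u) (R : ℝ) : Truncated k R (cutoff R u) := by
  refine ⟨hu.meas.indicator measurableSet_Ioo, fun x hx => indicator_of_notMem hx _, ?_⟩
  refine (hu.low.indicator (measurableSet_Ioo (a := 0) (b := R))).congr
    (Eventually.of_forall fun x => ?_)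
  by_cases hx : x ∈ Ioo 0 R <;> simp [CollFrag.cutoff, hx]

lemma cutoff_nonneg (hu : ∀ x, 0 ≤ u x) (R x : ℝ) : 0 ≤ cutoff R u x :=
  indicator_nonneg (fun x _ => hu x) x

lemma cutoff_le (hu : ∀ x, 0 ≤ u x) (R x : ℝ) : cutoff R u x ≤ u x :=
  indicator_le_self' (fun x _ => hu x) x

lemma moment_cutoff_le (hu0 : ∀ x, 0 ≤ u x) {a : ℝ}
    (hi : Integrable (fun x => x ^ a * u x) μ₀) (R : ℝ) :
    moment a (cutoff R u) ≤ moment a u := by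
  refine integral_mono_of_nonneg ?_ hi ?_
  · filter_upwards [ae_pos] with x hx
    exact mul_nonneg (Real.rpow_nonneg hx.le _) (cutoff_nonneg hu0 R x)
  · filter_upwards [ae_pos] with x hx
    exact mul_le_mul_of_nonneg_left (cutoff_le hu0 R x) (Real.rpow_nonneg hx.le _)

lemma wnorm_cutoff_sub_le (hu : Weighted k u) {R R' : ℝ} (h : R ≤ R') :
    wnorm k (fun x => cutoff R' u x - cutoff R u x) ≤ wnorm k fun x => u x - cutoff R u x := by
  refine (hu.sub (hu.cutoff R).weighted).wnorm_mono (Eventually.of_forall fun x => ?_)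
  by_cases hx : x ∈ Ioo 0 R
  · have hx' : x ∈ Ioo 0 R' := ⟨hx.1, hx.2.trans_le h⟩
    simp [cutoff, hx, hx']
  · by_cases hx' : x ∈ Ioo 0 R' <;> simp [cutoff, hx, hx']

lemma wnorm_sub_cutoff_antitone (hu : Weighted k u) {R R' : ℝ} (h : R ≤ R') :
    wnorm k (fun x => u x - cutoff R' u x) ≤ wnorm k fun x => u x - cutoff R u x := by
  refine (hu.sub (hu.cutoff R).weighted).wnorm_mono (Eventually.of_forall fun x => ?_)
  by_cases hx : x ∈ Ioo 0 R
  · have hx' : x ∈ Ioo 0 R' := ⟨hx.1, hx.2.trans_le h⟩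
    simp [cutoff, hx, hx']
  · by_cases hx' : x ∈ Ioo 0 R' <;> simp [cutoff, hx, hx']

lemma tendsto_wnorm_sub_cutoff (hu : Weighted k u) :
    Tendsto (fun n : ℕ => wnorm k fun x => u x - cutoff n u x) atTop (𝓝 0) := by
  have h0 : (∫ _, (0 : ℝ) ∂μ₀) = 0 := by simp
  rw [← h0]
  refine tendsto_integral_of_dominated_convergence (fun x => (x ^ k + x ^ (1 + k)) * |u x|)
    (fun n => ((hu.sub (hu.cutoff n).weighted).integrable_weight).1) hu.integrable_weight
    (fun n => ?_) ?_
  · filter_upwards [ae_pos] with x hx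
    rw [Real.norm_of_nonneg (mul_nonneg (weight_nonneg k hx) (abs_nonneg _))]
    refine mul_le_mul_of_nonneg_left ?_ (weight_nonneg k hx)
    by_cases hx' : x ∈ Ioo (0 : ℝ) n <;> simp [cutoff, hx']
  · filter_upwards [ae_pos] with x hx
    obtain ⟨N, hN⟩ := exists_nat_gt x
    refine tendsto_const_nhds.congr' ?_
    filter_upwards [eventually_ge_atTop N] with n hn
    have : x ∈ Ioo (0 : ℝ) n := ⟨hx, hN.trans_le (by exact_mod_cast hn)⟩
    simp [cutoff, this]

/-- Partial sums of the individually sufficient radii make the sequence monotone. -/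
lemma exists_radii (hu : Weighted k u) {ε : ℕ → ℝ} (hε : ∀ n, 0 < ε n) :
    ∃ R : ℕ → ℝ, (∀ n, 0 ≤ R n) ∧ (∀ n, R n ≤ R (n + 1)) ∧
      ∀ n, wnorm k (fun x => u x - cutoff (R n) u x) ≤ ε n := by
  have h : ∀ n, ∃ N : ℕ, wnorm k (fun x => u x - cutoff N u x) ≤ ε n := fun n =>
    ((tendsto_wnorm_sub_cutoff hu).eventually_le_const (hε n)).exists
  choose N hN using h
  refine ⟨fun n => ((∑ i ∈ Finset.range (n + 1), N i : ℕ) : ℝ), fun n => Nat.cast_nonneg _,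
    fun n => ?_, fun n => ?_⟩
  · simp only
    rw [Finset.sum_range_succ _ (n + 1)]
    push_cast
    linarith [(Nat.cast_nonneg (N (n + 1)) : (0 : ℝ) ≤ N (n + 1))]
  · refine (wnorm_sub_cutoff_antitone hu (R := N n) ?_).trans (hN n)
    refine Nat.cast_le.2 ?_
    exact Finset.single_le_sum (f := N) (fun i _ => Nat.zero_le _)
      (Finset.mem_range.2 (Nat.lt_succ_self n))

/-- Powers of one half whose exponents are partial sums: each step is an integer multiple of the
next, so the time grids are nested. -/
lemma exists_steps {H : ℕ → ℝ} (hH : ∀ n, 0 < H n) :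
    ∃ (h : ℕ → ℝ) (m : ℕ → ℕ), (∀ n, 0 < h n) ∧ (∀ n, h n ≤ H n) ∧
      ∀ n, h n = m n * h (n + 1) := by
  have hex : ∀ n, ∃ j : ℕ, ((1 : ℝ) / 2) ^ j < H n := fun n =>
    exists_pow_lt_of_lt_one (hH n) (by norm_num)
  choose j hj using hex
  refine ⟨fun n => (1 / 2) ^ (∑ i ∈ Finset.range (n + 1), j i), fun n => 2 ^ j (n + 1),
    fun n => by positivity, fun n => ?_, fun n => ?_⟩
  · refine le_trans (pow_le_pow_of_le_one (by norm_num) (by norm_num) ?_) (hj n).le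
    exact Finset.single_le_sum (f := j) (fun i _ => Nat.zero_le _)
      (Finset.mem_range.2 (Nat.lt_succ_self n))
  · simp only
    rw [Finset.sum_range_succ _ (n + 1), pow_add]
    push_cast
    rw [mul_left_comm, ← mul_pow]
    norm_num

/-- Horizons strictly below `T` on which the majorant is available, exhausting `[0, T)` for finite
and infinite `T` alike. -/
lemma exists_times {T : EReal} (hT : 0 < T) :
    ∃ τ : ℕ → ℝ, (∀ n, 0 ≤ τ n) ∧ (∀ n, (τ n : EReal) < T) ∧
      ∀ t : ℝ, (t : EReal) < T → ∀ᶠ n in atTop, t ≤ τ n := by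
  induction T with
  | bot => exact absurd hT (by simp)
  | top =>
    exact ⟨fun n => n, fun n => Nat.cast_nonneg n, fun n => EReal.coe_lt_top _,
      fun t _ => tendsto_natCast_atTop_atTop.eventually_ge_atTop t⟩
  | coe c =>
    have hc : 0 < c := EReal.coe_pos.1 hT
    refine ⟨fun n => c - c * (1 / ((n : ℝ) + 1)), fun n => ?_, fun n => ?_, fun t ht => ?_⟩
    · have : 1 / ((n : ℝ) + 1) ≤ 1 := by
        rw [div_le_one (by positivity)]
        linarith [(Nat.cast_nonneg n : (0 : ℝ) ≤ n)]
      nlinarith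
    · refine EReal.coe_lt_coe_iff.2 ?_
      have : 0 < c * (1 / ((n : ℝ) + 1)) := by positivity
      linarith
    · have h := (tendsto_one_div_add_atTop_nhds_zero_nat (𝕜 := ℝ)).const_mul c
      have h' := h.const_sub c
      rw [mul_zero, sub_zero] at h'
      exact h'.eventually_const_le (EReal.coe_lt_coe_iff.1 ht)

end

/-! ### The approximating sequence and its properties. -/

noncomputable section

open Filter Topology

variable {k l₁ l₂ E δ R C h B : ℝ} {κ : ℝ → ℝ → ℝ → ℝ} {u v f g f₀ ς : ℝ → ℝ}

/-- The weak form of the collision operator. -/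
def collForm (κ : ℝ → ℝ → ℝ → ℝ) (l₁ l₂ : ℝ) (ς f : ℝ → ℝ) : ℝ :=
  ∫ z, (avg κ ς z.1 z.2 - ς z.1) * collisionKernel l₁ l₂ z.1 z.2 * f z.1 * f z.2 ∂(μ₀.prod μ₀)

namespace FragKernel

lemma measurable_avg_sub (hκ : FragKernel k E δ κ) (hς : Measurable ς) :
    Measurable fun z : ℝ × ℝ => avg κ ς z.1 z.2 - ς z.1 :=
  (hκ.measurable_avg hς).sub (hς.comp measurable_fst)

lemma abs_avg_sub_le (hκ : FragKernel k E δ κ) (hς : Measurable ς) (hC : 0 ≤ C)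
    (hςC : ∀ x, 0 < x → |ς x| ≤ C * x ^ k) {y z : ℝ} (hy : 0 < y) (hz : 0 < z) :
    |avg κ ς y z - ς y| ≤ C * (E + 1) * y ^ k := by
  have h1 := hκ.abs_avg_le hy hz hς hC fun x hx => hςC x hx.1
  have h2 := hςC y hy
  linarith [abs_sub (avg κ ς y z) (ς y)]

lemma abs_collForm_le (hk : Exponents k l₁ l₂) (hκ : FragKernel k E δ κ) (hς : Measurable ς)
    (hC : 0 ≤ C) (hςC : ∀ x, 0 < x → |ς x| ≤ C * x ^ k) (hf : Weighted k f) :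
    |collForm κ l₁ l₂ ς f| ≤ 2 * (C * (E + 1)) * wnorm k f * wnorm k f :=
  abs_integral_rate_le (ψ := fun z : ℝ × ℝ => avg κ ς z.1 z.2 - ς z.1) hk hf hf
    (hκ.measurable_avg_sub hς) (mul_nonneg hC (by linarith [hκ.one_le]))
    fun _ _ hx hy _ => hκ.abs_avg_sub_le hς hC hςC hx hy

/-- Test functions are bounded by `C * x ^ k`, so no moment above `1 + k` appears and the weak form
of the collision operator is locally Lipschitz in the weighted norm. -/
lemma abs_collForm_sub_le (hk : Exponents k l₁ l₂) (hκ : FragKernel k E δ κ)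
    (hς : Measurable ς) (hC : 0 ≤ C) (hςC : ∀ x, 0 < x → |ς x| ≤ C * x ^ k)
    (hf : Weighted k f) (hg : Weighted k g) :
    |collForm κ l₁ l₂ ς f - collForm κ l₁ l₂ ς g| ≤
      2 * (C * (E + 1)) * wnorm k (fun x => f x - g x) * (wnorm k f + wnorm k g) := by
  have hψ := hκ.measurable_avg_sub hς
  have hC' : 0 ≤ C * (E + 1) := mul_nonneg hC (by linarith [hκ.one_le])
  have hb : ∀ x y : ℝ, 0 < x → 0 < y → |avg κ ς x y - ς x| ≤ C * (E + 1) * x ^ k :=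
    fun x y hx hy => hκ.abs_avg_sub_le hς hC hςC hx hy
  set ψ : ℝ × ℝ → ℝ := fun z => avg κ ς z.1 z.2 - ς z.1
  have i1 := integrable_rate (ψ := ψ) hk hf hf hψ fun x y hx hy _ => hb x y hx hy
  have i2 := integrable_rate (ψ := ψ) hk hg hg hψ fun x y hx hy _ => hb x y hx hy
  have i3 := integrable_rate (ψ := ψ) hk (hf.sub hg) hf hψ fun x y hx hy _ => hb x y hx hy
  have i4 := integrable_rate (ψ := ψ) hk hg (hf.sub hg) hψ fun x y hx hy _ => hb x y hx hy
  have e : collForm κ l₁ l₂ ς f - collForm κ l₁ l₂ ς g =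
      (∫ z, ψ z * collisionKernel l₁ l₂ z.1 z.2 * (f z.1 - g z.1) * f z.2 ∂(μ₀.prod μ₀)) +
      ∫ z, ψ z * collisionKernel l₁ l₂ z.1 z.2 * g z.1 * (f z.2 - g z.2) ∂(μ₀.prod μ₀) := by
    rw [collForm, collForm, ← integral_sub i1 i2, ← integral_add i3 i4]
    refine integral_congr_ae (Eventually.of_forall fun z => ?_)
    simp only [ψ]; ring
  rw [e]
  have b1 := abs_integral_rate_le (ψ := ψ) hk (hf.sub hg) hf hψ hC'
    fun x y hx hy _ => hb x y hx hy
  have b2 := abs_integral_rate_le (ψ := ψ) hk hg (hf.sub hg) hψ hC'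
    fun x y hx hy _ => hb x y hx hy
  refine (abs_add_le _ _).trans ?_
  linarith

/-- With the weight `x ^ k` alone the moments involved stay in `[k, 1 + k]`, so the bound is free of
`R`. It yields continuity in time uniformly along the sequence. -/
lemma moment_coll_le (hk : Exponents k l₁ l₂) (hκ : FragKernel k E δ κ)
    (hu : Truncated k R u) (hv : Weighted k v) :
    moment k (fun x => |coll κ l₁ l₂ u v x|) ≤ 2 * (E + 1) * wnorm k u * wnorm k v := by
  have hψ : Measurable fun x : ℝ => x ^ k := measurable_id.pow_const k
  have hb : ∀ x ∈ Ioo 0 R, |x ^ k| ≤ 1 * x ^ k := fun x hx => abs_rpow_le hx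
  have hww : ∀ w : ℝ → ℝ, wnorm k (fun x => |w x|) = wnorm k w := fun w => by
    simp only [wnorm, abs_abs]
  have g1 := hκ.integrable_mul_gain hk hu.abs hv.abs hψ hb
  have g2 := integrable_mul_mul_loss (v := fun x => |v x|) hk hu.abs hψ hb
  have e1 := hκ.integral_mul_gain hk hu.abs hv.abs hψ hb
  have e2 := integral_mul_mul_loss hk hu.abs hv.abs hψ hb
  have hE := hκ.one_le
  have b1 := abs_integral_rate_le (C := 1 * E) (ψ := fun z : ℝ × ℝ => avg κ (fun x => x ^ k) z.1 z.2)
    hk hu.abs.weighted hv.abs (hκ.measurable_avg hψ) (by linarith) fun x y hx hy _ =>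
      hκ.abs_avg_le hx hy hψ zero_le_one fun x hx => abs_rpow_le hx
  have b2 := abs_integral_rate_le (C := 1) (ψ := fun z : ℝ × ℝ => z.1 ^ k)
    hk hu.abs.weighted hv.abs (measurable_fst.pow_const k) zero_le_one fun x y hx _ _ => by
      rw [one_mul, abs_of_nonneg (Real.rpow_nonneg hx.le _)]
  rw [hww, hww] at b1 b2
  calc moment k (fun x => |coll κ l₁ l₂ u v x|)
      ≤ (∫ x, x ^ k * gain κ l₁ l₂ (fun y => |u y|) (fun y => |v y|) x ∂μ₀) +
        ∫ x, x ^ k * (|u x| * loss l₁ l₂ (fun y => |v y|) x) ∂μ₀ := by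
        rw [← integral_add g1 g2, moment_eq]
        refine integral_mono_ae (hκ.truncated_coll hk hu hv).abs.low (g1.add g2) ?_
        filter_upwards [ae_pos] with x hx
        rw [← mul_add]
        refine mul_le_mul_of_nonneg_left ?_ (Real.rpow_nonneg hx.le _)
        refine (abs_sub _ _).trans (add_le_add (hκ.abs_gain_le u v x) ?_)
        rw [abs_mul]
        exact mul_le_mul_of_nonneg_left (abs_loss_le v hx) (abs_nonneg _)
    _ ≤ _ := by
        rw [e1, e2]
        linarith [(le_abs_self _).trans b1, (le_abs_self _).trans b2]

lemma moment_euler_add_sub_le (hk : Exponents k l₁ l₂) (hκ : FragKernel k E δ κ)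
    (hh : 0 ≤ h) (hf : Truncated k R f₀) (hB : 0 ≤ B) (i r : ℕ)
    (hb : ∀ s < r, wnorm k (euler κ l₁ l₂ h f₀ (i + s)) ≤ B) :
    moment k (fun x => |euler κ l₁ l₂ h f₀ (i + r) x - euler κ l₁ l₂ h f₀ i x|) ≤
      r * h * (2 * (E + 1) * B ^ 2) := by
  have hE := hκ.one_le
  induction r with
  | zero => simp [moment]
  | succ r ih =>
    have ht := hκ.truncated_euler (l₁ := l₁) (l₂ := l₂) hk hf h
    have hc := hκ.truncated_coll hk (ht (i + r)) (ht (i + r)).weighted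
    have i1 := ((ht (i + r)).sub (ht i)).abs.low
    have i2 := (hc.const_mul h).abs.low
    have step : moment k (fun x => |euler κ l₁ l₂ h f₀ (i + (r + 1)) x -
        euler κ l₁ l₂ h f₀ i x|) ≤
        moment k (fun x => |euler κ l₁ l₂ h f₀ (i + r) x - euler κ l₁ l₂ h f₀ i x|) +
        moment k (fun x => |h * coll κ l₁ l₂ (euler κ l₁ l₂ h f₀ (i + r))
          (euler κ l₁ l₂ h f₀ (i + r)) x|) := by
      rw [← moment_add i1 i2, moment_eq, moment_eq]
      refine integral_mono_ae ((ht _).sub (ht _)).abs.low ?_ ?_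
      · simp only [mul_add]
        exact i1.add i2
      · filter_upwards [ae_pos] with x hx
        refine mul_le_mul_of_nonneg_left ?_ (Real.rpow_nonneg hx.le _)
        rw [← add_assoc, euler, add_sub_right_comm]
        exact abs_add_le _ _
    simp only [abs_mul, abs_of_nonneg hh] at step
    rw [moment_const_mul] at step
    have h1 := ih fun s hs => hb s (hs.trans (Nat.lt_succ_self r))
    have h2 := hκ.moment_coll_le hk (ht (i + r)) (ht (i + r)).weighted
    have h3 := hb r (Nat.lt_succ_self r)
    have h4 := mul_le_mul h3 h3 (wnorm_nonneg _ _) hB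
    have h5 := mul_le_mul_of_nonneg_left h4 (show 0 ≤ 2 * (E + 1) by linarith)
    have h6 := mul_le_mul_of_nonneg_left (h2.trans ((mul_assoc _ _ _).trans_le h5)) hh
    push_cast
    linarith

/-- The scheme satisfies the weak equation exactly at grid points; between them the piecewise
constant interpolation misses one partial time cell. -/
lemma integral_mul_euler (hk : Exponents k l₁ l₂) (hκ : FragKernel k E δ κ)
    (hf : Truncated k R f₀) (hς : Measurable ς) (hC : 0 ≤ C)
    (hςC : ∀ x, 0 < x → |ς x| ≤ C * x ^ k) (h : ℝ) (j : ℕ) :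
    ∫ x, ς x * euler κ l₁ l₂ h f₀ j x ∂μ₀ = (∫ x, ς x * f₀ x ∂μ₀) +
      ∑ i ∈ Finset.range j, h * collForm κ l₁ l₂ ς (euler κ l₁ l₂ h f₀ i) := by
  have hb : ∀ x ∈ Ioo 0 R, |ς x| ≤ C * x ^ k := fun x hx => hςC x hx.1
  induction j with
  | zero => simp [euler]
  | succ j ih =>
    have ht := hκ.truncated_euler (l₁ := l₁) (l₂ := l₂) hk hf h j
    have hc := hκ.truncated_coll hk ht ht.weighted
    rw [Finset.sum_range_succ, ← add_assoc, ← ih, collForm,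
      ← hκ.integral_mul_coll hk ht ht.weighted hς hC hb, ← integral_const_mul,
      ← integral_add (ht.integrable_mul hς hb) ((hc.integrable_mul hς hb).const_mul h)]
    congr 1; ext x
    rw [euler]; ring

end FragKernel

lemma floor_div_eq {h τ : ℝ} (hh : 0 < h) {j : ℕ} (h1 : j * h ≤ τ) (h2 : τ < (j + 1) * h) :
    ⌊τ / h⌋₊ = j := by
  rw [Nat.floor_eq_iff (div_nonneg (le_trans (by positivity) h1) hh.le)]
  exact ⟨(le_div_iff₀ hh).2 h1, (div_lt_iff₀ hh).2 h2⟩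

/-- Integration of piecewise constant functions of time. -/
lemma integral_floor {h : ℝ} (hh : 0 < h) (F : ℕ → ℝ) (j : ℕ) {t : ℝ} (h1 : j * h ≤ t)
    (h2 : t ≤ (j + 1) * h) :
    IntervalIntegrable (fun τ => F ⌊τ / h⌋₊) volume 0 t ∧
      ∫ τ in (0 : ℝ)..t, F ⌊τ / h⌋₊ = (∑ i ∈ Finset.range j, h * F i) + (t - j * h) * F j := by
  have piece : ∀ (j : ℕ) (t : ℝ), j * h ≤ t → t ≤ (j + 1) * h →
      IntervalIntegrable (fun τ => F ⌊τ / h⌋₊) volume (j * h) t ∧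
      ∫ τ in (j * h : ℝ)..t, F ⌊τ / h⌋₊ = (t - j * h) * F j := by
    intro j t h1 h2
    have hae : ∀ᵐ τ ∂(volume.restrict (Ioc (j * h) t)), F ⌊τ / h⌋₊ = F j := by
      rw [← restrict_Ioo_eq_restrict_Ioc]
      filter_upwards [ae_restrict_mem measurableSet_Ioo] with τ hτ
      rw [floor_div_eq hh hτ.1.le (hτ.2.trans_le h2)]
    constructor
    · rw [intervalIntegrable_iff_integrableOn_Ioc_of_le h1]
      exact (integrable_const (F j)).congr (hae.mono fun τ hτ => hτ.symm)
    · rw [intervalIntegral.integral_of_le h1, integral_congr_ae hae, integral_const]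
      simp [h1]
  induction j generalizing t with
  | zero => simpa using piece 0 t (by simpa using h1) (by simpa using h2)
  | succ j ih =>
    have hj : ((j + 1 : ℕ) : ℝ) * h = (j + 1) * h := by push_cast; ring
    obtain ⟨i1, e1⟩ := ih (t := (j + 1) * h) (by nlinarith) le_rfl
    obtain ⟨i2, e2⟩ := piece (j + 1) t h1 h2
    rw [hj] at i2 e2
    refine ⟨i1.trans i2, ?_⟩
    rw [← intervalIntegral.integral_add_adjacent_intervals i1 i2, e1, e2,
      Finset.sum_range_succ, hj]
    ring

/-- Families of piecewise constant approximate solutions that converge geometrically. -/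
structure ApproxSolutions (k l₁ l₂ : ℝ) (κ : ℝ → ℝ → ℝ → ℝ) (T : EReal) (uin : ℝ → ℝ)
    (u : ℕ → ℝ → ℝ → ℝ) : Prop where
  step : ∀ n, ∃ (i : ℝ → ℕ) (e : ℕ → ℝ → ℝ), Measurable i ∧ (∀ j, Measurable (e j)) ∧
    ∀ t, u n t = e (i t)
  init : Tendsto (fun n => wnorm k fun x => u n 0 x - uin x) atTop (𝓝 0)
  control : ∀ S : ℝ, 0 ≤ S → (S : EReal) < T → ∃ B, ∀ᶠ n in atTop, ∀ t ∈ Icc 0 S,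
    (∀ x, 0 ≤ u n t x) ∧ Weighted k (u n t) ∧ wnorm k (u n t) ≤ B ∧
      moment 1 (u n t) = moment 1 (u n 0)
  cauchy : ∀ S : ℝ, 0 ≤ S → (S : EReal) < T → ∃ K, ∀ᶠ n in atTop, ∀ t ∈ Icc 0 S,
    wnorm k (fun x => u (n + 1) t x - u n t x) ≤ K * (1 / 2) ^ n
  lipschitz : ∀ S : ℝ, 0 ≤ S → (S : EReal) < T → ∃ L, ∀ᶠ n in atTop, ∀ s ∈ Icc 0 S,
    ∀ t ∈ Icc 0 S, moment k (fun x => |u n t x - u n s x|) ≤ L * (|t - s| + (1 / 2) ^ n)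
  weak : ∀ S : ℝ, 0 ≤ S → (S : EReal) < T → ∀ (ς : ℝ → ℝ) (C : ℝ), Measurable ς → 0 ≤ C →
    (∀ x, 0 < x → |ς x| ≤ C * x ^ k) → ∃ D, ∀ᶠ n in atTop, ∀ t ∈ Icc 0 S,
    |(∫ x, ς x * u n t x ∂μ₀) - (∫ x, ς x * u n 0 x ∂μ₀) -
      ∫ τ in (0 : ℝ)..t, collForm κ l₁ l₂ ς (u n τ)| ≤ D * (1 / 2) ^ n

lemma moment_abs_sub_comm (a : ℝ) (f g : ℝ → ℝ) :
    moment a (fun x => |f x - g x|) = moment a fun x => |g x - f x| := by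
  simp only [abs_sub_comm]

theorem exists_approxSolutions (hk : Exponents k l₁ l₂) (hκ : FragKernel k E δ κ)
    {uin : ℝ → ℝ} (hu : Weighted k uin) (hu0 : ∀ x, 0 ≤ uin x) (hm : 0 < moment 1 uin) :
    ∃ u, ApproxSolutions k l₁ l₂ κ (existenceTime k l₁ l₂ E uin) uin u := by
  have hE := hκ.one_le
  obtain ⟨hT, g, Y, hg, hY0, hY⟩ := exists_growthBound_majorant hk (by linarith) hu hu0 hm
  set T := existenceTime k l₁ l₂ E uin
  set ρ := moment 1 uin with hρ
  set M := moment (1 + k) uin with hM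
  have hM0 : 0 ≤ M := moment_nonneg _ hu0
  obtain ⟨τ, hτ0, hτT, hτ⟩ := exists_times hT
  -- The first entry makes the truncated data converge geometrically, the second leaves them at
  -- least half of the mass.
  obtain ⟨R, hR0, hRm, hR⟩ := exists_radii hu (ε := fun n => min ((1 / 2) ^ n) (ρ / 2))
    fun n => by positivity
  obtain ⟨c, hc, hcf⟩ := exists_le_moment hk (half_pos hm) M
  set Bn : ℕ → ℝ := fun n => Y (τ n) + M with hBn
  have hBn0 : ∀ n, 0 ≤ Bn n := fun n => add_nonneg ((hY _ (hτT n)).nonneg hg (hτ0 n) le_rfl) hM0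
  set L : ℕ → ℝ := fun n => lipConst E (R (n + 1)) with hL
  have hL0 : ∀ n, 0 ≤ L n := fun n => by
    have := hR0 (n + 1)
    simp only [hL, lipConst]; positivity
  -- The terms serve, in turn, `h n ≤ 2 ^ (-n)`, the loss restriction, the consistency error and the
  -- drift within a coarse step. The radius `R (n + 1)` occurs because step `n` is compared with
  -- densities supported up to `R (n + 1)`.
  set A : ℕ → ℝ := fun n =>
    1 + 2 * (1 + R (n + 1)) * Bn n + 2 * L n ^ 2 * Bn n ^ 3 + L n * Bn n ^ 2 with hA
  have hRB : ∀ n, 0 ≤ 2 * (1 + R (n + 1)) * Bn n := fun n => by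
    have := hR0 (n + 1); have := hBn0 n; positivity
  have hLB : ∀ n, 0 ≤ 2 * L n ^ 2 * Bn n ^ 3 := fun n => by
    have := hL0 n; have := hBn0 n; positivity
  have hLB' : ∀ n, 0 ≤ L n * Bn n ^ 2 := fun n => by
    have := hL0 n; positivity
  have hA1 : ∀ n, 1 ≤ A n := fun n => by
    have := hRB n; have := hLB n; have := hLB' n
    simp only [hA]; linarith
  obtain ⟨h, m, hh, hhH, hhm⟩ := exists_steps (H := fun n => (1 / 2) ^ n / A n)
    fun n => by have := hA1 n; positivity
  have hhA : ∀ n a, a ≤ A n → h n * a ≤ (1 / 2) ^ n := fun n a ha => by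
    have h1 := hA1 n
    have h2 := hhH n
    rw [le_div_iff₀ (by linarith)] at h2
    exact (mul_le_mul_of_nonneg_left ha (hh n).le).trans h2
  have hhalf : ∀ n, ((1 : ℝ) / 2) ^ n ≤ 1 := fun n => pow_le_one₀ (by norm_num) (by norm_num)
  have hh2 : ∀ n, h n ≤ (1 / 2) ^ n := fun n => by simpa using hhA n 1 (hA1 n)
  have hadm : ∀ n, Admissible k ρ M (τ n) Y (R n) (h n) (cutoff (R n) uin) := fun n => by
    have i1 := hu.integrable_rpow hk.lt_one.le (by linarith [hk.pos])
    have hle := moment_cutoff_le hu0 i1 (R n)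
    have ht := hu.cutoff (R n)
    refine ⟨hR0 n, ht, cutoff_nonneg hu0 _, hle, ?_, moment_cutoff_le hu0 hu.high _, ?_,
      hh n, ?_⟩
    · have h1 := (hu.sub ht.weighted).moment_abs_le hk.lt_one.le (by linarith [hk.pos])
      have h2 := (abs_moment_le 1 fun x => uin x - cutoff (R n) uin x)
      rw [moment_sub i1 (ht.weighted.integrable_rpow hk.lt_one.le (by linarith [hk.pos]))] at h2
      have h3 := (hR n).trans (min_le_right _ _)
      have h4 := le_abs_self (moment 1 uin - moment 1 (cutoff (R n) uin))
      linarith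
    · rw [hY0]; exact moment_cutoff_le hu0 hu.low _
    · refine le_trans ?_ (hhalf n)
      refine le_trans ?_ (hhA n (2 * (1 + R (n + 1)) * Bn n) ?_)
      · have := hBn0 n; have := hRm n; have := (hh n).le
        simp only [hBn] at *
        gcongr
      · have := hLB n; have := hLB' n
        simp only [hA]; linarith
  have hfloor : ∀ n t, 0 ≤ t → (⌊t / h n⌋₊ : ℝ) * h n ≤ t := fun n t ht =>
    (le_div_iff₀ (hh n)).1 (Nat.floor_le (div_nonneg ht (hh n).le))
  have hfloor' : ∀ n (t : ℝ), t < (⌊t / h n⌋₊ + 1 : ℝ) * h n := fun n t =>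
    (div_lt_iff₀ (hh n)).1 (Nat.lt_floor_add_one _)
  set e : ℕ → ℕ → ℝ → ℝ := fun n => euler κ l₁ l₂ (h n) (cutoff (R n) uin) with he
  have htr : ∀ n j, Truncated k (R n) (e n j) := fun n j =>
    hκ.truncated_euler hk (hu.cutoff (R n)) (h n) j
  have heB : ∀ S : ℝ, (S : EReal) < T → ∀ n, S ≤ τ n → ∀ j : ℕ, j * h n ≤ S →
      wnorm k (e n j) ≤ Y S + M := fun S hS n hSn j hj =>
    hκ.wnorm_euler_le hk hg (hY _ (hτT n)) (hadm n) hSn hj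
  refine ⟨fun n t => e n ⌊t / h n⌋₊, ?_, ?_, ?_, ?_, ?_, ?_⟩
  · exact fun n => ⟨fun t => ⌊t / h n⌋₊, e n,
      Nat.measurable_floor.comp (measurable_id.div_const _), fun j => (htr n j).meas,
      fun t => rfl⟩
  · have h0 : ∀ n, e n ⌊(0 : ℝ) / h n⌋₊ = cutoff (R n) uin := fun n => by simp [he, euler]
    simp only [h0]
    refine squeeze_zero (fun n => wnorm_nonneg _ _) (fun n => ?_)
      (tendsto_pow_atTop_nhds_zero_of_lt_one (r := (1 : ℝ) / 2) (by norm_num) (by norm_num))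
    rw [wnorm_sub_comm]
    exact (hR n).trans (min_le_left _ _)
  · intro S hS0 hS
    refine ⟨Y S + M, ?_⟩
    filter_upwards [hτ S hS] with n hn t ht
    have hb := hκ.eulerBounds hk hg (hY _ (hτT n)) (hadm n) ⌊t / h n⌋₊
      ((hfloor n t ht.1).trans (ht.2.trans hn))
    refine ⟨hb.nonneg, (htr n _).weighted, heB S hS n hn _ ((hfloor n t ht.1).trans ht.2), ?_⟩
    have h0 : e n ⌊(0 : ℝ) / h n⌋₊ = cutoff (R n) uin := by simp [he, euler]
    rw [h0]
    exact hb.mass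
  · intro S hS0 hS
    have hYS := hY S hS
    have hB0 : 0 ≤ Y S + M := add_nonneg (hYS.nonneg hg hS0 le_rfl) hM0
    -- This constant depends on `S` but not on `n`: the initial difference and `η` are both at most
    -- `2 ^ (-n)`.
    refine ⟨Real.exp (stabConst E (Y S + M) S (M / (δ * c))) * (1 + S) + 1, ?_⟩
    filter_upwards [hτ S hS, (tendsto_add_atTop_nat 1).eventually (hτ S hS)] with n hn hn1 t ht
    have hBB : Y S + M ≤ Bn n := by
      have := (hY _ (hτT n)).le hg hS0 hn le_rfl
      simp only [hBn]; linarith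
    have hLn := hL0 n
    have hpow : (0 : ℝ) < (1 / 2) ^ n := by positivity
    have hcmp := hκ.wnorm_euler_floor_sub_le hk hg (hY _ (hτT n)) (hY _ (hτT (n + 1))) (hadm n)
      (hadm (n + 1)) hn hn1 (hRm n) (hhm n) rfl hB0 hc hcf (η := (1 / 2) ^ n) ?_ ?_ ?_ ht.1 ht.2
    · refine hcmp.trans ?_
      have h1 := (wnorm_cutoff_sub_le hu (hRm n)).trans ((hR n).trans (min_le_left _ _))
      have h2 : wnorm k (fun x => cutoff (R (n + 1)) uin x - cutoff (R n) uin x) +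
          S * (1 / 2) ^ n ≤ (1 + S) * (1 / 2) ^ n := by linarith
      have h3 := mul_le_mul_of_nonneg_left h2
        (Real.exp_pos (stabConst E (Y S + M) S (M / (δ * c)))).le
      linarith
    · refine le_trans ?_ ((hhA n (2 * (1 + R (n + 1)) * Bn n) ?_).trans (hhalf n))
      · have := hR0 (n + 1); have := (hh n).le
        gcongr
      · have := hLB n; have := hLB' n
        simp only [hA]; linarith
    · refine le_trans ?_ (hhA n (2 * L n ^ 2 * Bn n ^ 3) ?_)
      · have := (hh n).le
        gcongr
      · have := hRB n; have := hLB' n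
        simp only [hA]; linarith
    · refine le_trans ?_ (hhA n (L n * Bn n ^ 2) ?_)
      · have := (hh n).le
        gcongr
      · have := hRB n; have := hLB n
        simp only [hA]; linarith
  · intro S hS0 hS
    have hB0 : 0 ≤ Y S + M := add_nonneg ((hY S hS).nonneg hg hS0 le_rfl) hM0
    refine ⟨2 * (E + 1) * (Y S + M) ^ 2, ?_⟩
    filter_upwards [hτ S hS] with n hn
    have key : ∀ s ∈ Icc 0 S, ∀ t ∈ Icc 0 S, s ≤ t →
        moment k (fun x => |e n ⌊t / h n⌋₊ x - e n ⌊s / h n⌋₊ x|) ≤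
          2 * (E + 1) * (Y S + M) ^ 2 * (|t - s| + (1 / 2) ^ n) := by
      intro s hs t ht hst
      have hle : ⌊s / h n⌋₊ ≤ ⌊t / h n⌋₊ :=
        Nat.floor_le_floor (div_le_div_of_nonneg_right hst (hh n).le)
      obtain ⟨r, hr⟩ := Nat.exists_eq_add_of_le hle
      have h1 := hκ.moment_euler_add_sub_le (l₁ := l₁) (l₂ := l₂) hk (hh n).le
        (hu.cutoff (R n)) hB0 ⌊s / h n⌋₊ r fun j hj => heB S hS n hn _ (by
          have h2 := (hfloor n t ht.1).trans ht.2
          have h3 : ((⌊s / h n⌋₊ + j : ℕ) : ℝ) ≤ ⌊t / h n⌋₊ := by exact_mod_cast (by omega)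
          exact (mul_le_mul_of_nonneg_right h3 (hh n).le).trans h2)
      rw [← hr] at h1
      refine h1.trans ?_
      rw [mul_comm]
      refine mul_le_mul_of_nonneg_left ?_ (by positivity)
      have h2 := hfloor n t ht.1
      have h3 := hfloor' n s
      have h4 := hh2 n
      have h5 : (⌊t / h n⌋₊ : ℝ) = ⌊s / h n⌋₊ + r := by exact_mod_cast hr
      rw [h5] at h2
      rw [abs_of_nonneg (by linarith)]
      linarith
    intro s hs t ht
    rcases le_total s t with hst | hst
    · exact key s hs t ht hst
    · rw [moment_abs_sub_comm, abs_sub_comm]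
      exact key t ht s hs hst
  · intro S hS0 hS ς C hς hC hςC
    have hB0 : 0 ≤ Y S + M := add_nonneg ((hY S hS).nonneg hg hS0 le_rfl) hM0
    refine ⟨2 * (C * (E + 1)) * (Y S + M) * (Y S + M), ?_⟩
    filter_upwards [hτ S hS] with n hn t ht
    have h0 : e n ⌊(0 : ℝ) / h n⌋₊ = cutoff (R n) uin := by simp [he, euler]
    rw [h0, hκ.integral_mul_euler hk (hu.cutoff (R n)) hς hC hςC (h n) ⌊t / h n⌋₊,
      (integral_floor (hh n) (fun j => collForm κ l₁ l₂ ς (e n j)) ⌊t / h n⌋₊ (hfloor n t ht.1)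
        (hfloor' n t).le).2]
    have hB := heB S hS n hn _ ((hfloor n t ht.1).trans ht.2)
    have h1 := hκ.abs_collForm_le hk hς hC hςC (htr n ⌊t / h n⌋₊).weighted
    have h2 : |collForm κ l₁ l₂ ς (e n ⌊t / h n⌋₊)| ≤
        2 * (C * (E + 1)) * (Y S + M) * (Y S + M) := by
      refine h1.trans ?_
      have := wnorm_nonneg k (e n ⌊t / h n⌋₊)
      gcongr
    have h3 : |t - ⌊t / h n⌋₊ * h n| ≤ (1 / 2) ^ n := by
      have h4 := hfloor' n t
      rw [abs_of_nonneg (by linarith [hfloor n t ht.1])]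
      linarith [hh2 n]
    have h5 : ∀ a b d : ℝ, a + b - a - (b + d) = -d := fun a b d => by ring
    rw [h5, abs_neg, abs_mul, mul_comm]
    exact mul_le_mul h2 h3 (abs_nonneg _) ((abs_nonneg _).trans h2)

end

/-! ### Passage to the limit. -/

noncomputable section

open Filter Topology

variable {k l₁ l₂ E δ C : ℝ} {κ : ℝ → ℝ → ℝ → ℝ} {f g uin ς : ℝ → ℝ} {T : EReal}

/-- Mass-conserving weak solutions that are Lipschitz continuous in time. -/
structure LipschitzSolution (k l₁ l₂ : ℝ) (κ : ℝ → ℝ → ℝ → ℝ) (T : EReal) (uin : ℝ → ℝ)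
    (u : ℝ → ℝ → ℝ) : Prop where
  meas : Measurable fun p : ℝ × ℝ => u p.1 p.2
  nonneg : ∀ t x, 0 ≤ u t x
  init : u 0 =ᵐ[μ₀] uin
  bounded : ∀ S : ℝ, 0 ≤ S → (S : EReal) < T → ∃ B, ∀ t ∈ Icc 0 S,
    Weighted k (u t) ∧ wnorm k (u t) ≤ B
  mass : ∀ t ∈ timeIco T, moment 1 (u t) = moment 1 uin
  lipschitz : ∀ S : ℝ, 0 ≤ S → (S : EReal) < T → ∃ L, ∀ s ∈ Icc 0 S, ∀ t ∈ Icc 0 S,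
    moment k (fun x => |u t x - u s x|) ≤ L * |t - s|
  weak : ∀ t ∈ timeIco T, ∀ (ς : ℝ → ℝ) (C : ℝ), Measurable ς → 0 ≤ C →
    (∀ x, 0 < x → |ς x| ≤ C * x ^ k) →
    ∫ x, ς x * u t x ∂μ₀ = (∫ x, ς x * uin x ∂μ₀) +
      ∫ τ in (0 : ℝ)..t, collForm κ l₁ l₂ ς (u τ)

namespace Weighted

lemma integrable_mul (hf : Weighted k f) (hς : Measurable ς)
    (hςC : ∀ x, 0 < x → |ς x| ≤ C * x ^ k) : Integrable (fun x => ς x * f x) μ₀ := by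
  refine (hf.abs.low.const_mul C).mono' (hς.mul hf.meas).aestronglyMeasurable ?_
  filter_upwards [ae_pos] with x hx
  rw [norm_mul, ← mul_assoc]
  exact mul_le_mul_of_nonneg_right (hςC x hx) (abs_nonneg _)

lemma abs_integral_mul_le (hf : Weighted k f) (hς : Measurable ς) (hC : 0 ≤ C)
    (hςC : ∀ x, 0 < x → |ς x| ≤ C * x ^ k) : |∫ x, ς x * f x ∂μ₀| ≤ C * wnorm k f := by
  refine le_trans ?_ (mul_le_mul_of_nonneg_left
    (hf.moment_abs_le le_rfl (le_add_of_nonneg_left zero_le_one)) hC)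
  rw [moment_eq, ← integral_const_mul]
  refine abs_integral_le_integral_abs.trans (integral_mono_ae (hf.integrable_mul hς hςC).abs
    (hf.abs.low.const_mul C) ?_)
  filter_upwards [ae_pos] with x hx
  rw [abs_mul, ← mul_assoc]
  exact mul_le_mul_of_nonneg_right (hςC x hx) (abs_nonneg _)

lemma tendsto_integral_mul {v : ℕ → ℝ → ℝ} (hv : ∀ᶠ n in atTop, Weighted k (v n))
    (hf : Weighted k f) (h : Tendsto (fun n => wnorm k fun x => v n x - f x) atTop (𝓝 0))
    (hς : Measurable ς) (hC : 0 ≤ C) (hςC : ∀ x, 0 < x → |ς x| ≤ C * x ^ k) :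
    Tendsto (fun n => ∫ x, ς x * v n x ∂μ₀) atTop (𝓝 (∫ x, ς x * f x ∂μ₀)) := by
  rw [tendsto_iff_norm_sub_tendsto_zero]
  refine squeeze_zero' (Eventually.of_forall fun _ => norm_nonneg _) ?_
    (by simpa using h.const_mul C)
  filter_upwards [hv] with n hn
  rw [← integral_sub (hn.integrable_mul hς hςC) (hf.integrable_mul hς hςC)]
  simpa only [mul_sub, Real.norm_eq_abs] using (hn.sub hf).abs_integral_mul_le hς hC hςC

lemma tendsto_moment {v : ℕ → ℝ → ℝ} (hv : ∀ᶠ n in atTop, Weighted k (v n))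
    (hf : Weighted k f) (h : Tendsto (fun n => wnorm k fun x => v n x - f x) atTop (𝓝 0))
    {a : ℝ} (h₁ : k ≤ a) (h₂ : a ≤ 1 + k) :
    Tendsto (fun n => moment a (v n)) atTop (𝓝 (moment a f)) := by
  rw [tendsto_iff_norm_sub_tendsto_zero]
  refine squeeze_zero' (Eventually.of_forall fun _ => norm_nonneg _) ?_ h
  filter_upwards [hv] with n hn
  rw [← moment_sub (hn.integrable_rpow h₁ h₂) (hf.integrable_rpow h₁ h₂)]
  exact (abs_moment_le _ _).trans ((hn.sub hf).moment_abs_le h₁ h₂)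

end Weighted

lemma ae_eq_of_wnorm_sub_eq_zero (hf : Weighted k f) (hg : Weighted k g)
    (h : wnorm k (fun x => f x - g x) = 0) : f =ᵐ[μ₀] g := by
  have h0 : 0 ≤ᵐ[μ₀] fun x => (x ^ k + x ^ (1 + k)) * |f x - g x| := by
    filter_upwards [ae_pos] with x hx
    exact mul_nonneg (weight_nonneg k hx) (abs_nonneg _)
  filter_upwards [(integral_eq_zero_iff_of_nonneg_ae h0 (hf.sub hg).integrable_weight).1 h,
    ae_pos] with x h1 hx
  have h2 := Real.rpow_pos_of_pos hx k
  have h3 := Real.rpow_pos_of_pos hx (1 + k)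
  rcases mul_eq_zero.1 h1 with h | h
  · exact absurd h (by positivity)
  · exact sub_eq_zero.1 (abs_eq_zero.1 h)

/-- The pointwise limit of a sequence of non-negative functions of time and size. -/
def limitFun (u : ℕ → ℝ → ℝ → ℝ) (t x : ℝ) : ℝ :=
  (limsup (fun n => ENNReal.ofReal (u n t x)) atTop).toReal

lemma limitFun_eq {u : ℕ → ℝ → ℝ → ℝ} {t x l : ℝ} (hu : ∀ᶠ n in atTop, 0 ≤ u n t x)
    (h : Tendsto (fun n => u n t x) atTop (𝓝 l)) : limitFun u t x = l := by
  rw [limitFun, (ENNReal.tendsto_ofReal h).limsup_eq, ENNReal.toReal_ofReal (ge_of_tendsto h hu)]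

namespace ApproxSolutions

variable {u : ℕ → ℝ → ℝ → ℝ}

/-- The upper limit gives a representative jointly measurable in time and size, which a separate
choice of an `L¹` limit at each time would not ensure. -/
lemma measurable_limitFun (hu : ApproxSolutions k l₁ l₂ κ T uin u) :
    Measurable fun p : ℝ × ℝ => limitFun u p.1 p.2 := by
  refine (Measurable.limsup fun n => ?_).ennreal_toReal
  obtain ⟨i, e, hi, he, hie⟩ := hu.step n
  have h : Measurable fun q : ℕ × ℝ => e q.1 q.2 := measurable_from_prod_countable_right he
  simp only [hie]
  exact (h.comp ((hi.comp measurable_fst).prodMk measurable_snd)).ennreal_ofReal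

lemma eventually_weighted (hu : ApproxSolutions k l₁ l₂ κ T uin u) {t : ℝ} (ht : t ∈ timeIco T) :
    ∀ᶠ n in atTop, Weighted k (u n t) := by
  obtain ⟨B, hB⟩ := hu.control t ht.1 ht.2
  exact hB.mono fun n hn => (hn t ⟨ht.1, le_rfl⟩).2.1

lemma tendsto_limitFun (hu : ApproxSolutions k l₁ l₂ κ T uin u) {t : ℝ} (ht : t ∈ timeIco T) :
    Weighted k (limitFun u t) ∧
      Tendsto (fun n => wnorm k fun x => u n t x - limitFun u t x) atTop (𝓝 0) := by
  obtain ⟨B, hB⟩ := hu.control t ht.1 ht.2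
  obtain ⟨K, hK⟩ := hu.cauchy t ht.1 ht.2
  obtain ⟨N, hN⟩ := eventually_atTop.1 (hB.and hK)
  have hmem : t ∈ Icc 0 t := ⟨ht.1, le_rfl⟩
  have h1 : ∀ n, N ≤ n → Weighted k (u n t) := fun n hn => ((hN n hn).1 t hmem).2.1
  have h2 : ∀ n, N ≤ n → wnorm k (fun x => u (n + 1) t x - u n t x) ≤ K * (1 / 2) ^ n :=
    fun n hn => (hN n hn).2 t hmem
  have h3 : Measurable (limitFun u t) := hu.measurable_limitFun.of_uncurry_left
  refine weighted_limit (v := fun n => u n t) h1 h2 h3 fun x l hl => ?_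
  exact limitFun_eq (hB.mono fun n hn => (hn t hmem).1 x) hl

lemma tendsto_collForm (hu : ApproxSolutions k l₁ l₂ κ T uin u) (hk : Exponents k l₁ l₂)
    (hκ : FragKernel k E δ κ) (hς : Measurable ς) (hC : 0 ≤ C)
    (hςC : ∀ x, 0 < x → |ς x| ≤ C * x ^ k) {t : ℝ} (ht : t ∈ timeIco T) :
    Tendsto (fun n => collForm κ l₁ l₂ ς (u n t)) atTop
      (𝓝 (collForm κ l₁ l₂ ς (limitFun u t))) := by
  obtain ⟨B, hB⟩ := hu.control t ht.1 ht.2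
  obtain ⟨hw, hlim⟩ := hu.tendsto_limitFun ht
  rw [tendsto_iff_norm_sub_tendsto_zero]
  refine squeeze_zero' (g := fun n => 2 * (C * (E + 1)) *
      (wnorm k fun x => u n t x - limitFun u t x) * (B + wnorm k (limitFun u t)))
    (Eventually.of_forall fun _ => norm_nonneg _) ?_
    (by simpa using (hlim.const_mul (2 * (C * (E + 1)))).mul_const (B + wnorm k (limitFun u t)))
  filter_upwards [hB] with n hn
  obtain ⟨-, h1, h2, -⟩ := hn t ⟨ht.1, le_rfl⟩
  refine (hκ.abs_collForm_sub_le hk hς hC hςC h1 hw).trans ?_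
  have := hκ.one_le
  have := wnorm_nonneg k fun x => u n t x - limitFun u t x
  gcongr

/-- Dominated convergence in time: the norm bound is uniform on `[0, t]`, and each approximation is
a step function of time with countably many values, hence measurable. -/
lemma tendsto_integral_collForm (hu : ApproxSolutions k l₁ l₂ κ T uin u)
    (hk : Exponents k l₁ l₂) (hκ : FragKernel k E δ κ) (hς : Measurable ς) (hC : 0 ≤ C)
    (hςC : ∀ x, 0 < x → |ς x| ≤ C * x ^ k) {t : ℝ} (ht : t ∈ timeIco T) :
    Tendsto (fun n => ∫ τ in (0 : ℝ)..t, collForm κ l₁ l₂ ς (u n τ)) atTop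
      (𝓝 (∫ τ in (0 : ℝ)..t, collForm κ l₁ l₂ ς (limitFun u τ))) := by
  obtain ⟨B, hB⟩ := hu.control t ht.1 ht.2
  have hE := hκ.one_le
  refine intervalIntegral.tendsto_integral_filter_of_dominated_convergence
    (fun _ => 2 * (C * (E + 1)) * B * B) (Eventually.of_forall fun n => ?_) ?_
    intervalIntegrable_const (Eventually.of_forall fun τ hτ => ?_)
  · obtain ⟨i, e, hi, -, hie⟩ := hu.step n
    have h : Measurable fun j => collForm κ l₁ l₂ ς (e j) := measurable_from_nat
    simp only [hie]
    exact (h.comp hi).aestronglyMeasurable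
  · filter_upwards [hB] with n hn
    refine Eventually.of_forall fun τ hτ => ?_
    rw [uIoc_of_le ht.1] at hτ
    obtain ⟨-, h1, h2, -⟩ := hn τ ⟨hτ.1.le, hτ.2⟩
    refine (hκ.abs_collForm_le hk hς hC hςC h1).trans ?_
    have h3 := wnorm_nonneg k (u n τ)
    have := h3.trans h2
    gcongr
  · rw [uIoc_of_le ht.1] at hτ
    exact hu.tendsto_collForm hk hκ hς hC hςC
      ⟨hτ.1.le, (EReal.coe_le_coe_iff.2 hτ.2).trans_lt ht.2⟩

theorem lipschitzSolution (hu : ApproxSolutions k l₁ l₂ κ T uin u) (hk : Exponents k l₁ l₂)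
    (hκ : FragKernel k E δ κ) (hin : Weighted k uin) (hT : 0 < T) :
    LipschitzSolution k l₁ l₂ κ T uin (limitFun u) := by
  have mem0 : (0 : ℝ) ∈ timeIco T := ⟨le_rfl, by simpa using hT⟩
  have mem : ∀ {S t : ℝ}, (S : EReal) < T → t ∈ Icc 0 S → t ∈ timeIco T := fun hS ht =>
    ⟨ht.1, (EReal.coe_le_coe_iff.2 ht.2).trans_lt hS⟩
  have pow0 : Tendsto (fun n : ℕ => ((1 : ℝ) / 2) ^ n) atTop (𝓝 0) :=
    tendsto_pow_atTop_nhds_zero_of_lt_one (by norm_num) (by norm_num)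
  have h1k : k ≤ 1 := hk.lt_one.le
  have h1k' : (1 : ℝ) ≤ 1 + k := by linarith [hk.pos]
  refine ⟨hu.measurable_limitFun, fun _ _ => ENNReal.toReal_nonneg, ?_, ?_, ?_, ?_, ?_⟩
  · obtain ⟨hw, hlim⟩ := hu.tendsto_limitFun mem0
    refine ae_eq_of_wnorm_sub_eq_zero hw hin (le_antisymm ?_ (wnorm_nonneg _ _))
    refine ge_of_tendsto (by simpa using hlim.add hu.init) ?_
    filter_upwards [hu.eventually_weighted mem0] with n hn
    rw [wnorm_sub_comm k (u n 0) (limitFun u 0)]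
    exact hw.wnorm_sub_le_add hn hin
  · intro S hS0 hS
    obtain ⟨B, hB⟩ := hu.control S hS0 hS
    refine ⟨B, fun t ht => ?_⟩
    obtain ⟨hw, hlim⟩ := hu.tendsto_limitFun (mem hS ht)
    have hB' : Tendsto (fun n => B + wnorm k fun x => u n t x - limitFun u t x) atTop (𝓝 B) := by
      simpa using hlim.const_add B
    refine ⟨hw, ge_of_tendsto hB' ?_⟩
    filter_upwards [hB] with n hn
    obtain ⟨-, h1, h2, -⟩ := hn t ht
    have := h1.wnorm_sub_le (h1.sub hw)
    simp only [sub_sub_cancel] at this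
    linarith
  · intro t ht
    obtain ⟨B, hB⟩ := hu.control t ht.1 ht.2
    obtain ⟨hw, hlim⟩ := hu.tendsto_limitFun ht
    have a1 := Weighted.tendsto_moment (hu.eventually_weighted ht) hw hlim h1k h1k'
    have a2 := Weighted.tendsto_moment (hu.eventually_weighted mem0) hin hu.init h1k h1k'
    refine tendsto_nhds_unique (a2.congr' ?_) a1 |>.symm
    filter_upwards [hB] with n hn
    exact (hn t ⟨ht.1, le_rfl⟩).2.2.2.symm
  · intro S hS0 hS
    obtain ⟨L, hL⟩ := hu.lipschitz S hS0 hS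
    refine ⟨L, fun s hs t ht => ?_⟩
    obtain ⟨hwt, ht'⟩ := hu.tendsto_limitFun (mem hS ht)
    obtain ⟨hws, hs'⟩ := hu.tendsto_limitFun (mem hS hs)
    -- The time-grid error `2 ^ (-n)` vanishes, leaving a genuine Lipschitz bound.
    have hlim : Tendsto (fun n => L * (|t - s| + (1 / 2) ^ n) +
        ((wnorm k fun x => u n t x - limitFun u t x) +
        wnorm k fun x => u n s x - limitFun u s x)) atTop (𝓝 (L * |t - s|)) := by
      simpa using ((pow0.const_add |t - s|).const_mul L).add (ht'.add hs')
    refine ge_of_tendsto hlim ?_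
    filter_upwards [hL, hu.eventually_weighted (mem hS ht),
      hu.eventually_weighted (mem hS hs)] with n hn h1 h2
    have h3 := (h1.sub hwt).moment_abs_le le_rfl (le_add_of_nonneg_left zero_le_one)
    have h4 := (h2.sub hws).moment_abs_le le_rfl (le_add_of_nonneg_left zero_le_one)
    refine le_trans ?_ (add_le_add (hn s hs t ht) (add_le_add h3 h4))
    have i1 := (h1.sub h2).abs.low
    have i2 := (h1.sub hwt).abs.low
    have i3 := (h2.sub hws).abs.low
    have i12 := (h1.sub h2).abs.add (h1.sub hwt).abs
    rw [← add_assoc, ← moment_add i1 i2, ← moment_add i12.low i3]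
    refine integral_mono_ae (hwt.sub hws).abs.low (i12.add (h2.sub hws).abs).low ?_
    filter_upwards [ae_pos] with x hx
    refine mul_le_mul_of_nonneg_left ?_ (Real.rpow_nonneg hx.le _)
    have h5 := abs_add_le (u n t x - u n s x)
      (-(u n t x - limitFun u t x) + (u n s x - limitFun u s x))
    have h6 := abs_add_le (-(u n t x - limitFun u t x)) (u n s x - limitFun u s x)
    rw [abs_neg] at h6
    rw [show limitFun u t x - limitFun u s x = u n t x - u n s x +
      (-(u n t x - limitFun u t x) + (u n s x - limitFun u s x)) by ring]
    linarith
  · intro t ht ς C hς hC hςC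
    obtain ⟨D, hD⟩ := hu.weak t ht.1 ht.2 ς C hς hC hςC
    obtain ⟨hw, hlim⟩ := hu.tendsto_limitFun ht
    have a1 := Weighted.tendsto_integral_mul (hu.eventually_weighted ht) hw hlim hς hC hςC
    have a2 := Weighted.tendsto_integral_mul (hu.eventually_weighted mem0) hin hu.init hς hC hςC
    have a3 := hu.tendsto_integral_collForm hk hκ hς hC hςC ht
    have a4 := tendsto_nhds_unique ((a1.sub a2).sub a3)
      (squeeze_zero_norm' (hD.mono fun n hn => hn t ⟨ht.1, le_rfl⟩)
        (by simpa using pow0.const_mul D))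
    linarith

end ApproxSolutions

end

/-! ### From Lipschitz solutions to weak solutions in the sense of the definitions. -/

noncomputable section

open Filter Topology

variable {k l₁ l₂ E δ C : ℝ} {κ : ℝ → ℝ → ℝ → ℝ} {f g uin ς : ℝ → ℝ} {T : EReal}

lemma measurable_ofReal_rpow (a : ℝ) : Measurable fun x : ℝ => ENNReal.ofReal (x ^ a) :=
  (measurable_id.pow_const a).ennreal_ofReal

lemma memX_iff (a : ℝ) (f : ℝ → ℝ) : MemX a f ↔ Integrable (fun x => x ^ a * f x) μ₀ := by
  rw [MemX, sizeMeasure, integrable_withDensity_iff_integrable_smul' (measurable_ofReal_rpow a)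
    (Eventually.of_forall fun x => ENNReal.ofReal_lt_top)]
  refine integrable_congr ?_
  filter_upwards [ae_pos] with x hx
  rw [ENNReal.toReal_ofReal (Real.rpow_nonneg hx.le _), smul_eq_mul]

lemma integral_sizeMeasure (a : ℝ) (f : ℝ → ℝ) : ∫ x, f x ∂(sizeMeasure a) = moment a f := by
  rw [sizeMeasure, integral_withDensity_eq_integral_toReal_smul (measurable_ofReal_rpow a)
    (Eventually.of_forall fun x => ENNReal.ofReal_lt_top)]
  refine integral_congr_ae ?_
  filter_upwards [ae_pos] with x hx
  rw [ENNReal.toReal_ofReal (Real.rpow_nonneg hx.le _), smul_eq_mul]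

lemma ae_sizeMeasure_iff (a : ℝ) {p : ℝ → Prop} :
    (∀ᵐ x ∂(sizeMeasure a), p x) ↔ ∀ᵐ x ∂μ₀, p x := by
  rw [sizeMeasure, ae_withDensity_iff (measurable_ofReal_rpow a)]
  refine eventually_congr ?_
  filter_upwards [ae_pos] with x hx
  have h := Real.rpow_pos_of_pos hx a
  exact ⟨fun h' => h' (ENNReal.ofReal_pos.2 h).ne', fun h' _ => h'⟩

open Classical in
/-- The element of `X a` that is represented by `f`. -/
def toX (a : ℝ) (f : ℝ → ℝ) : X a :=
  if h : Integrable f (sizeMeasure a) then h.toL1 f else 0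

lemma toX_ae_eq {a : ℝ} (hf : MemX a f) : ∀ᵐ x ∂(sizeMeasure a), toX a f x = f x := by
  have h : Integrable f (sizeMeasure a) := hf
  rw [toX, dif_pos h]
  exact h.coeFn_toL1

lemma norm_toX {a : ℝ} (hf : MemX a f) : ‖toX a f‖ = moment a fun x => |f x| := by
  have h : Integrable f (sizeMeasure a) := hf
  rw [toX, dif_pos h, L1.norm_of_fun_eq_integral_norm, integral_sizeMeasure]
  simp only [Real.norm_eq_abs]

lemma norm_toX_sub {a : ℝ} (hf : MemX a f) (hg : MemX a g) :
    ‖toX a f - toX a g‖ = moment a fun x => |f x - g x| := by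
  have h : Integrable f (sizeMeasure a) := hf
  have h' : Integrable g (sizeMeasure a) := hg
  rw [toX, toX, dif_pos h, dif_pos h', ← Integrable.toL1_sub, L1.norm_of_fun_eq_integral_norm,
    integral_sizeMeasure]
  simp only [Real.norm_eq_abs, Pi.sub_apply]

lemma Weighted.memX (hf : Weighted k f) {a : ℝ} (h₁ : k ≤ a) (h₂ : a ≤ 1 + k) : MemX a f :=
  (memX_iff a f).2 (hf.integrable_rpow h₁ h₂)

lemma measurableSet_timeIoo (T : EReal) : MeasurableSet (timeIoo T) :=
  (measurableSet_lt measurable_const measurable_id).inter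
    (measurableSet_lt measurable_coe_real_ereal measurable_const)

lemma timeIoo_subset_timeIco (T : EReal) : timeIoo T ⊆ timeIco T := fun _ ht => ⟨ht.1.le, ht.2⟩

/-- By symmetry of the kernel the two weights contribute equally, so the case of `z.1 ^ k` suffices.
-/
lemma Weighted.integrable_collisions (hk : Exponents k l₁ l₂) (hf : Weighted k f) :
    Integrable (fun z : ℝ × ℝ =>
      (z.1 ^ k + z.2 ^ k) * collisionKernel l₁ l₂ z.1 z.2 * f z.1 * f z.2) (μ₀.prod μ₀) ∧
    ∫ z, |(z.1 ^ k + z.2 ^ k) * collisionKernel l₁ l₂ z.1 z.2 * f z.1 * f z.2| ∂(μ₀.prod μ₀) ≤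
      4 * wnorm k f * wnorm k f := by
  have hψ : Measurable fun z : ℝ × ℝ => z.1 ^ k := measurable_fst.pow_const k
  have hb : ∀ x y : ℝ, 0 < x → 0 < y → f x ≠ 0 → |x ^ k| ≤ 1 * x ^ k := fun x y hx _ _ => by
    rw [one_mul, abs_of_nonneg (Real.rpow_nonneg hx.le _)]
  set F : ℝ × ℝ → ℝ := fun z => z.1 ^ k * collisionKernel l₁ l₂ z.1 z.2 * f z.1 * f z.2 with hF
  have i1 : Integrable F (μ₀.prod μ₀) :=
    integrable_rate (ψ := fun z : ℝ × ℝ => z.1 ^ k) hk hf hf hψ hb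
  have b1 : ∫ z, |F z| ∂(μ₀.prod μ₀) ≤ 2 * 1 * wnorm k f * wnorm k f :=
    integral_abs_rate_le (ψ := fun z : ℝ × ℝ => z.1 ^ k) hk hf hf hψ zero_le_one hb
  have i2 : Integrable (fun z : ℝ × ℝ => F z.swap) (μ₀.prod μ₀) := i1.swap
  have b2 : ∫ z : ℝ × ℝ, |F z.swap| ∂(μ₀.prod μ₀) = ∫ z, |F z| ∂(μ₀.prod μ₀) :=
    integral_prod_swap fun z => |F z|
  have e : (fun z : ℝ × ℝ =>
      (z.1 ^ k + z.2 ^ k) * collisionKernel l₁ l₂ z.1 z.2 * f z.1 * f z.2) =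
      fun z => F z + F z.swap := by
    ext z
    simp only [hF, Prod.fst_swap, Prod.snd_swap]
    rw [collisionKernel_comm l₁ l₂ z.2 z.1]; ring
  have i3 : Integrable (fun z => F z + F z.swap) (μ₀.prod μ₀) := i1.add i2
  refine ⟨e ▸ i3, ?_⟩
  calc _ = ∫ z, |F z + F z.swap| ∂(μ₀.prod μ₀) := by
        refine integral_congr_ae (Eventually.of_forall fun z => ?_)
        exact congrArg (fun r : ℝ => |r|) (congrFun e z)
    _ ≤ ∫ z, (|F z| + |F z.swap|) ∂(μ₀.prod μ₀) :=
        integral_mono_ae i3.abs (i1.abs.add i2.abs)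
          (Eventually.of_forall fun z => abs_add_le _ _)
    _ ≤ _ := by
        rw [integral_add i1.abs i2.abs, b2]
        linarith

/-- Symmetrization of the weak form of the collision operator. -/
lemma FragKernel.integral_sym_eq (hk : Exponents k l₁ l₂) (hκ : FragKernel k E δ κ)
    (hς : Measurable ς) (hC : 0 ≤ C) (hςC : ∀ x, 0 < x → |ς x| ≤ C * x ^ k)
    (hf : Weighted k f) {Υ : ℝ → ℝ → ℝ}
    (hΥ : ∀ x y, 0 < x → 0 < y → Υ x y = (avg κ ς x y - ς x) + (avg κ ς y x - ς y)) :
    ∫ x in Ioi (0 : ℝ), ∫ y in Ioi (0 : ℝ), Υ x y * collisionKernel l₁ l₂ x y * f x * f y =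
      2 * collForm κ l₁ l₂ ς f := by
  have hψ := hκ.measurable_avg_sub hς
  have hb : ∀ x y : ℝ, 0 < x → 0 < y → f x ≠ 0 → |avg κ ς x y - ς x| ≤ C * (E + 1) * x ^ k :=
    fun x y hx hy _ => hκ.abs_avg_sub_le hς hC hςC hx hy
  set F : ℝ × ℝ → ℝ := fun z =>
    (avg κ ς z.1 z.2 - ς z.1) * collisionKernel l₁ l₂ z.1 z.2 * f z.1 * f z.2 with hF
  have i1 : Integrable F (μ₀.prod μ₀) :=
    integrable_rate (ψ := fun z : ℝ × ℝ => avg κ ς z.1 z.2 - ς z.1) hk hf hf hψ hb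
  have i2 : Integrable (fun z : ℝ × ℝ => F z.swap) (μ₀.prod μ₀) := i1.swap
  have e1 : ∫ z : ℝ × ℝ, F z.swap ∂(μ₀.prod μ₀) = ∫ z, F z ∂(μ₀.prod μ₀) := integral_prod_swap F
  have e2 : ∫ z, (F z + F z.swap) ∂(μ₀.prod μ₀) = 2 * collForm κ l₁ l₂ ς f := by
    rw [integral_add i1 i2, e1, collForm, two_mul]
  have i3 : Integrable (fun z => F z + F z.swap) (μ₀.prod μ₀) := i1.add i2
  rw [← e2, integral_prod _ i3]
  refine integral_congr_ae ?_
  filter_upwards [ae_pos] with x hx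
  refine integral_congr_ae ?_
  filter_upwards [ae_pos] with y hy
  simp only [hF, Prod.swap_prod_mk]
  rw [hΥ x y hx hy, collisionKernel_comm l₁ l₂ y x]; ring

/-- The domain `(0, x + y)` contains the fragments of both partners, so `upsilon` is the sum of the
contributions of `x` shattered by `y` and of `y` shattered by `x`. -/
lemma upsilon_eq {β βs : ℝ → ℝ → ℝ → ℝ} (hκ : FragKernel k E δ (fragmentKernel βs))
    (hβ : ∀ x₃ x₁ x₂ : ℝ, 0 < x₃ → 0 < x₁ → 0 < x₂ →
      β x₃ x₁ x₂ = (Ioo 0 x₁).indicator (fun x => βs x x₁ x₂) x₃ +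
        (Ioo 0 x₂).indicator (fun x => βs x x₂ x₁) x₃)
    {ς' : ℝ → ℝ} (hς : Measurable ς) (hςC : ∀ x, 0 < x → |ς x| ≤ C * x ^ k)
    (hς' : ∀ x, 0 < x → ς' x = ς x) {x y : ℝ} (hx : 0 < x) (hy : 0 < y) :
    upsilon β ς' x y = (avg (fragmentKernel βs) ς x y - ς x) +
      (avg (fragmentKernel βs) ς y x - ς y) := by
  have i1 := hκ.integrable_mul hx hy hς fun z hz => hςC z hz.1
  have i2 := hκ.integrable_mul hy hx hς fun z hz => hςC z hz.1
  have hind : ∀ {a b z : ℝ}, 0 < b →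
      (Ioo 0 a).indicator (fun z => βs z a b) z = fragmentKernel βs z a b := fun {a b z} hb => by
    simpa using (congrFun (mul_fragmentKernel βs (fun _ => 1) a hb) z).symm
  have e : ∫ z in Ioo (0 : ℝ) (x + y), ς' z * β z x y =
      ∫ z in Ioi (0 : ℝ), (ς z * fragmentKernel βs z x y + ς z * fragmentKernel βs z y x) := by
    rw [setIntegral_eq_of_subset_of_forall_sdiff_eq_zero (s := Ioo 0 (x + y)) (t := Ioi 0)
      measurableSet_Ioi Ioo_subset_Ioi_self]
    · refine setIntegral_congr_fun measurableSet_Ioo fun z hz => ?_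
      rw [hβ z x y hz.1 hx hy, hς' z hz.1, hind hy, hind hx, mul_add]
    · intro z hz
      have h : ¬ z < x + y := fun h => hz.2 ⟨hz.1, h⟩
      rw [hκ.supp z x y fun h' => h (by linarith [h'.2]),
        hκ.supp z y x fun h' => h (by linarith [h'.2])]
      ring
  rw [upsilon, e, integral_add i1 i2, hς' x hx, hς' y hy, avg, avg]
  ring

lemma IsTestFunction.exists_abs_le (hς : IsTestFunction k ς) :
    ∃ C, 0 ≤ C ∧ ∀ x, 0 < x → |ς x| ≤ C * x ^ k := by
  obtain ⟨C, hC⟩ := hς.holder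
  refine ⟨|C|, abs_nonneg C, fun x hx => ?_⟩
  have h := hC x 0 hx.le le_rfl
  rw [hς.zero, sub_zero, sub_zero, abs_of_pos hx] at h
  exact h.trans (mul_le_mul_of_nonneg_right (le_abs_self C) (Real.rpow_nonneg hx.le _))

/-- A test function is arbitrary on the negative axis; composing with `max x 0` makes it measurable
without changing it on `(0, ∞)`. -/
lemma IsTestFunction.measurable_comp_max (hk : 0 < k) (hς : IsTestFunction k ς) :
    Measurable fun x => ς (max x 0) := by
  obtain ⟨C, hC⟩ := hς.holder
  refine Continuous.measurable (continuous_iff_continuousAt.2 fun x => ?_)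
  rw [ContinuousAt, tendsto_iff_norm_sub_tendsto_zero]
  have h : Continuous fun y : ℝ => C * |max y 0 - max x 0| ^ k :=
    continuous_const.mul ((by fun_prop : Continuous fun y : ℝ => |max y 0 - max x 0|).rpow_const
      fun _ => Or.inr hk.le)
  have h0 := h.tendsto x
  simp only [sub_self, abs_zero, Real.zero_rpow hk.ne', mul_zero] at h0
  exact squeeze_zero (fun _ => norm_nonneg _)
    (fun y => hC _ _ (le_max_right _ _) (le_max_right _ _)) h0

namespace LipschitzSolution

variable {u : ℝ → ℝ → ℝ}

lemma weighted (hu : LipschitzSolution k l₁ l₂ κ T uin u) {t : ℝ} (ht : t ∈ timeIco T) :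
    Weighted k (u t) := by
  obtain ⟨B, hB⟩ := hu.bounded t ht.1 ht.2
  exact (hB t ⟨ht.1, le_rfl⟩).1

/-- Interpolation between order `k`, where the solution is Lipschitz in time, and order `1 + k`,
where it is bounded. It gives norm continuity, used for weak continuity with `a = k` and for strong
measurability with `a = 1`. -/
lemma continuousOn_toX (hu : LipschitzSolution k l₁ l₂ κ T uin u) {a : ℝ} (h₁ : k ≤ a)
    (h₂ : a < 1 + k) : ContinuousOn (fun t => toX a (u t)) (timeIco T) := by
  intro s hs
  obtain ⟨S, hsS, hST⟩ := EReal.lt_iff_exists_real_btwn.1 hs.2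
  have hsS' : s < S := EReal.coe_lt_coe_iff.1 hsS
  have hS0 : 0 ≤ S := hs.1.trans hsS'.le
  obtain ⟨B, hB⟩ := hu.bounded S hS0 hST
  obtain ⟨L, hL⟩ := hu.lipschitz S hS0 hST
  have hsm : s ∈ Icc 0 S := ⟨hs.1, hsS'.le⟩
  rw [ContinuousWithinAt, tendsto_iff_norm_sub_tendsto_zero]
  have hθ : 0 < (1 + k - a) / (1 + k - k) := div_pos (by linarith) (by linarith)
  have hθ' : 0 ≤ (a - k) / (1 + k - k) := div_nonneg (by linarith) (by linarith)
  have h : Continuous fun t : ℝ => (L * |t - s|) ^ ((1 + k - a) / (1 + k - k)) *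
      (B + B) ^ ((a - k) / (1 + k - k)) :=
    ((by fun_prop : Continuous fun t : ℝ => L * |t - s|).rpow_const
      fun _ => Or.inr hθ.le).mul continuous_const
  have h0 := h.tendsto s
  simp only [sub_self, abs_zero, mul_zero, Real.zero_rpow hθ.ne', zero_mul] at h0
  refine squeeze_zero' (Eventually.of_forall fun _ => norm_nonneg _) ?_
    (h0.mono_left nhdsWithin_le_nhds)
  filter_upwards [self_mem_nhdsWithin, mem_nhdsWithin_of_mem_nhds (Iio_mem_nhds hsS')]
    with t ht htS
  have htm : t ∈ Icc 0 S := ⟨ht.1, (mem_Iio.1 htS).le⟩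
  obtain ⟨w1, b1⟩ := hB t htm
  obtain ⟨w2, b2⟩ := hB s hsm
  rw [norm_toX_sub (w1.memX h₁ h₂.le) (w2.memX h₁ h₂.le)]
  refine (moment_le_rpow_mul_rpow (w1.sub w2).abs.meas (fun _ => abs_nonneg _) h₁ h₂.le
    (by linarith) (w1.sub w2).abs.low (w1.sub w2).abs.high).trans ?_
  have m1 := moment_nonneg k (f := fun x => |u t x - u s x|) fun _ => abs_nonneg _
  have m2 := moment_nonneg (1 + k) (f := fun x => |u t x - u s x|) fun _ => abs_nonneg _
  have m3 := ((w1.sub w2).moment_abs_le (le_add_of_nonneg_left zero_le_one) le_rfl).trans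
    ((w1.wnorm_sub_le w2).trans (add_le_add b1 b2))
  have m4 := hL s hsm t htm
  have m5 := m1.trans m4
  gcongr

lemma weaklyContinuousIn (hu : LipschitzSolution k l₁ l₂ κ T uin u) :
    WeaklyContinuousIn k T u :=
  ⟨fun t => toX k (u t),
    fun _ ht => toX_ae_eq ((hu.weighted ht).memX le_rfl (le_add_of_nonneg_left zero_le_one)),
    (toWeakSpaceCLM ℝ (X k)).continuous.comp_continuousOn
      (hu.continuousOn_toX le_rfl (lt_add_of_pos_left k zero_lt_one))⟩

lemma essBoundedIn (hu : LipschitzSolution k l₁ l₂ κ T uin u) (hk : Exponents k l₁ l₂) :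
    EssBoundedIn 1 T u := by
  have h1 := hk.pos
  have hm : ∀ t ∈ timeIco T, MemX 1 (u t) := fun t ht =>
    (hu.weighted ht).memX hk.lt_one.le (by linarith)
  refine ⟨fun t => toX 1 (u t), ?_, memLp_top_of_bound
    (((hu.continuousOn_toX hk.lt_one.le (by linarith)).mono
      (timeIoo_subset_timeIco T)).aestronglyMeasurable (measurableSet_timeIoo T))
    (moment 1 uin) ?_⟩
  · filter_upwards [ae_restrict_mem (measurableSet_timeIoo T)] with t ht
    exact toX_ae_eq (hm t (timeIoo_subset_timeIco T ht))
  · filter_upwards [ae_restrict_mem (measurableSet_timeIoo T)] with t ht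
    have ht' := timeIoo_subset_timeIco T ht
    rw [norm_toX (hm t ht'), moment_abs_of_nonneg (hu.nonneg t), hu.mass t ht']

lemma integrableOn_collisions (hu : LipschitzSolution k l₁ l₂ κ T uin u)
    (hk : Exponents k l₁ l₂) {t : ℝ} (ht : t ∈ timeIoo T) :
    IntegrableOn (fun z : ℝ × ℝ × ℝ => (z.2.1 ^ k + z.2.2 ^ k) *
      collisionKernel l₁ l₂ z.2.1 z.2.2 * u z.1 z.2.1 * u z.1 z.2.2)
      (Ioo (0 : ℝ) t ×ˢ Ioi (0 : ℝ) ×ˢ Ioi (0 : ℝ)) := by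
  obtain ⟨B, hB⟩ := hu.bounded t ht.1.le ht.2
  have hmeas : Measurable fun z : ℝ × ℝ × ℝ => (z.2.1 ^ k + z.2.2 ^ k) *
      collisionKernel l₁ l₂ z.2.1 z.2.2 * u z.1 z.2.1 * u z.1 z.2.2 := by
    have h1 : Measurable fun z : ℝ × ℝ × ℝ => z.2.1 := measurable_fst.comp measurable_snd
    have h2 : Measurable fun z : ℝ × ℝ × ℝ => z.2.2 := measurable_snd.comp measurable_snd
    exact ((((h1.pow_const k).add (h2.pow_const k)).mul
      ((measurable_collisionKernel l₁ l₂).comp measurable_snd)).mul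
      (hu.meas.comp (measurable_fst.prodMk h1))).mul (hu.meas.comp (measurable_fst.prodMk h2))
  rw [IntegrableOn, Measure.volume_eq_prod, Measure.volume_eq_prod, ← Measure.prod_restrict,
    ← Measure.prod_restrict, integrable_prod_iff hmeas.aestronglyMeasurable]
  have hc : ∀ᵐ τ ∂(volume.restrict (Ioo 0 t)), τ ∈ Icc 0 t := by
    filter_upwards [ae_restrict_mem measurableSet_Ioo] with τ hτ
    exact ⟨hτ.1.le, hτ.2.le⟩
  refine ⟨?_, (integrable_const (4 * B * B)).mono'
    hmeas.norm.stronglyMeasurable.integral_prod_right'.aestronglyMeasurable ?_⟩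
  · filter_upwards [hc] with τ hτ
    exact ((hB τ hτ).1.integrable_collisions hk).1
  · filter_upwards [hc] with τ hτ
    obtain ⟨w, b⟩ := hB τ hτ
    rw [Real.norm_of_nonneg (integral_nonneg fun _ => norm_nonneg _)]
    refine (w.integrable_collisions hk).2.trans ?_
    have h0 := wnorm_nonneg k (u τ)
    have := h0.trans b
    gcongr

/-- The factor `1 / 2` of the weak formulation cancels the factor `2` from symmetrization. -/
theorem isWeakSolution {β βs : ℝ → ℝ → ℝ → ℝ}
    (hu : LipschitzSolution k l₁ l₂ (fragmentKernel βs) T uin u) (hk : Exponents k l₁ l₂)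
    (hκ : FragKernel k E δ (fragmentKernel βs))
    (hβ : ∀ x₃ x₁ x₂ : ℝ, 0 < x₃ → 0 < x₁ → 0 < x₂ →
      β x₃ x₁ x₂ = (Ioo 0 x₁).indicator (fun x => βs x x₁ x₂) x₃ +
        (Ioo 0 x₂).indicator (fun x => βs x x₂ x₁) x₃) :
    IsWeakSolution k (collisionKernel l₁ l₂) β uin T u := by
  refine ⟨fun t _ x _ => hu.nonneg t x, hu.weaklyContinuousIn, hu.essBoundedIn hk, hu.init,
    fun t ht => hu.integrableOn_collisions hk ht, fun t ht ς hς => ?_⟩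
  obtain ⟨C, hC0, hC⟩ := hς.exists_abs_le
  have hmax : ∀ x : ℝ, 0 < x → ς x = ς (max x 0) := fun x hx => by rw [max_eq_left hx.le]
  have hm := hς.measurable_comp_max hk.pos
  have hC' : ∀ x, 0 < x → |ς (max x 0)| ≤ C * x ^ k := fun x hx => hmax x hx ▸ hC x hx
  have hreplace : ∀ f : ℝ → ℝ, ∫ x in Ioi (0 : ℝ), ς x * f x = ∫ x, ς (max x 0) * f x ∂μ₀ :=
    fun f => integral_congr_ae (by
      filter_upwards [ae_pos] with x hx
      rw [hmax x hx])
  rw [hreplace, hreplace, hu.weak t (timeIoo_subset_timeIco T ht) _ C hm hC0 hC',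
    intervalIntegral.integral_of_le ht.1.le, integral_Ioc_eq_integral_Ioo, ← integral_const_mul]
  congr 1
  refine setIntegral_congr_fun measurableSet_Ioo fun τ hτ => ?_
  have hw := hu.weighted ⟨hτ.1.le, (EReal.coe_lt_coe_iff.2 hτ.2).trans ht.2⟩
  rw [hκ.integral_sym_eq hk hm hC0 hC' hw fun x y hx hy => upsilon_eq hκ hβ hm hC' hmax hx hy]
  ring

lemma isMassConserving (hu : LipschitzSolution k l₁ l₂ κ T uin u) (hk : Exponents k l₁ l₂) :
    IsMassConserving uin T u := fun t ht =>
  ⟨(hu.weighted ht).memX hk.lt_one.le (by linarith [hk.pos]), hu.mass t ht⟩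

end LipschitzSolution

/-- Non-negative elements of `X k` have measurable non-negative representatives. -/
lemma MemXPos.exists_weighted (h : MemXPos k uin) (h' : MemX (1 + k) uin) :
    ∃ v, Weighted k v ∧ (∀ x, 0 ≤ v x) ∧ uin =ᵐ[μ₀] v := by
  have hmeas : AEStronglyMeasurable uin (sizeMeasure k) := h.1.aestronglyMeasurable
  have hmk : uin =ᵐ[μ₀] hmeas.mk uin := (ae_sizeMeasure_iff k).1 hmeas.ae_eq_mk
  have he : uin =ᵐ[μ₀] fun x => max (hmeas.mk uin x) 0 := by
    filter_upwards [hmk, (ae_sizeMeasure_iff k).1 h.2] with x h1 h2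
    rw [← h1, max_eq_left h2]
  have hmul : ∀ a : ℝ, (fun x => x ^ a * uin x) =ᵐ[μ₀]
      fun x => x ^ a * max (hmeas.mk uin x) 0 := fun a => by
    filter_upwards [he] with x hx
    rw [hx]
  exact ⟨_, ⟨hmeas.stronglyMeasurable_mk.measurable.max measurable_const,
    ((memX_iff k uin).1 h.1).congr (hmul k), ((memX_iff (1 + k) uin).1 h').congr (hmul _)⟩,
    fun x => le_max_right _ _, he⟩

lemma existenceTime_congr_ae (h : f =ᵐ[μ₀] g) :
    existenceTime k l₁ l₂ E f = existenceTime k l₁ l₂ E g := by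
  simp only [existenceTime, localTime, growthConst, momentConst, moment_congr_ae _ h]

lemma LipschitzSolution.congr_ae {u : ℝ → ℝ → ℝ} (hu : LipschitzSolution k l₁ l₂ κ T f u)
    (h : f =ᵐ[μ₀] g) : LipschitzSolution k l₁ l₂ κ T g u := by
  refine ⟨hu.meas, hu.nonneg, hu.init.trans h, hu.bounded, fun t ht => ?_, hu.lipschitz,
    fun t ht ς C hς hC hςC => ?_⟩
  · rw [hu.mass t ht, moment_congr_ae 1 h]
  · rw [hu.weak t ht ς C hς hC hςC]
    congr 1
    refine integral_congr_ae ?_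
    filter_upwards [h] with x hx
    rw [hx]

/-- The construction needs a datum that is measurable and non-negative everywhere; replacing the
datum by such a representative changes neither its moments nor, therefore, the existence time. -/
theorem exists_lipschitzSolution (hk : Exponents k l₁ l₂) (hκ : FragKernel k E δ κ)
    (hin : MemXPos k uin) (hin' : MemX (1 + k) uin) (hm : 0 < moment 1 uin) :
    ∃ u, LipschitzSolution k l₁ l₂ κ (existenceTime k l₁ l₂ E uin) uin u := by
  obtain ⟨v, hv, hv0, he⟩ := hin.exists_weighted hin'
  have hm' : 0 < moment 1 v := moment_congr_ae 1 he ▸ hm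
  obtain ⟨u, hu⟩ := exists_approxSolutions (l₁ := l₁) (l₂ := l₂) hk hκ hv hv0 hm'
  have hT := (exists_growthBound_majorant hk (lt_of_lt_of_le one_pos hκ.one_le) hv hv0 hm').1
  rw [existenceTime_congr_ae he]
  exact ⟨_, (hu.lipschitzSolution hk hκ hv hT).congr_ae he.symm⟩

end

end CollFrag

theorem theorem2p2
    (k₀ p₀ l₁ l₂ : ℝ) (hk₀ : 0 < k₀) (hk₀' : k₀ < 1) (hp₀ : 1 < p₀) (hp₀' : p₀ < 1 + k₀)
    (hl₁ : k₀ ≤ l₁) (hl₁₂ : l₁ ≤ l₂) (hl₂ : l₂ ≤ 1)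
    (β βs : ℝ → ℝ → ℝ → ℝ) (E : ℝ → ℝ)
    (hβs_meas : Measurable fun z : ℝ × ℝ × ℝ => βs z.1 z.2.1 z.2.2)
    (hβs_nonneg : ∀ x₃ x₁ x₂ : ℝ, 0 < x₃ → 0 < x₁ → 0 < x₂ → 0 ≤ βs x₃ x₁ x₂)
    (hβ : ∀ x₃ x₁ x₂ : ℝ, 0 < x₃ → 0 < x₁ → 0 < x₂ →
      β x₃ x₁ x₂ = (Set.Ioo 0 x₁).indicator (fun x => βs x x₁ x₂) x₃ +
        (Set.Ioo 0 x₂).indicator (fun x => βs x x₂ x₁) x₃)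
    (hβs_mass : ∀ x₁ x₂ : ℝ, 0 < x₁ → 0 < x₂ →
      ∫ x₃ in Set.Ioo 0 x₁, x₃ * βs x₃ x₁ x₂ = x₁)
    (hE_pos : ∀ p ∈ Set.Icc 1 p₀, 0 < E p)
    (hβs_bound : ∀ p ∈ Set.Icc 1 p₀, ∀ x₁ x₂ : ℝ, 0 < x₁ → 0 < x₂ →
      ∫⁻ x₃ in Set.Ioo 0 x₁, ENNReal.ofReal (x₃ ^ k₀ * βs x₃ x₁ x₂ ^ p) ≤
        ENNReal.ofReal (E p * x₁ ^ (k₀ + 1 - p)))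
    (uin : ℝ → ℝ) (huin : CollFrag.MemXPos k₀ uin) (huin₁ : CollFrag.MemX 1 uin)
    (huin_add : CollFrag.MemX (1 + k₀) uin) (hmass : 0 < CollFrag.moment 1 uin) :
    ∃ u : ℝ → ℝ → ℝ,
      CollFrag.IsWeakSolution k₀ (CollFrag.collisionKernel l₁ l₂) β uin
        (CollFrag.existenceTime k₀ l₁ l₂ (E 1) uin) u ∧
      CollFrag.IsMassConserving uin (CollFrag.existenceTime k₀ l₁ l₂ (E 1) uin) u := by
  obtain ⟨δ, hκ⟩ := CollFrag.exists_fragKernel hk₀ hk₀' hp₀ hβs_meas hβs_nonneg hβs_mass hE_pos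
    hβs_bound
  have hk : CollFrag.Exponents k₀ l₁ l₂ := ⟨hk₀, hk₀', hl₁, hl₁₂, hl₂⟩
  obtain ⟨u, hu⟩ := CollFrag.exists_lipschitzSolution hk hκ huin huin_add hmass
  exact ⟨u, hu.isWeakSolution hk hκ hβ, hu.isMassConserving hk⟩
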